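/- Let $X_1,X_2,\dots$ be i.i.d. random variables with distribution function $F$ and quantile function $Q(s)=\inf\{x: F(x)\ge s\}$, and assume $Q(1-s)=s^{-\gamma}\ell(s)$ for $s\in(0,1)$, where $\gamma>0$ and $\ell$ is slowly varying at $0$. Let $X_{1,n}\le\dots\le X_{n,n}$ be the order statistics of $X_1,\dots,X_n$, let $1\le k_n\le n$ be integers with $k_n\to\infty$ and $k_n/n\to0$, and put $$S_n(p)=\frac1{k_n}\sum_{i=1}^{k_n}\Big(\log\frac{X_{n+1-i,n}}{X_{n-k_n,n}}\Big)^p .$$ With $U$ uniform on $(0,1)$ let $Y(v)=\log\frac{Q(1-Uv)}{Q(1-v)}$ for $v\in(0,1)$ and $Y(0)=-\gamma\log U$; let $m_p(v)=\mathbb E\,Y(v)^p$, $\sigma_p(v)^2=\mathrm{Var}(Y(v)^p)$ with $\sigma_p(v)\ge 0$, $m_p=m_p(0)=\gamma^p\Gamma(p+1)$ and $\sigma_p=\sigma_p(0)$, so that $\sigma_p^2=\gamma^{2p}(\Gamma(2p+1)-\Gamma(p+1)^2)$. Let $p_n=\alpha^{-1}\log k_n$. (i) If $\alpha>1$, then $\big(S_n(p_n)/\Gamma(p_n+1)\big)^{1/p_n}\to\gamma$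 in probability. (ii) If $\alpha>2$, and $U_1,U_2,\dots$ are i.i.d. uniform on $(0,1)$ on the same probability space with $X_i=Q(1-U_i)$ a.s. for each $i$ (the quantile representation), with order statistics $U_{1,n}\le\dots\le U_{n,n}$, then $$\frac{\sqrt{k_n}\,m_{p_n}(U_{k_n+1,n})}{\sigma_{p_n}(U_{k_n+1,n})}\,p_n\Big[\Big(\frac{S_n(p_n)}{m_{p_n}(U_{k_n+1,n})}\Big)^{1/p_n}-1\Big]\xrightarrow{\mathcal D}N(0,1).$$ (iii) Suppose $\alpha>2$ and that there is a function $a$, regularly varying at $0$, such that $$\limsup_{v\downarrow0}\sup_{u\in(0,1]}\frac{|\ell(uv)-\ell(v)|}{a(v)}<\infty,\qquad \lim_{v\downarrow0}\frac{a(v)}{\ell(v)}=0,\qquad p_n\frac{a(k_n/n)}{\ell(k_n/n)}\to0,$$ $$\limsup_{n\to\infty}p_n^{-1}\log\Big(\sqrt{k_n}\,\frac{a(k_n/n)}{\ell(k_n/n)}\Big)<\log2 .$$ Then $$\frac{\sqrt{k_n}\,m_{p_n}}{\sigma_{p_n}}\,p_n\Big[\Big(\frac{S_n(p_n)}{m_{p_n}}\Big)^{1/p_n}-1\Big]\xrightarrow{\mathcal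 D}N(0,1).$$ -/

import Mathlib

open MeasureTheory ProbabilityTheory Filter Topology Set

noncomputable section

namespace TailIndex

/-- The uniform distribution on `(0,1)`. -/
def unif01 : Measure ℝ := volume.restrict (Ioo 0 1)

/-- The quantile function `Q(s) = inf {x : F(x) ≥ s}` of a probability law `μ` on `ℝ` with
distribution function `F`; it is used only for `s ∈ (0,1)`. -/
def quantile (μ : Measure ℝ) (s : ℝ) : ℝ := sInf {x : ℝ | s ≤ cdf μ x}

/-- `f` is regularly varying at `0` (from the right) with index `ρ`: it is positive and
measurable on some interval `(0,δ)`, and `f(cs)/f(s) → c^ρ` as `s ↓ 0` for every `c > 0`. -/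
def RegVaryingAtZero (ρ : ℝ) (f : ℝ → ℝ) : Prop :=
  (∃ δ : ℝ, 0 < δ ∧ (∀ s ∈ Ioo 0 δ, 0 < f s) ∧ Measurable ((Ioo 0 δ).domRestrict f)) ∧
  ∀ c : ℝ, 0 < c → Tendsto (fun s => f (c * s) / f s) (𝓝[>] 0) (𝓝 (c ^ ρ))

/-- `f` is slowly varying at `0`: regularly varying with index `0`. -/
def SlowlyVaryingAtZero (f : ℝ → ℝ) : Prop := RegVaryingAtZero 0 f

/-- The `j`-th smallest value (`1 ≤ j ≤ n`) among the first `n` terms `x 0, …, x (n-1)`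
of a sequence. Outside `1 ≤ j ≤ n` the value is `0` by convention. -/
def orderStat (n : ℕ) (x : ℕ → ℝ) (j : ℕ) : ℝ :=
  if h : 1 ≤ j ∧ j ≤ n then
    x (Tuple.sort (fun i : Fin n => x i) ⟨j - 1, by omega⟩)
  else 0

/-- `S_n(p) = k⁻¹ ∑_{i=1}^{k} (log (X_{n+1-i,n} / X_{n-k,n}))^p` for the sample
`x 0, …, x (n-1)`. -/
def hillMoment (n k : ℕ) (p : ℝ) (x : ℕ → ℝ) : ℝ :=
  (1 / (k : ℝ)) * ∑ i ∈ Finset.Icc 1 k,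
    (Real.log (orderStat n x (n + 1 - i) / orderStat n x (n - k))) ^ p

/-- The variable `Y(v) = log (Q(1-uv)/Q(1-v))` for `v ≠ 0`, and `Y(0) = -γ log u`, as a function
of the uniform variable `u`. -/
def logExcess (γ : ℝ) (Q : ℝ → ℝ) (v u : ℝ) : ℝ :=
  if v = 0 then -γ * Real.log u else Real.log (Q (1 - u * v) / Q (1 - v))

/-- `m_p(v) = E Y(v)^p`; the limiting moment is `m_p = m_p(0) = E (-γ log U)^p`. -/
def excessMean (γ : ℝ) (Q : ℝ → ℝ) (p v : ℝ) : ℝ :=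
  ∫ u, (logExcess γ Q v u) ^ p ∂unif01

/-- `σ_p(v) = (Var Y(v)^p)^{1/2}`; the limiting quantity is
`σ_p = σ_p(0) = (Var (-γ log U)^p)^{1/2}`. -/
def excessStd (γ : ℝ) (Q : ℝ → ℝ) (p v : ℝ) : ℝ :=
  Real.sqrt (variance (fun u => (logExcess γ Q v u) ^ p) unif01)

/-- The second order condition
`limsup_{v ↓ 0} sup_{u ∈ (0,1]} |ℓ(uv) - ℓ(v)| / a(v) < ∞` together with
`lim_{v ↓ 0} a(v)/ℓ(v) = 0`, where `a` is regularly varying at `0`. -/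
structure SecondOrder (ℓ a : ℝ → ℝ) : Prop where
  regVarying : ∃ ρ : ℝ, RegVaryingAtZero ρ a
  bound : limsup (fun v : ℝ => ⨆ u ∈ Ioc (0 : ℝ) 1, ((|ℓ (u * v) - ℓ v| / a v : ℝ) : EReal))
    (𝓝[>] 0) < ⊤
  negligible : Tendsto (fun v => a v / ℓ v) (𝓝[>] 0) (𝓝 0)

end TailIndex

end

/-!
The statistic `S_n(p)` depends on the sample only through the excesses `log (X / X_{n-k,n})` of the
`k` largest observations. Writing `X = Q(1 - U)` with uniform `U` and conditioning on
`V = U_{k+1,n}`, the `k` smallest uniform variables become, up to their order, independent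
`V * w 1, …, V * w k` with uniform `w i`; hence `S_n(p)` has conditionally the law of the mean of `k`
independent copies of `Y(V) ^ p` (`lintegral_orderVal_hillVal`). This representation is proved by
symmetrization over the permutations of the sample, without conditional distributions. Since
`0 < V ≤ 2 k / n` with probability tending to one, a limit along *every* deterministic sequence
`v n ∈ (0, 2 k / n]` gives the limit for the random `V` (`tendsto_lintegral_order_hill`). All three
statements thus become statements about row-wise independent triangular arrays `Y(v n) ^ p n` with
`p n → ∞` and `k n = exp (α p n)`.

Because `Q` is monotone, slow variation along the single ratio `e⁻¹` yields a Potter bound without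
the uniform convergence theorem: for small `v`, the variable `Y(v)` lies between
`(γ - ε) (E - 1)` and `(γ + ε) (E + 1)`, where `E = -log u` is standard exponential
(`NearExp`, `nearExp_logExcess`). Shifting `E` by a constant multiplies its moments by a constant, so
that the moment of order `s` of `Y(v)` is `Γ(s + 1)` times a factor between constant multiples of
`(γ - ε) ^ s` and `(γ + ε) ^ s`, and the ratios of moments of orders `r a` and `a` are controlled by
Stirling-type bounds on `Γ` (`NearExp.moment_ratio_le`).

* Consistency needs `α > 1` only. The upper bound is Markov's inequality. For the lower bound one
  counts the excesses with `E` at least `p` up to a constant. Their expected number is of the order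
  `k exp (-p)`, which tends to infinity exactly when `α > 1`, and they alone contribute the order
  `p ^ p exp (-p)`, which is that of `Γ(p + 1)` up to a polynomial factor
  (`tendsto_measure_root_far`).
* For `α > 2` the Lyapunov condition of order `2 r` holds with `r` slightly above `1`, which gives the
  central limit theorem for `S_n(p)` (`tendsto_charFun_powerMean`). The standard error `σ_p / √k` is
  negligible relative to the mean `m_p`, so the `p`-th root may be linearized
  (`root_transform_locally_unif`, `tendsto_charFun_rootMean`).
* Under the second order condition, comparison of `ℓ(uv)` and `ℓ(v)` with `ℓ(2 k / n)` shows that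
  `Y(v)` is `γ E` up to a shift of order `a(k / n) / ℓ(k / n)`, uniformly in `v ≤ 2 k / n`
  (`nearExp_of_second_order`). Its moments are those of `γ E` up to a factor `1 + O(a / ℓ)`. As the
  ratio of mean to standard deviation is of order at most `p 2 ^ (-p)`, the resulting bias is
  negligible as soon as `√k a / ℓ` grows slower than `2 ^ p` at an exponential rate, which is the
  upper limit condition (`tendsto_charFun_fixed_centering`).
-/

namespace TailIndex

/-! ### Order statistics of a finite sample -/

/-- The `j`-th smallest value of a tuple, with value `0` outside `1 ≤ j ≤ n`: the version of
`orderStat` for samples indexed by `Fin n`. -/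
noncomputable def orderVal (n : ℕ) (x : Fin n → ℝ) (j : ℕ) : ℝ :=
  if h : 1 ≤ j ∧ j ≤ n then x (Tuple.sort x ⟨j - 1, by omega⟩) else 0

/-- The version of `hillMoment` for samples indexed by `Fin n`. -/
noncomputable def hillVal (n k : ℕ) (p : ℝ) (x : Fin n → ℝ) : ℝ :=
  (1 / (k : ℝ)) * ∑ i ∈ Finset.Icc 1 k,
    (Real.log (orderVal n x (n + 1 - i) / orderVal n x (n - k))) ^ p

theorem orderStat_eq_orderVal (n : ℕ) (x : ℕ → ℝ) (j : ℕ) :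
    orderStat n x j = orderVal n (fun i => x i) j := rfl

theorem hillMoment_eq_hillVal (n k : ℕ) (p : ℝ) (x : ℕ → ℝ) :
    hillMoment n k p x = hillVal n k p (fun i => x i) := rfl

theorem orderVal_comp_perm {n : ℕ} (x : Fin n → ℝ) (σ : Equiv.Perm (Fin n)) (j : ℕ) :
    orderVal n (x ∘ σ) j = orderVal n x j := by
  unfold orderVal
  split_ifs with h
  · exact congrFun (Tuple.comp_perm_comp_sort_eq_comp_sort (f := x) (σ := σ)) _
  · rfl

theorem hillVal_comp_perm {n : ℕ} (k : ℕ) (p : ℝ) (x : Fin n → ℝ) (σ : Equiv.Perm (Fin n)) :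
    hillVal n k p (x ∘ σ) = hillVal n k p x := by
  unfold hillVal
  simp only [orderVal_comp_perm]

theorem orderVal_of_monotone {n : ℕ} {x : Fin n → ℝ} {σ : Equiv.Perm (Fin n)}
    (h : Monotone (x ∘ σ)) {j : ℕ} (hj : 1 ≤ j ∧ j ≤ n) :
    orderVal n x j = x (σ ⟨j - 1, by omega⟩) := by
  unfold orderVal
  rw [dif_pos hj]
  exact (congrFun (Tuple.comp_sort_eq_comp_iff_monotone.2 h) _).symm

theorem measurableSet_sort_eq {n : ℕ} (σ : Equiv.Perm (Fin n)) :
    MeasurableSet {x : Fin n → ℝ | Tuple.sort x = σ} := by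
  have : {x : Fin n → ℝ | Tuple.sort x = σ} =
      {x | (∀ i j, i ≤ j → x (σ i) ≤ x (σ j)) ∧
        ∀ i j, i < j → x (σ i) = x (σ j) → σ i < σ j} := by
    ext x
    rw [mem_ofPred_eq, eq_comm, Tuple.eq_sort_iff]
    rfl
  rw [this]
  simp only [ofPred_and, ofPred_forall]
  refine MeasurableSet.inter ?_ ?_
  · refine MeasurableSet.iInter fun i => MeasurableSet.iInter fun j =>
      MeasurableSet.iInter fun _ => measurableSet_le (by fun_prop) (by fun_prop)
  · refine MeasurableSet.iInter fun i => MeasurableSet.iInter fun j =>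
      MeasurableSet.iInter fun _ => ?_
    by_cases h : σ i < σ j
    · simp [h]
    · have : {x : Fin n → ℝ | x (σ i) = x (σ j) → σ i < σ j} =
          {x | x (σ i) = x (σ j)}ᶜ := by ext x; simp [h]
      simp only [h, imp_false]
      exact (measurableSet_eq_fun (by fun_prop) (by fun_prop)).compl

theorem measurable_orderVal (n j : ℕ) : Measurable (fun x : Fin n → ℝ => orderVal n x j) := by
  unfold orderVal
  by_cases h : 1 ≤ j ∧ j ≤ n
  · simp only [dif_pos h]
    have : (fun x : Fin n → ℝ => x (Tuple.sort x ⟨j - 1, by omega⟩)) =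
        fun x => ∑ σ : Equiv.Perm (Fin n),
          {x : Fin n → ℝ | Tuple.sort x = σ}.indicator (fun x => x (σ ⟨j - 1, by omega⟩)) x := by
      ext x
      rw [Finset.sum_eq_single (Tuple.sort x)]
      · simp
      · intro σ _ hσ
        simp [hσ.symm]
      · simp
    rw [this]
    exact Finset.measurable_sum _ fun σ _ =>
      Measurable.indicator (by fun_prop) (measurableSet_sort_eq σ)
  · simp only [dif_neg h, measurable_const]

theorem measurable_hillVal (n k : ℕ) (p : ℝ) : Measurable (hillVal n k p) := by
  unfold hillVal
  refine Measurable.const_mul (Finset.measurable_sum _ fun i _ => ?_) _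
  exact (Real.measurable_log.comp
    ((measurable_orderVal _ _).div (measurable_orderVal _ _))).pow_const _

/-- The samples whose value at `κ` exceeds exactly the values at the indices below `κ`. -/
def pivotSet {n : ℕ} (κ : Fin n) : Set (Fin n → ℝ) :=
  {u | (∀ i, i < κ → u i < u κ) ∧ ∀ i, κ < i → u κ < u i}

theorem measurableSet_pivotSet {n : ℕ} (κ : Fin n) : MeasurableSet (pivotSet κ) := by
  unfold pivotSet
  simp only [ofPred_and, ofPred_forall]
  exact (MeasurableSet.iInter fun i => MeasurableSet.iInter fun _ =>
    measurableSet_lt (by fun_prop) (by fun_prop)).inter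
    (MeasurableSet.iInter fun i => MeasurableSet.iInter fun _ =>
    measurableSet_lt (by fun_prop) (by fun_prop))

theorem lt_pivot_iff {n : ℕ} {κ : Fin n} {u : Fin n → ℝ} (hu : u ∈ pivotSet κ) (i : Fin n) :
    u i < u κ ↔ i < κ := by
  refine ⟨fun h => ?_, hu.1 i⟩
  by_contra hi
  rcases (not_lt.1 hi).eq_or_lt with rfl | hi
  · exact lt_irrefl _ h
  · exact lt_asymm h (hu.2 i hi)

theorem le_pivot_iff {n : ℕ} {κ : Fin n} {u : Fin n → ℝ} (hu : u ∈ pivotSet κ) (i : Fin n) :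
    u i ≤ u κ ↔ i ≤ κ := by
  refine ⟨fun h => ?_, fun h => ?_⟩
  · by_contra hi
    exact absurd (hu.2 i (not_le.1 hi)) (not_lt.2 h)
  · rcases h.eq_or_lt with rfl | h
    · exact le_rfl
    · exact (hu.1 i h).le

theorem sort_lt_pivot_iff {n : ℕ} {κ : Fin n} {u : Fin n → ℝ} (hu : u ∈ pivotSet κ) (j : Fin n) :
    Tuple.sort u j < κ ↔ j < κ := by
  have h := Tuple.lt_card_lt_iff_apply_lt_of_monotone (j := j) (a := u κ) (Tuple.monotone_sort u)
  have hc : (Finset.univ.filter fun i => (u ∘ Tuple.sort u) i < u κ).card = κ := by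
    rw [show (κ : ℕ) = (Finset.univ.filter fun i => u i < u κ).card by
      simp [lt_pivot_iff hu, Finset.filter_gt_eq_Iio]]
    exact Finset.card_equiv (Tuple.sort u) (by simp)
  rw [hc] at h
  rw [← lt_pivot_iff hu]
  exact h.symm

theorem sort_pivot {n : ℕ} {κ : Fin n} {u : Fin n → ℝ} (hu : u ∈ pivotSet κ) :
    Tuple.sort u κ = κ := by
  have h := Tuple.lt_card_le_iff_apply_le_of_monotone (j := κ) (a := u κ) (Tuple.monotone_sort u)
  have hc : (Finset.univ.filter fun i => (u ∘ Tuple.sort u) i ≤ u κ).card = κ + 1 := by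
    rw [show (κ : ℕ) + 1 = (Finset.univ.filter fun i => u i ≤ u κ).card by
      simp [le_pivot_iff hu, Finset.filter_ge_eq_Iic]]
    exact Finset.card_equiv (Tuple.sort u) (by simp)
  rw [hc] at h
  have h1 := (le_pivot_iff hu _).1 (h.1 (Nat.lt_succ_self _))
  exact le_antisymm h1 (not_lt.1 fun h2 => lt_irrefl _ ((sort_lt_pivot_iff hu κ).1 h2))

theorem orderVal_pivot {n : ℕ} {κ : Fin n} {u : Fin n → ℝ} (hu : u ∈ pivotSet κ) :
    orderVal n u (κ + 1) = u κ := by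
  rw [orderVal_of_monotone (Tuple.monotone_sort u) ⟨by omega, by omega⟩]
  have : (⟨(κ : ℕ) + 1 - 1, by omega⟩ : Fin n) = κ := by ext; simp
  rw [this, sort_pivot hu]

/-- For a decreasing transformation `q` of a sample with pivot `κ`, the `κ` largest values are
those at the indices below `κ`. -/
theorem hillVal_pivot {n : ℕ} {κ : Fin n} {u : Fin n → ℝ} (hu : u ∈ pivotSet κ) {s : Set ℝ}
    (hus : ∀ i, u i ∈ s) {q : ℝ → ℝ} (hq : AntitoneOn q s) (p : ℝ) :
    hillVal n κ p (fun i => q (u i)) =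
      (1 / ((κ : ℕ) : ℝ)) * ∑ i : {i : Fin n // i < κ}, (Real.log (q (u i) / q (u κ))) ^ p := by
  have hmono : Monotone ((fun i => q (u i)) ∘ (Fin.revPerm.trans (Tuple.sort u))) := by
    intro i j hij
    simp only [Function.comp_apply, Equiv.trans_apply, Fin.revPerm_apply]
    exact hq (hus _) (hus _) (Tuple.monotone_sort u (Fin.rev_le_rev.2 hij))
  have hκ := κ.2
  have h1 : orderVal n (fun i => q (u i)) (n - κ) = q (u κ) := by
    rw [orderVal_of_monotone hmono ⟨by omega, by omega⟩]
    simp only [Equiv.trans_apply, Fin.revPerm_apply]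
    have : Fin.rev (⟨n - κ - 1, by omega⟩ : Fin n) = κ := by
      ext; simp only [Fin.val_rev]; omega
    rw [this, sort_pivot hu]
  unfold hillVal
  rw [h1]
  congr 1
  have h2 : ∑ i : {i : Fin n // i < κ}, (Real.log (q (u i) / q (u κ))) ^ p =
      ∑ i : {i : Fin n // i < κ}, (Real.log (q (u (Tuple.sort u i)) / q (u κ))) ^ p := by
    symm
    exact Fintype.sum_equiv ((Tuple.sort u).subtypeEquiv fun i => (sort_lt_pivot_iff hu i).symm)
      _ _ (fun i => rfl)
  rw [h2]
  refine Finset.sum_bij' (fun i hi => ⟨⟨i - 1, ?_⟩, ?_⟩) (fun i _ => (i : ℕ) + 1) ?_ ?_ ?_ ?_ ?_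
  · have := Finset.mem_Icc.1 hi; omega
  · have := Finset.mem_Icc.1 hi
    rw [Fin.lt_def]
    simp only; omega
  · simp
  · intro i _
    have := i.2
    rw [Fin.lt_def] at this
    rw [Finset.mem_Icc]; omega
  · intro i hi
    have := Finset.mem_Icc.1 hi
    simp only; omega
  · intro i _
    ext; simp
  · intro i hi
    have hi := Finset.mem_Icc.1 hi
    rw [orderVal_of_monotone hmono ⟨by omega, by omega⟩]
    simp only [Equiv.trans_apply, Fin.revPerm_apply]
    have : Fin.rev (⟨n + 1 - i - 1, by omega⟩ : Fin n) = ⟨i - 1, by omega⟩ := by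
      ext; simp only [Fin.val_rev]; omega
    rw [this]

theorem ae_injective_pi (n : ℕ) (ν : Measure ℝ) [IsProbabilityMeasure ν] [NullSingletonClass ν] :
    ∀ᵐ u ∂Measure.pi (fun _ : Fin n => ν), Function.Injective u := by
  have key : ∀ i j : Fin n, i ≠ j → ∀ᵐ u ∂Measure.pi (fun _ : Fin n => ν), u i ≠ u j := by
    intro i j hij
    have hind := iIndepFun_pi (μ := fun _ : Fin n => ν) (X := fun _ => (id : ℝ → ℝ))
      (fun _ => aemeasurable_id)
    simp only [id] at hind
    have hp := (indepFun_iff_map_prod_eq_prod_map_map (measurable_pi_apply i).aemeasurable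
      (measurable_pi_apply j).aemeasurable).1
      (hind.indepFun hij)
    rw [show (fun ω : Fin n → ℝ => ω i) = Function.eval i from rfl,
      show (fun ω : Fin n → ℝ => ω j) = Function.eval j from rfl,
      (measurePreserving_eval (fun _ : Fin n => ν) i).map_eq,
      (measurePreserving_eval (fun _ : Fin n => ν) j).map_eq] at hp
    have hd : MeasurableSet {z : ℝ × ℝ | z.1 = z.2} :=
      measurableSet_eq_fun measurable_fst measurable_snd
    have h0 : (ν.prod ν) {z : ℝ × ℝ | z.1 = z.2} = 0 := by
      rw [Measure.measure_prod_null hd]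
      refine Eventually.of_forall fun x => ?_
      have : Prod.mk x ⁻¹' {z : ℝ × ℝ | z.1 = z.2} = {x} := by ext y; simp [eq_comm]
      simp only [this, measure_singleton, Pi.zero_apply]
    rw [← hp, Measure.map_apply (by fun_prop) hd] at h0
    exact measure_eq_zero_iff_ae_notMem.1 h0
  have : ∀ᵐ u ∂Measure.pi (fun _ : Fin n => ν), ∀ i j : Fin n, i ≠ j → u i ≠ u j := by
    simp only [ae_all_iff]
    exact fun i j h => key i j h
  filter_upwards [this] with u hu i j h
  by_contra hne
  exact hu i j hne h

theorem measurePreserving_comp_perm {n : ℕ} (ν : Measure ℝ) [IsProbabilityMeasure ν]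
    (σ : Equiv.Perm (Fin n)) :
    MeasurePreserving (fun u : Fin n → ℝ => u ∘ σ) (Measure.pi fun _ => ν)
      (Measure.pi fun _ => ν) := by
  have h := (measurePreserving_piCongrLeft (α := fun _ : Fin n => ℝ) (fun _ => ν) σ.symm)
  convert! h using 1
  ext u i
  simp [MeasurableEquiv.piCongrLeft, Equiv.piCongrLeft, Equiv.piCongrLeft']

/-- The number of relabellings that put an injective sample into `pivotSet κ` does not depend on
the sample; it is this number. -/
noncomputable def pivotCount {n : ℕ} (κ : Fin n) : ℕ := by
  classical
  exact (Finset.univ.filter fun τ : Equiv.Perm (Fin n) =>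
    (∀ i, i < κ → τ i < τ κ) ∧ ∀ i, κ < i → τ κ < τ i).card

theorem pivotCount_ne_zero {n : ℕ} (κ : Fin n) : pivotCount κ ≠ 0 := by
  classical
  unfold pivotCount
  exact Finset.card_ne_zero_of_mem (a := 1) (by simp)

theorem sum_indicator_pivotSet {n : ℕ} (κ : Fin n) {u : Fin n → ℝ} (hu : Function.Injective u) :
    ∑ τ : Equiv.Perm (Fin n), (pivotSet κ).indicator (fun _ => (1 : ENNReal)) (u ∘ τ) =
      pivotCount κ := by
  classical
  have hs : StrictMono (u ∘ Tuple.sort u) :=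
    (Tuple.monotone_sort u).strictMono_of_injective (hu.comp (Tuple.sort u).injective)
  unfold pivotCount
  rw [Finset.card_filter, Nat.cast_sum]
  refine (Equiv.sum_comp (Equiv.mulLeft (Tuple.sort u)) _).symm.trans
    (Finset.sum_congr rfl fun τ _ => ?_)
  have h1 : ∀ i j, u (Tuple.sort u (τ i)) < u (Tuple.sort u (τ j)) ↔ τ i < τ j :=
    fun i j => hs.lt_iff_lt
  simp [indicator_apply, pivotSet, h1]

/-- For an i.i.d. sample from a law without atoms, integrals of symmetric functions are
proportional to their integrals over `pivotSet κ`. -/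
theorem lintegral_symmetric_eq {n : ℕ} (κ : Fin n) (ν : Measure ℝ) [IsProbabilityMeasure ν]
    [NullSingletonClass ν] {Φ : (Fin n → ℝ) → ENNReal} (hΦ : Measurable Φ)
    (hsym : ∀ u, ∀ σ : Equiv.Perm (Fin n), Φ (u ∘ σ) = Φ u) :
    pivotCount κ * ∫⁻ u, Φ u ∂(Measure.pi fun _ => ν) =
      (Fintype.card (Equiv.Perm (Fin n)) : ENNReal) *
        ∫⁻ u in pivotSet κ, Φ u ∂(Measure.pi fun _ => ν) := by
  have hm := measurableSet_pivotSet κ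
  calc pivotCount κ * ∫⁻ u, Φ u ∂(Measure.pi fun _ => ν)
      = ∫⁻ u, ∑ τ : Equiv.Perm (Fin n), (pivotSet κ).indicator Φ (u ∘ τ)
          ∂(Measure.pi fun _ => ν) := by
        rw [← lintegral_const_mul _ hΦ]
        refine lintegral_congr_ae ?_
        filter_upwards [ae_injective_pi n ν] with u hu
        rw [← sum_indicator_pivotSet κ hu, Finset.sum_mul]
        refine Finset.sum_congr rfl fun τ _ => ?_
        by_cases h : u ∘ τ ∈ pivotSet κ <;> simp [h, hsym]
    _ = ∑ τ : Equiv.Perm (Fin n), ∫⁻ u, (pivotSet κ).indicator Φ (u ∘ τ)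
          ∂(Measure.pi fun _ => ν) :=
        lintegral_finsetSum _ fun τ _ => (hΦ.indicator hm).comp
          (measurePreserving_comp_perm ν τ).measurable
    _ = ∑ τ : Equiv.Perm (Fin n), ∫⁻ u in pivotSet κ, Φ u ∂(Measure.pi fun _ => ν) := by
        refine Finset.sum_congr rfl fun τ _ => ?_
        rw [(measurePreserving_comp_perm ν τ).lintegral_comp (hΦ.indicator hm),
          lintegral_indicator hm]
    _ = _ := by simp

/-! ### Conditioning on an order statistic of a uniform sample -/

instance : IsProbabilityMeasure unif01 := ⟨by simp [unif01]⟩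

instance : NullSingletonClass unif01 := by unfold unif01; infer_instance

theorem ae_unif01 : ∀ᵐ u ∂unif01, u ∈ Ioo (0 : ℝ) 1 :=
  ae_restrict_mem measurableSet_Ioo

theorem ae_pi_unif01 (ι : Type*) [Fintype ι] :
    ∀ᵐ u ∂Measure.pi (fun _ : ι => unif01), ∀ i, u i ∈ Ioo (0 : ℝ) 1 := by
  rw [ae_all_iff]
  intro i
  exact (Measure.quasiMeasurePreserving_eval (fun _ : ι => unif01) i).ae ae_unif01

/-- A uniform variable restricted to `(0,v)` is a rescaled uniform variable. -/
theorem unif01_restrict_Iio {v : ℝ} (hv : v ∈ Ioc (0 : ℝ) 1) :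
    unif01.restrict (Iio v) = ENNReal.ofReal v • unif01.map (fun w => v * w) := by
  ext s hs
  have hm : Measurable fun w : ℝ => v * w := by fun_prop
  rw [Measure.smul_apply, Measure.map_apply hm hs, Measure.restrict_apply hs, unif01,
    Measure.restrict_apply (hs.inter measurableSet_Iio), Measure.restrict_apply (hm hs)]
  have h1 : s ∩ Iio v ∩ Ioo 0 1 = s ∩ Ioo 0 v := by
    ext x
    simp only [mem_inter_iff, mem_Iio, mem_Ioo]
    have := hv.2
    constructor
    · rintro ⟨⟨h1, h2⟩, h3, h4⟩; exact ⟨h1, h3, h2⟩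
    · rintro ⟨h1, h3, h2⟩; exact ⟨⟨h1, h2⟩, h3, by linarith⟩
  have h2 : (fun w => v * w) ⁻¹' s ∩ Ioo 0 1 = (fun w => v * w) ⁻¹' (s ∩ Ioo 0 v) := by
    ext x
    simp only [mem_inter_iff, mem_preimage, mem_Ioo]
    rw [mul_pos_iff_of_pos_left hv.1, mul_lt_iff_lt_one_right hv.1]
  rw [h1, h2, Real.volume_preimage_mul_left hv.1.ne', smul_eq_mul, ← mul_assoc,
    ← ENNReal.ofReal_mul hv.1.le, abs_of_pos (inv_pos.2 hv.1), mul_inv_cancel₀ hv.1.ne']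
  simp

/-- The product version of `unif01_restrict_Iio`, up to a constant. -/
theorem pi_unif01_restrict_Iio (ι : Type*) [Fintype ι] {v : ℝ} (hv : v ∈ Ioc (0 : ℝ) 1) :
    (Measure.pi fun _ : ι => unif01).restrict (Set.pi univ fun _ => Iio v) =
      ENNReal.ofReal v ^ Fintype.card ι •
        (Measure.pi fun _ : ι => unif01).map (fun w i => v * w i) := by
  have hp : IsProbabilityMeasure (unif01.map (fun w => v * w)) :=
    Measure.isProbabilityMeasure_map (by fun_prop)
  rw [Measure.restrict_pi_pi, Measure.pi_map_pi (fun _ => by fun_prop)]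
  refine Measure.pi_eq fun s hs => ?_
  rw [Measure.smul_apply, Measure.pi_pi, smul_eq_mul]
  simp only [unif01_restrict_Iio hv, Measure.smul_apply, smul_eq_mul, Finset.prod_mul_distrib,
    Finset.prod_const, Finset.card_univ]

/-- Given its pivot value `u κ`, the smaller values of a uniform sample are distributed like
independent uniform variables rescaled by `u κ`. -/
theorem setLIntegral_pivotSet {n : ℕ} (κ : Fin n) {G : ℝ × ({i : Fin n // i < κ} → ℝ) → ENNReal}
    (hG : Measurable G) :
    ∫⁻ u in pivotSet κ, G (u κ, fun i => u i) ∂(Measure.pi fun _ => unif01) =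
      ∫⁻ u in pivotSet κ, (∫⁻ w, G (u κ, fun i => u κ * w i) ∂(Measure.pi fun _ => unif01))
        ∂(Measure.pi fun _ => unif01) := by
  -- splitting off the coordinates below `κ` turns the pivot event into a product condition
  have hsplit : ∀ K : ℝ × ({i : Fin n // i < κ} → ℝ) → ENNReal, Measurable K →
      ∫⁻ u in pivotSet κ, K (u κ, fun i => u i) ∂(Measure.pi fun _ => unif01) =
      ∫⁻ y : {i : Fin n // ¬ i < κ} → ℝ,
        {y : {i : Fin n // ¬ i < κ} → ℝ | ∀ i : {i : Fin n // ¬ i < κ}, κ < i →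
            y ⟨κ, lt_irrefl _⟩ < y i}.indicator
          (fun y => ∫⁻ x in Set.pi univ fun _ => Iio (y ⟨κ, lt_irrefl _⟩),
            K (y ⟨κ, lt_irrefl _⟩, x) ∂(Measure.pi fun _ => unif01)) y
        ∂(Measure.pi fun _ => unif01) := by
    intro K hK
    set κ' : {i : Fin n // ¬ i < κ} := ⟨κ, lt_irrefl _⟩
    set A : Set ({i : Fin n // ¬ i < κ} → ℝ) := {y | ∀ i : {i : Fin n // ¬ i < κ}, κ < i →
      y κ' < y i} with hA
    have hAm : MeasurableSet A := by
      simp only [hA, ofPred_forall]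
      exact MeasurableSet.iInter fun i => MeasurableSet.iInter fun _ =>
        measurableSet_lt (by fun_prop) (by fun_prop)
    set B : Set (({i : Fin n // i < κ} → ℝ) × ({i : Fin n // ¬ i < κ} → ℝ)) :=
      {z | ∀ i, z.1 i < z.2 κ'} with hB
    have hBm : MeasurableSet B := by
      simp only [hB, ofPred_forall]
      exact MeasurableSet.iInter fun i => measurableSet_lt (by fun_prop) (by fun_prop)
    have hmp := measurePreserving_piEquivPiSubtypeProd (α := fun _ : Fin n => ℝ)
      (fun _ => unif01) (fun i => i < κ)
    set F : ({i : Fin n // i < κ} → ℝ) × ({i : Fin n // ¬ i < κ} → ℝ) → ENNReal :=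
      (B ∩ Prod.snd ⁻¹' A).indicator fun z => K (z.2 κ', z.1) with hF
    have hFm : Measurable F := Measurable.indicator
      (hK.comp (by fun_prop)) (hBm.inter (measurable_snd hAm))
    have h1 : ∫⁻ u in pivotSet κ, K (u κ, fun i => u i) ∂(Measure.pi fun _ => unif01) =
        ∫⁻ u, F (MeasurableEquiv.piEquivPiSubtypeProd (fun _ : Fin n => ℝ) (fun i => i < κ) u)
          ∂(Measure.pi fun _ => unif01) := by
      rw [← lintegral_indicator (measurableSet_pivotSet κ)]
      refine lintegral_congr fun u => ?_
      have : u ∈ pivotSet κ ↔ MeasurableEquiv.piEquivPiSubtypeProd (fun _ : Fin n => ℝ)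
          (fun i => i < κ) u ∈ B ∩ Prod.snd ⁻¹' A := by
        simp only [pivotSet, hA, hB, mem_inter_iff, mem_ofPred_eq, mem_preimage]
        refine and_congr ⟨fun h i => h i i.2, fun h i hi => h ⟨i, hi⟩⟩
          ⟨fun h i hi => h i hi, fun h i hi => h ⟨i, not_lt.2 hi.le⟩ hi⟩
      by_cases h : u ∈ pivotSet κ
      · rw [indicator_of_mem h, hF, indicator_of_mem (this.1 h)]
        rfl
      · rw [indicator_of_notMem h, hF, indicator_of_notMem (fun h' => h (this.2 h'))]
    rw [h1, hmp.lintegral_comp hFm, lintegral_prod_symm _ hFm.aemeasurable]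
    refine lintegral_congr fun y => ?_
    by_cases hy : y ∈ A
    · rw [indicator_of_mem hy, ← lintegral_indicator
        (MeasurableSet.univ_pi fun _ => measurableSet_Iio)]
      refine lintegral_congr fun x => ?_
      by_cases hx : x ∈ Set.pi univ fun _ => Iio (y κ')
      · have : (x, y) ∈ B ∩ Prod.snd ⁻¹' A := ⟨fun i => hx i (mem_univ i), hy⟩
        rw [indicator_of_mem hx, hF, indicator_of_mem this]
      · have : (x, y) ∉ B ∩ Prod.snd ⁻¹' A := fun h => hx fun i _ => h.1 i
        rw [indicator_of_notMem hx, hF, indicator_of_notMem this]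
    · rw [indicator_of_notMem hy]
      have : ∀ x, F (x, y) = 0 := fun x => indicator_of_notMem (fun h => hy h.2) _
      simp [this]
  have hinner : Measurable fun v : ℝ => ∫⁻ w : {i : Fin n // i < κ} → ℝ, G (v, fun i => v * w i)
      ∂(Measure.pi fun _ => unif01) := by
    refine Measurable.lintegral_prod_right'
      (f := fun z : ℝ × ({i : Fin n // i < κ} → ℝ) => G (z.1, fun i => z.1 * z.2 i))
      (hG.comp (by fun_prop))
  rw [hsplit G hG, hsplit (fun z => ∫⁻ w, G (z.1, fun i => z.1 * w i)
    ∂(Measure.pi fun _ => unif01)) (hinner.comp measurable_fst)]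
  refine lintegral_congr_ae ?_
  filter_upwards [ae_pi_unif01 {i : Fin n // ¬ i < κ}] with y hy
  simp only [indicator_apply]
  congr 1
  have hv := hy ⟨κ, lt_irrefl _⟩
  set v := y ⟨κ, lt_irrefl _⟩
  rw [pi_unif01_restrict_Iio _ ⟨hv.1, hv.2.le⟩]
  rw [lintegral_smul_measure, lintegral_smul_measure, lintegral_map (by fun_prop) (by fun_prop),
    lintegral_const, Measure.map_apply (by fun_prop) MeasurableSet.univ]
  simp

/-! ### The quantile function -/

theorem quantile_le_iff (μ : Measure ℝ) [IsProbabilityMeasure μ] {s : ℝ} (hs : s ∈ Ioo (0 : ℝ) 1)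
    (x : ℝ) : quantile μ s ≤ x ↔ s ≤ cdf μ x := by
  have hne : {x : ℝ | s ≤ cdf μ x}.Nonempty := by
    obtain ⟨y, hy⟩ := ((tendsto_cdf_atTop μ).eventually (lt_mem_nhds hs.2)).exists
    exact ⟨y, hy.le⟩
  obtain ⟨b, hb⟩ := ((tendsto_cdf_atBot μ).eventually (gt_mem_nhds hs.1)).exists
  have hbdd : BddBelow {x : ℝ | s ≤ cdf μ x} := by
    refine ⟨b, fun y hy => ?_⟩
    by_contra hlt
    exact absurd (lt_of_le_of_lt (le_trans hy (monotone_cdf μ (not_le.1 hlt).le)) hb)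
      (lt_irrefl _)
  constructor
  · intro h
    -- right continuity of the distribution function
    have hlim : Tendsto (cdf μ) (𝓝[>] x) (𝓝 (cdf μ x)) :=
      ((cdf μ).right_continuous x).mono_left (nhdsWithin_mono _ Ioi_subset_Ici_self)
    refine ge_of_tendsto hlim ?_
    filter_upwards [self_mem_nhdsWithin] with y hy
    obtain ⟨z, hz, hzy⟩ := exists_lt_of_csInf_lt hne (lt_of_le_of_lt h hy)
    exact le_trans hz (monotone_cdf μ hzy.le)
  · intro h
    exact csInf_le hbdd h

theorem monotoneOn_quantile (μ : Measure ℝ) [IsProbabilityMeasure μ] :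
    MonotoneOn (quantile μ) (Ioo 0 1) := by
  intro s hs t ht hst
  rw [quantile_le_iff μ hs]
  exact hst.trans ((quantile_le_iff μ ht _).1 le_rfl)

theorem antitoneOn_quantile_one_sub (μ : Measure ℝ) [IsProbabilityMeasure μ] :
    AntitoneOn (fun u => quantile μ (1 - u)) (Ioo 0 1) := by
  intro s hs t ht hst
  exact monotoneOn_quantile μ ⟨by linarith [ht.2], by linarith [ht.1]⟩
    ⟨by linarith [hs.2], by linarith [hs.1]⟩ (by linarith)

theorem measurable_quantile (μ : Measure ℝ) [IsProbabilityMeasure μ] :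
    Measurable (quantile μ) := by
  refine measurable_of_Iic fun x => ?_
  -- outside `(0,1]` the quantile function takes its default value `0`
  have h1 : quantile μ ⁻¹' Iic x = (Ioo 0 1 ∩ Iic (cdf μ x)) ∪
      ({1} ∩ {_s : ℝ | quantile μ 1 ≤ x}) ∪ ((Iic 0 ∪ Ioi 1) ∩ {_s : ℝ | (0 : ℝ) ≤ x}) := by
    ext s
    simp only [mem_preimage, mem_Iic, mem_union, mem_inter_iff, mem_singleton_iff, mem_Ioi,
      mem_ofPred_eq]
    rcases le_or_gt s 0 with h0 | h0
    · have : quantile μ s = 0 := by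
        have : {x : ℝ | s ≤ cdf μ x} = univ := by
          ext y; simpa using h0.trans (cdf_nonneg μ y)
        rw [quantile, this, Real.sInf_univ]
      have h2 : ¬ s ∈ Ioo (0 : ℝ) 1 := fun h => absurd h.1 (not_lt.2 h0)
      have h3 : s ≠ 1 := by rintro rfl; linarith
      simp [this, h0, h2, h3]
    · rcases lt_trichotomy s 1 with h | h | h
      · have hs : s ∈ Ioo (0 : ℝ) 1 := ⟨h0, h⟩
        have h3 : ¬ (s ≤ 0 ∨ 1 < s) := by push Not; exact ⟨h0, h.le⟩
        simp [quantile_le_iff μ hs, hs, h.ne, h3]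
      · subst h; simp
      · have : quantile μ s = 0 := by
          have : {x : ℝ | s ≤ cdf μ x} = ∅ := by
            ext y
            simpa using (cdf_le_one μ y).trans_lt h
          rw [quantile, this, Real.sInf_empty]
        have h2 : ¬ s ∈ Ioo (0 : ℝ) 1 := fun h' => absurd h'.2 (not_lt.2 h.le)
        simp [this, h, h2, h.ne']
  rw [h1]
  exact ((measurableSet_Ioo.inter measurableSet_Iic).union
    ((measurableSet_singleton _).inter (MeasurableSet.const _))).union
    ((measurableSet_Iic.union measurableSet_Ioi).inter (MeasurableSet.const _))

/-- The quantile transform of a uniform variable has law `μ`. -/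
theorem map_quantile_unif01 (μ : Measure ℝ) [IsProbabilityMeasure μ] :
    unif01.map (fun u => quantile μ (1 - u)) = μ := by
  have hm : Measurable fun u : ℝ => quantile μ (1 - u) :=
    (measurable_quantile μ).comp (by fun_prop)
  have := Measure.isProbabilityMeasure_map (μ := unif01) hm.aemeasurable
  refine Measure.ext_of_Iic _ _ fun x => ?_
  rw [Measure.map_apply hm measurableSet_Iic, ← ofReal_cdf, unif01,
    Measure.restrict_apply (hm measurableSet_Iic)]
  have h1 : (fun u => quantile μ (1 - u)) ⁻¹' Iic x ∩ Ioo 0 1 =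
      Ico (1 - cdf μ x) 1 ∩ Ioo 0 1 := by
    ext u
    simp only [mem_inter_iff, mem_preimage, mem_Iic, mem_Ico]
    refine and_congr_left fun hu => ?_
    rw [quantile_le_iff μ ⟨by linarith [hu.2], by linarith [hu.1]⟩]
    constructor
    · intro h; exact ⟨by linarith, hu.2⟩
    · intro h; linarith [h.1]
  have h2 : (Ico (1 - cdf μ x) 1 ∩ Ioo 0 1 : Set ℝ) =ᵐ[volume] Ico (1 - cdf μ x) 1 := by
    have h3 : Ico (1 - cdf μ x) 1 ∩ Ioo 0 1 = Ico (1 - cdf μ x) 1 \ {0} := by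
      ext u
      have := cdf_le_one μ x
      simp only [mem_inter_iff, mem_Ico, mem_Ioo, Set.mem_sdiff, mem_singleton_iff]
      constructor
      · rintro ⟨h, h'⟩; exact ⟨h, h'.1.ne'⟩
      · rintro ⟨h, h'⟩
        exact ⟨h, lt_of_le_of_ne (by linarith [h.1]) (Ne.symm h'), h.2⟩
    rw [h3]
    exact sdiff_null_ae_eq_self (by simp)
  rw [h1, measure_congr h2, Real.volume_Ico]
  congr 1; ring

/-! ### The excess variables -/

theorem measurable_logExcess {Q : ℝ → ℝ} (hQ : Measurable Q) (γ : ℝ) :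
    Measurable (fun z : ℝ × ℝ => logExcess γ Q z.1 z.2) := by
  unfold logExcess
  refine Measurable.ite (measurable_fst (measurableSet_singleton 0)) (by fun_prop) ?_
  exact Real.measurable_log.comp ((hQ.comp (by fun_prop)).div (hQ.comp (by fun_prop)))

theorem measurable_logExcess_right {Q : ℝ → ℝ} (hQ : Measurable Q) (γ v : ℝ) :
    Measurable (logExcess γ Q v) :=
  (measurable_logExcess hQ γ).comp measurable_prodMk_left

theorem measurable_excessMean {Q : ℝ → ℝ} (hQ : Measurable Q) (γ p : ℝ) :
    Measurable (excessMean γ Q p) := by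
  unfold excessMean
  exact (StronglyMeasurable.integral_prod_right'
    (f := fun z : ℝ × ℝ => logExcess γ Q z.1 z.2 ^ p)
    ((measurable_logExcess hQ γ).pow_const p).stronglyMeasurable).measurable

theorem measurable_excessStd {Q : ℝ → ℝ} (hQ : Measurable Q) (γ p : ℝ) :
    Measurable (excessStd γ Q p) := by
  unfold excessStd variance evariance
  refine Real.continuous_sqrt.measurable.comp (Measurable.ennreal_toReal ?_)
  refine Measurable.lintegral_prod_right'
    (f := fun z : ℝ × ℝ => ‖logExcess γ Q z.1 z.2 ^ p - excessMean γ Q p z.1‖ₑ ^ 2) ?_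
  exact (((measurable_logExcess hQ γ).pow_const p).sub
    ((measurable_excessMean hQ γ p).comp measurable_fst)).enorm.pow_const 2

/-- The empirical counterpart of `excessMean`, for a sample `w` of size `k`. -/
noncomputable def sampleMean (γ : ℝ) (Q : ℝ → ℝ) (k : ℕ) (p v : ℝ) (w : Fin k → ℝ) : ℝ :=
  (1 / (k : ℝ)) * ∑ i, logExcess γ Q v (w i) ^ p

theorem measurable_sampleMean {Q : ℝ → ℝ} (hQ : Measurable Q) (γ : ℝ) (k : ℕ) (p : ℝ) :
    Measurable (fun z : ℝ × (Fin k → ℝ) => sampleMean γ Q k p z.1 z.2) := by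
  unfold sampleMean
  refine Measurable.const_mul (Finset.measurable_sum _ fun i _ => ?_) _
  exact ((measurable_logExcess hQ γ).comp
    (g := fun z : ℝ × ℝ => logExcess γ Q z.1 z.2)
    (f := fun z : ℝ × (Fin k → ℝ) => (z.1, z.2 i)) (by fun_prop)).pow_const p

/-- Conditionally on the order statistic `V = U_{k+1,n}`, the moment statistic of the `k` largest
observations is distributed like the mean of `k` independent copies of `Y(V)^p`. -/
theorem lintegral_orderVal_hillVal (μ : Measure ℝ) [IsProbabilityMeasure μ] (γ : ℝ) {n k : ℕ}
    (hkn : k < n) (p : ℝ) {H : ℝ × ℝ → ENNReal} (hH : Measurable H) :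
    ∫⁻ u, H (orderVal n u (k + 1), hillVal n k p (fun i => quantile μ (1 - u i)))
        ∂(Measure.pi fun _ : Fin n => unif01) =
      ∫⁻ u, (∫⁻ w, H (orderVal n u (k + 1), sampleMean γ (quantile μ) k p (orderVal n u (k + 1)) w)
        ∂(Measure.pi fun _ : Fin k => unif01)) ∂(Measure.pi fun _ : Fin n => unif01) := by
  set κ : Fin n := ⟨k, hkn⟩ with hκ
  set Q := quantile μ with hQdef
  have hQ : Measurable Q := measurable_quantile μ
  have hq : Measurable fun u : ℝ => Q (1 - u) := hQ.comp (by fun_prop)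
  set Ψ : ℝ → ENNReal := fun v => ∫⁻ w, H (v, sampleMean γ Q k p v w)
        ∂(Measure.pi fun _ : Fin k => unif01) with hΨdef
  have hΨ : Measurable Ψ := by
    refine Measurable.lintegral_prod_right'
      (f := fun z : ℝ × (Fin k → ℝ) => H (z.1, sampleMean γ Q k p z.1 z.2)) ?_
    exact hH.comp (measurable_fst.prodMk (measurable_sampleMean hQ γ k p))
  have hΦ1 : Measurable fun u : Fin n → ℝ =>
      H (orderVal n u (k + 1), hillVal n k p (fun i => Q (1 - u i))) :=
    hH.comp ((measurable_orderVal n (k + 1)).prodMk ((measurable_hillVal n k p).comp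
      (measurable_pi_lambda _ fun i => hq.comp (measurable_pi_apply i))))
  have hΦ2 : Measurable fun u : Fin n → ℝ => Ψ (orderVal n u (k + 1)) :=
    hΨ.comp (measurable_orderVal n (k + 1))
  have hs1 := lintegral_symmetric_eq κ unif01 hΦ1 (fun u σ => by
    rw [orderVal_comp_perm, ← hillVal_comp_perm k p (fun i => Q (1 - u i)) σ]; rfl)
  have hs2 := lintegral_symmetric_eq κ unif01 hΦ2 (fun u σ => by rw [orderVal_comp_perm])
  set G : ℝ × ({i : Fin n // i < κ} → ℝ) → ENNReal := fun z =>
    H (z.1, (1 / (k : ℝ)) * ∑ i, (Real.log (Q (1 - z.2 i) / Q (1 - z.1))) ^ p) with hGdef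
  have hG : Measurable G := by
    refine hH.comp (measurable_fst.prodMk
      (Measurable.const_mul (Finset.measurable_sum _ fun i _ => ?_) _))
    exact (Real.measurable_log.comp ((hq.comp (by fun_prop)).div (hq.comp (by fun_prop)))).pow_const
      p
  have hpiv := setLIntegral_pivotSet κ hG
  have hA : ∫⁻ u in pivotSet κ, H (orderVal n u (k + 1), hillVal n k p (fun i => Q (1 - u i)))
        ∂(Measure.pi fun _ : Fin n => unif01) =
      ∫⁻ u in pivotSet κ, G (u κ, fun i => u i) ∂(Measure.pi fun _ => unif01) := by
    refine setLIntegral_congr_fun_ae (measurableSet_pivotSet κ) ?_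
    filter_upwards [ae_pi_unif01 (Fin n)] with u hu hpv
    have h1 := orderVal_pivot hpv
    have h2 := hillVal_pivot hpv hu (antitoneOn_quantile_one_sub μ) p
    simp only [hκ] at h1 h2
    rw [h1, h2]
  have hB : ∫⁻ u in pivotSet κ, Ψ (orderVal n u (k + 1)) ∂(Measure.pi fun _ : Fin n => unif01) =
      ∫⁻ u in pivotSet κ, (∫⁻ w, G (u κ, fun i => u κ * w i) ∂(Measure.pi fun _ => unif01))
        ∂(Measure.pi fun _ => unif01) := by
    refine setLIntegral_congr_fun_ae (measurableSet_pivotSet κ) ?_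
    filter_upwards [ae_pi_unif01 (Fin n)] with u hu hpv
    have h1 := orderVal_pivot hpv
    simp only [hκ] at h1
    rw [h1]
    set v := u κ with hv
    have hv0 : v ≠ 0 := (hu κ).1.ne'
    let e : Fin k ≃ {i : Fin n // i < κ} :=
      { toFun := fun i => ⟨⟨i, i.2.trans hkn⟩, i.2⟩
        invFun := fun i => ⟨i, i.2⟩
        left_inv := fun i => rfl
        right_inv := fun i => rfl }
    have hmp := measurePreserving_piCongrLeft (α := fun _ : {i : Fin n // i < κ} => ℝ)
      (fun _ => unif01) e
    rw [← hmp.lintegral_comp (f := fun w => G (v, fun i => v * w i)) (by fun_prop)]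
    refine lintegral_congr fun w => ?_
    simp only [hGdef, sampleMean, logExcess, if_neg hv0]
    rw [← e.sum_comp]
    congr 4
    ext i
    rw [MeasurableEquiv.coe_piCongrLeft, Equiv.piCongrLeft_apply_apply, mul_comm]
  have hfin : (pivotCount κ : ENNReal) * ∫⁻ u, H (orderVal n u (k + 1),
        hillVal n k p (fun i => Q (1 - u i))) ∂(Measure.pi fun _ : Fin n => unif01) =
      pivotCount κ * ∫⁻ u, Ψ (orderVal n u (k + 1)) ∂(Measure.pi fun _ : Fin n => unif01) := by
    rw [hs1, hs2, hA, hB, hpiv]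
  exact (ENNReal.mul_right_inj (by exact_mod_cast pivotCount_ne_zero κ)
    (ENNReal.natCast_ne_top _)).1 hfin

/-! ### Reduction to deterministic values of the order statistic -/

/-- Chebyshev's inequality for the number of sample points in a set `A`: the count is rarely below
half of its mean. -/
theorem measure_count_le (ι : Type*) [Fintype ι] (ρ : Measure ℝ) [IsProbabilityMeasure ρ]
    {A : Set ℝ} (hA : MeasurableSet A) (hpos : 0 < Fintype.card ι * ρ.real A) :
    (Measure.pi fun _ : ι => ρ) {w | ∑ i, A.indicator (fun _ => (1 : ℝ)) (w i) ≤
        Fintype.card ι * ρ.real A / 2} ≤ ENNReal.ofReal (4 / (Fintype.card ι * ρ.real A)) := by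
  set f : ℝ → ℝ := A.indicator fun _ => (1 : ℝ) with hf
  set N : ℝ := Fintype.card ι * ρ.real A with hN
  have hfm : Measurable f := measurable_const.indicator hA
  have hfL : MemLp f 2 ρ := MemLp.of_bound hfm.aestronglyMeasurable 1
    (Eventually.of_forall fun x => by
      by_cases hx : x ∈ A <;> simp [hf, hx])
  have hint : ∫ x, f x ∂ρ = ρ.real A := by
    rw [hf, integral_indicator hA]; simp
  have hvar1 : variance f ρ ≤ ρ.real A := by
    refine (variance_le_expectation_sq hfm.aestronglyMeasurable).trans_eq ?_
    rw [← hint]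
    refine integral_congr_ae (Eventually.of_forall fun x => ?_)
    by_cases hx : x ∈ A <;> simp [hf, hx]
  set X : (ι → ℝ) → ℝ := ∑ i : ι, fun w : ι → ℝ => f (w i) with hX
  have hXapp : ∀ w, X w = ∑ i, f (w i) := fun w => by simp [hX]
  have hXi : ∀ i : ι, MemLp (fun w : ι → ℝ => f (w i)) 2 (Measure.pi fun _ : ι => ρ) := fun i =>
    hfL.comp_measurePreserving (measurePreserving_eval (fun _ : ι => ρ) i)
  have hXL : MemLp X 2 (Measure.pi fun _ : ι => ρ) := memLp_finsetSum' _ fun i _ => hXi i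
  have hmean : ∫ w, X w ∂(Measure.pi fun _ : ι => ρ) = N := by
    simp only [hXapp]
    rw [integral_finsetSum _ fun i _ => (hXi i).integrable (by norm_num)]
    simp only [integral_comp_eval (μ := fun _ : ι => ρ) (f := f) hfm.aestronglyMeasurable, hint]
    simp [hN]
  have hvar : variance X (Measure.pi fun _ : ι => ρ) ≤ N := by
    rw [hX, variance_sum_pi (μ := fun _ : ι => ρ) (X := fun _ => f) fun _ => hfL]
    simp only [Finset.sum_const, Finset.card_univ, nsmul_eq_mul, hN]
    gcongr
  have hcheb := meas_ge_le_variance_div_sq hXL (half_pos hpos)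
  refine le_trans (measure_mono fun w hw => ?_) (hcheb.trans (ENNReal.ofReal_le_ofReal ?_))
  · simp only [mem_ofPred_eq] at hw ⊢
    rw [hmean, hXapp, abs_sub_comm]
    exact le_trans (by linarith) (le_abs_self _)
  · rw [div_le_div_iff₀ (by positivity) hpos]
    nlinarith

/-- With high probability the `(k+1)`-th smallest of `n` uniform variables is at most `2k/n`. -/
theorem measure_lt_orderVal {n k : ℕ} (hk : 1 ≤ k) (hkn : 2 * k ≤ n) :
    (Measure.pi fun _ : Fin n => unif01) {u | 2 * (k : ℝ) / n < orderVal n u (k + 1)} ≤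
      ENNReal.ofReal (2 / k) := by
  have hn : (0 : ℝ) < n := by exact_mod_cast (by omega : 0 < n)
  have hk0 : (0 : ℝ) < k := by exact_mod_cast hk
  set b : ℝ := 2 * (k : ℝ) / n with hb
  have hb0 : 0 < b := by positivity
  have hb1 : b ≤ 1 := by rw [hb, div_le_one hn]; exact_mod_cast hkn
  have hreal : unif01.real (Iic b) = b := by
    rw [Measure.real, unif01, Measure.restrict_apply measurableSet_Iic]
    have : (Iic b ∩ Ioo 0 1 : Set ℝ) =ᵐ[volume] Ioc 0 b := by
      rcases hb1.eq_or_lt with h1 | h1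
      · have : (Iic b ∩ Ioo 0 1 : Set ℝ) = Ioo 0 b := by
          ext x; rw [h1]; simp only [mem_inter_iff, mem_Iic, mem_Ioo]
          exact ⟨fun h => h.2, fun h => ⟨h.2.le, h⟩⟩
        rw [this]; exact Ioo_ae_eq_Ioc
      · have : (Iic b ∩ Ioo 0 1 : Set ℝ) = Ioc 0 b := by
          ext x; simp only [mem_inter_iff, mem_Iic, mem_Ioo, mem_Ioc]
          exact ⟨fun h => ⟨h.2.1, h.1⟩, fun h => ⟨h.2, h.1, lt_of_le_of_lt h.2 h1⟩⟩
        exact this ▸ ae_eq_refl _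
    rw [measure_congr this, Real.volume_Ioc, sub_zero, ENNReal.toReal_ofReal hb0.le]
  have hN : (Fintype.card (Fin n) : ℝ) * unif01.real (Iic b) = 2 * k := by
    rw [hreal, Fintype.card_fin, hb]; field_simp
  have h := measure_count_le (Fin n) unif01 (measurableSet_Iic (a := b)) (by rw [hN]; positivity)
  rw [hN] at h
  refine (measure_mono fun u hu => ?_).trans (h.trans (ENNReal.ofReal_le_ofReal ?_))
  · simp only [mem_ofPred_eq] at hu ⊢
    have hkn' : k < n := by omega
    have hu' : ¬ (u ∘ Tuple.sort u) ⟨k, hkn'⟩ ≤ b := by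
      rw [orderVal_of_monotone (Tuple.monotone_sort u) ⟨by omega, by omega⟩] at hu
      exact not_le.2 hu
    rw [← Tuple.lt_card_le_iff_apply_le_of_monotone (Tuple.monotone_sort u), not_lt] at hu'
    have hc : (Finset.univ.filter fun i => (u ∘ Tuple.sort u) i ≤ b).card =
        (Finset.univ.filter fun i => u i ≤ b).card :=
      Finset.card_equiv (Tuple.sort u) (by simp)
    rw [hc] at hu'
    have : ∑ i, (Iic b).indicator (fun _ => (1 : ℝ)) (u i) =
        (Finset.univ.filter fun i => u i ≤ b).card := by
      rw [Finset.card_filter, Nat.cast_sum]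
      exact Finset.sum_congr rfl fun i _ => by simp [indicator_apply]
    rw [this, mul_div_cancel_left₀ _ two_ne_zero]
    exact_mod_cast hu'
  · rw [div_le_div_iff₀ (by positivity) hk0]; nlinarith

theorem orderVal_pos_ae {n k : ℕ} (hkn : k < n) :
    ∀ᵐ u ∂(Measure.pi fun _ : Fin n => unif01), 0 < orderVal n u (k + 1) := by
  filter_upwards [ae_pi_unif01 (Fin n)] with u hu
  rw [orderVal_of_monotone (Tuple.monotone_sort u) ⟨by omega, by omega⟩]
  exact (hu _).1

/-- If the bounded functions `Ψ n` converge to `c` along every sequence of arguments in `(0, b n]`,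
then so do their integrals with respect to random arguments that lie in `(0, b n]` with high
probability. -/
theorem tendsto_lintegral_of_forall_seq {α : ℕ → Type*} [∀ n, MeasurableSpace (α n)]
    (π : ∀ n, Measure (α n)) [∀ n, IsProbabilityMeasure (π n)] {V : ∀ n, α n → ℝ}
    (hV : ∀ n, Measurable (V n)) {b : ℕ → ℝ} (hb : ∀ᶠ n in atTop, 0 < b n)
    (hπ : Tendsto (fun n => π n {x | V n x ∉ Ioc 0 (b n)}) atTop (𝓝 0))
    {Ψ : ℕ → ℝ → ENNReal} {C c : ENNReal} (hC : C ≠ ⊤) (hc : c ≠ ⊤) (hΨ : ∀ n v, Ψ n v ≤ C)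
    (hseq : ∀ v : ℕ → ℝ, (∀ᶠ n in atTop, v n ∈ Ioc 0 (b n)) →
      Tendsto (fun n => Ψ n (v n)) atTop (𝓝 c)) :
    Tendsto (fun n => ∫⁻ x, Ψ n (V n x) ∂π n) atTop (𝓝 c) := by
  classical
  have hunif : ∀ ε > 0, ∀ᶠ n in atTop, ∀ v ∈ Ioc 0 (b n), Ψ n v ∈ Icc (c - ε) (c + ε) := by
    intro ε hε
    set v : ℕ → ℝ := fun n => if h : ∃ v ∈ Ioc 0 (b n), Ψ n v ∉ Icc (c - ε) (c + ε) then h.choose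
      else b n with hv
    have hvb : ∀ᶠ n in atTop, v n ∈ Ioc 0 (b n) := by
      filter_upwards [hb] with n hn
      simp only [hv]
      split_ifs with h
      · exact h.choose_spec.1
      · exact ⟨hn, le_rfl⟩
    filter_upwards [(ENNReal.tendsto_nhds hc).1 (hseq v hvb) ε hε] with n hn
    by_contra hcon
    push Not at hcon
    have h2 := hcon.choose_spec.2
    simp only [hv, dif_pos hcon] at hn
    exact h2 hn
  have hbad : ∀ n, MeasurableSet {x | V n x ∉ Ioc 0 (b n)} := fun n =>
    (hV n measurableSet_Ioc).compl
  have hsmall : ∀ D : ENNReal, D ≠ ⊤ → ∀ ε > 0, ∀ᶠ n in atTop,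
      D * π n {x | V n x ∉ Ioc 0 (b n)} ≤ ε := by
    intro D hD ε hε
    have := ENNReal.Tendsto.const_mul hπ (Or.inr hD)
    rw [mul_zero] at this
    exact (ENNReal.tendsto_nhds_zero.1 this) ε hε
  rw [ENNReal.tendsto_nhds hc]
  intro ε hε
  have hε2 : 0 < ε / 2 := ENNReal.half_pos hε.ne'
  filter_upwards [hunif _ hε2, hsmall C hC _ hε2, hsmall c hc _ hε2] with n h1 h2 h3
  constructor
  · rw [tsub_le_iff_right]
    calc c = ∫⁻ _, c ∂π n := by simp
      _ ≤ ∫⁻ x, (Ψ n (V n x) + (ε / 2 + {x | V n x ∉ Ioc 0 (b n)}.indicator (fun _ => c) x))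
          ∂π n := by
        refine lintegral_mono fun x => ?_
        by_cases hx : V n x ∈ Ioc 0 (b n)
        · have := (h1 _ hx).1
          rw [tsub_le_iff_right] at this
          exact this.trans (by gcongr; exact le_self_add)
        · rw [indicator_of_mem (by exact hx)]
          exact le_add_left (le_add_left le_rfl)
      _ = ∫⁻ x, Ψ n (V n x) ∂π n + (ε / 2 + c * π n {x | V n x ∉ Ioc 0 (b n)}) := by
        have hg : Measurable fun x => ε / 2 +
            {x | V n x ∉ Ioc 0 (b n)}.indicator (fun _ => c) x :=
          measurable_const.add (measurable_const.indicator (hbad n))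
        rw [lintegral_add_right _ hg, lintegral_add_left measurable_const, lintegral_indicator_const (hbad n)]
        simp
      _ ≤ ∫⁻ x, Ψ n (V n x) ∂π n + ε := by
        gcongr
        exact (add_le_add_right h3 _).trans_eq (ENNReal.add_halves ε)
  · calc
      ∫⁻ x, Ψ n (V n x) ∂π n
      _ ≤ ∫⁻ x, ((c + ε / 2) + {x | V n x ∉ Ioc 0 (b n)}.indicator (fun _ => C) x) ∂π n := by
        refine lintegral_mono fun x => ?_
        by_cases hx : V n x ∈ Ioc 0 (b n)
        · exact le_add_right (h1 _ hx).2
        · rw [indicator_of_mem (by exact hx)]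
          exact le_add_left (hΨ n _)
      _ = (c + ε / 2) + C * π n {x | V n x ∉ Ioc 0 (b n)} := by
        rw [lintegral_add_left measurable_const, lintegral_indicator_const (hbad n)]
        simp
      _ ≤ c + ε := by
        rw [add_assoc]
        gcongr
        exact (add_le_add_right h2 _).trans_eq (ENNReal.add_halves ε)

/-- Integrals of functions of the pair `(U_{k+1,n}, S_n(p))` converge as soon as they do so for
every deterministic sequence of values of `U_{k+1,n}` in `(0, 2k/n]`. -/
theorem tendsto_lintegral_order_hill (μ : Measure ℝ) [IsProbabilityMeasure μ] (γ : ℝ)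
    {k : ℕ → ℕ} (hk : ∀ n, 1 ≤ n → 1 ≤ k n ∧ k n ≤ n) (hk_top : Tendsto k atTop atTop)
    (hk_zero : Tendsto (fun n => (k n : ℝ) / n) atTop (𝓝 0)) (p : ℕ → ℝ)
    {H : ℕ → ℝ × ℝ → ENNReal} (hH : ∀ n, Measurable (H n)) {C c : ENNReal} (hC : C ≠ ⊤)
    (hc : c ≠ ⊤) (hHC : ∀ n z, H n z ≤ C)
    (hseq : ∀ v : ℕ → ℝ, (∀ᶠ n in atTop, v n ∈ Ioc 0 (2 * (k n : ℝ) / n)) →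
      Tendsto (fun n => ∫⁻ w, H n (v n, sampleMean γ (quantile μ) (k n) (p n) (v n) w)
        ∂(Measure.pi fun _ : Fin (k n) => unif01)) atTop (𝓝 c)) :
    Tendsto (fun n => ∫⁻ u, H n (orderVal n u (k n + 1),
        hillVal n (k n) (p n) (fun i => quantile μ (1 - u i)))
      ∂(Measure.pi fun _ : Fin n => unif01)) atTop (𝓝 c) := by
  have hkn : ∀ᶠ n in atTop, 1 ≤ n ∧ 2 * k n < n := by
    filter_upwards [hk_zero.eventually (gt_mem_nhds (show (0 : ℝ) < 1 / 2 by norm_num)),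
      eventually_ge_atTop 1] with n hn h1
    refine ⟨h1, ?_⟩
    have hn0 : (0 : ℝ) < n := by exact_mod_cast h1
    rw [div_lt_iff₀ hn0] at hn
    have : (2 * k n : ℝ) < n := by linarith
    exact_mod_cast this
  have hb : ∀ᶠ n in atTop, (0 : ℝ) < 2 * (k n : ℝ) / n := by
    filter_upwards [hkn] with n hn
    have h1 : (0 : ℝ) < n := by exact_mod_cast hn.1
    have h2 : (0 : ℝ) < k n := by exact_mod_cast (hk n hn.1).1
    positivity
  have hπ : Tendsto (fun n => (Measure.pi fun _ : Fin n => unif01)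
      {u | orderVal n u (k n + 1) ∉ Ioc 0 (2 * (k n : ℝ) / n)}) atTop (𝓝 0) := by
    have hlim : Tendsto (fun n => ENNReal.ofReal (2 / (k n : ℝ))) atTop (𝓝 0) := by
      rw [← ENNReal.ofReal_zero]
      exact (ENNReal.continuous_ofReal.tendsto 0).comp
        (tendsto_const_nhds.div_atTop (tendsto_natCast_atTop_atTop.comp hk_top))
    refine tendsto_of_tendsto_of_tendsto_of_le_of_le' tendsto_const_nhds hlim
      (Eventually.of_forall fun _ => zero_le) ?_
    filter_upwards [hkn] with n hn
    refine le_trans (measure_mono_ae ?_) (measure_lt_orderVal (hk n hn.1).1 hn.2.le)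
    filter_upwards [orderVal_pos_ae (n := n) (k := k n) (by omega)] with u hu hmem
    by_contra hcon
    exact hmem ⟨hu, not_lt.1 hcon⟩
  have := tendsto_lintegral_of_forall_seq (fun n => Measure.pi fun _ : Fin n => unif01)
    (fun n => measurable_orderVal n (k n + 1)) hb hπ
    (Ψ := fun n v => ∫⁻ w, H n (v, sampleMean γ (quantile μ) (k n) (p n) v w)
        ∂(Measure.pi fun _ : Fin (k n) => unif01)) hC hc
    (fun n v => (lintegral_mono fun w => hHC n _).trans (by simp)) hseq
  refine this.congr' ?_
  filter_upwards [hkn] with n hn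
  exact (lintegral_orderVal_hillVal μ γ (by omega) (p n) (hH n)).symm

/-! ### Moments of nearly exponential variables -/

theorem lintegral_scale {v : ℝ} (hv : v ∈ Ioc (0 : ℝ) 1) {f : ℝ → ENNReal} (hf : Measurable f) :
    ENNReal.ofReal v * ∫⁻ w, f (v * w) ∂unif01 = ∫⁻ u in Iio v, f u ∂unif01 := by
  rw [unif01_restrict_Iio hv, lintegral_smul_measure, lintegral_map hf (by fun_prop), smul_eq_mul]

theorem lintegral_neg_log_rpow {s : ℝ} (hs : 0 ≤ s) :
    ∫⁻ u, ENNReal.ofReal ((-Real.log u) ^ s) ∂unif01 = ENNReal.ofReal (Real.Gamma (s + 1)) := by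
  have himg : (fun x : ℝ => Real.exp (-x)) '' Ioi 0 = Ioo 0 1 := by
    ext u
    constructor
    · rintro ⟨x, hx, rfl⟩
      exact ⟨Real.exp_pos _, Real.exp_lt_one_iff.2 (by simpa using hx)⟩
    · intro hu
      exact ⟨-Real.log u, by simpa using Real.log_neg hu.1 hu.2, by simp [Real.exp_log hu.1]⟩
  have hder : ∀ x ∈ Ioi (0 : ℝ), HasDerivWithinAt (fun x : ℝ => Real.exp (-x)) (-Real.exp (-x))
      (Ioi 0) x := by
    intro x _
    simpa using ((hasDerivAt_neg x).exp).hasDerivWithinAt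
  have hinj : InjOn (fun x : ℝ => Real.exp (-x)) (Ioi 0) := by
    intro x _ y _ h
    simpa using h
  have h1 := lintegral_image_eq_lintegral_abs_deriv_mul measurableSet_Ioi hder hinj
    (fun u => ENNReal.ofReal ((-Real.log u) ^ s))
  rw [himg] at h1
  have hint := Real.GammaIntegral_convergent (s := s + 1) (by linarith)
  rw [unif01, h1, Real.Gamma_eq_integral (by linarith), ofReal_integral_eq_lintegral_ofReal hint]
  · refine setLIntegral_congr_fun measurableSet_Ioi fun x hx => ?_
    simp only [Real.log_exp, neg_neg, abs_neg, abs_of_pos (Real.exp_pos _), add_sub_cancel_right]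
    rw [← ENNReal.ofReal_mul (Real.exp_pos _).le]
  · filter_upwards [ae_restrict_mem measurableSet_Ioi] with x hx
    exact mul_nonneg (Real.exp_pos _).le (Real.rpow_nonneg (le_of_lt hx) _)

/-- Upper moment bound. The shift by `c` of the exponential variable `-log u` is the rescaling of
`u` by `e^{-c}`, which costs at most a factor `e^c`. -/
theorem lintegral_rpow_le {Y : ℝ → ℝ} {B c s : ℝ} (hB : 0 ≤ B) (hc : 0 ≤ c) (hs : 0 ≤ s)
    (hY0 : ∀ u ∈ Ioo (0 : ℝ) 1, 0 ≤ Y u)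
    (hY : ∀ u ∈ Ioo (0 : ℝ) 1, Y u ≤ B * (-Real.log u + c)) :
    ∫⁻ u, ENNReal.ofReal (Y u ^ s) ∂unif01 ≤
      ENNReal.ofReal (Real.exp c * B ^ s * Real.Gamma (s + 1)) := by
  set v := Real.exp (-c) with hv
  have hv1 : v ∈ Ioc (0 : ℝ) 1 := ⟨Real.exp_pos _, Real.exp_le_one_iff.2 (by linarith)⟩
  have hm : Measurable fun u : ℝ => ENNReal.ofReal ((-Real.log u) ^ s) := by fun_prop
  have h1 : ENNReal.ofReal v * ∫⁻ w, ENNReal.ofReal ((-Real.log (v * w)) ^ s) ∂unif01 ≤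
      ENNReal.ofReal (Real.Gamma (s + 1)) := by
    rw [lintegral_scale hv1 hm, ← lintegral_neg_log_rpow hs]
    exact setLIntegral_le_lintegral _ _
  have hinv : Real.exp c * v = 1 := by rw [hv, ← Real.exp_add]; simp
  have h2 : ∫⁻ w, ENNReal.ofReal ((-Real.log (v * w)) ^ s) ∂unif01 ≤
      ENNReal.ofReal (Real.exp c * Real.Gamma (s + 1)) := by
    calc _ = ENNReal.ofReal (Real.exp c) * (ENNReal.ofReal v *
          ∫⁻ w, ENNReal.ofReal ((-Real.log (v * w)) ^ s) ∂unif01) := by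
          rw [← mul_assoc, ← ENNReal.ofReal_mul (Real.exp_pos _).le, hinv]; simp
      _ ≤ _ := by
          rw [ENNReal.ofReal_mul (Real.exp_pos _).le]
          gcongr
  calc ∫⁻ u, ENNReal.ofReal (Y u ^ s) ∂unif01
      ≤ ∫⁻ w, ENNReal.ofReal (B ^ s) * ENNReal.ofReal ((-Real.log (v * w)) ^ s) ∂unif01 := by
        refine lintegral_mono_ae ?_
        filter_upwards [ae_unif01] with u hu
        have hE : 0 < -Real.log u := by linarith [Real.log_neg hu.1 hu.2]
        have hlog : -Real.log (v * u) = -Real.log u + c := by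
          rw [Real.log_mul hv1.1.ne' hu.1.ne', hv, Real.log_exp]; ring
        rw [hlog, ← ENNReal.ofReal_mul (Real.rpow_nonneg hB _),
          ← Real.mul_rpow hB (by linarith)]
        exact ENNReal.ofReal_le_ofReal (Real.rpow_le_rpow (hY0 u hu) (hY u hu) hs)
    _ = ENNReal.ofReal (B ^ s) * ∫⁻ w, ENNReal.ofReal ((-Real.log (v * w)) ^ s) ∂unif01 :=
        lintegral_const_mul _ (by fun_prop)
    _ ≤ ENNReal.ofReal (B ^ s) * ENNReal.ofReal (Real.exp c * Real.Gamma (s + 1)) := by gcongr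
    _ = _ := by
        rw [← ENNReal.ofReal_mul (Real.rpow_nonneg hB _)]
        congr 1; ring

/-- Lower moment bound: by the memoryless property, the excess of `-log u` over `c` is again
exponential. -/
theorem le_lintegral_rpow {Y : ℝ → ℝ} {A c s : ℝ} (hA : 0 ≤ A) (hc : 0 ≤ c) (hs : 0 ≤ s)
    (hY : ∀ u ∈ Ioo (0 : ℝ) 1, A * (-Real.log u - c) ≤ Y u) :
    ENNReal.ofReal (Real.exp (-c) * A ^ s * Real.Gamma (s + 1)) ≤
      ∫⁻ u, ENNReal.ofReal (Y u ^ s) ∂unif01 := by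
  set v := Real.exp (-c) with hv
  have hv1 : v ∈ Ioc (0 : ℝ) 1 := ⟨Real.exp_pos _, Real.exp_le_one_iff.2 (by linarith)⟩
  have hm : Measurable fun u : ℝ => ENNReal.ofReal ((A * (-Real.log u - c)) ^ s) := by fun_prop
  calc ENNReal.ofReal (v * A ^ s * Real.Gamma (s + 1))
      = ENNReal.ofReal v * (ENNReal.ofReal (A ^ s) *
          ∫⁻ u, ENNReal.ofReal ((-Real.log u) ^ s) ∂unif01) := by
        rw [lintegral_neg_log_rpow hs, ← ENNReal.ofReal_mul (Real.rpow_nonneg hA _),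
          ← ENNReal.ofReal_mul hv1.1.le, mul_assoc]
    _ = ENNReal.ofReal v * ∫⁻ w, ENNReal.ofReal ((A * (-Real.log (v * w) - c)) ^ s) ∂unif01 := by
        rw [← lintegral_const_mul _ (by fun_prop)]
        congr 1
        refine lintegral_congr_ae ?_
        filter_upwards [ae_unif01] with u hu
        have hE : 0 < -Real.log u := by linarith [Real.log_neg hu.1 hu.2]
        have hlog : -Real.log (v * u) - c = -Real.log u := by
          rw [Real.log_mul hv1.1.ne' hu.1.ne', hv, Real.log_exp]; ring
        rw [hlog, Real.mul_rpow hA hE.le, ENNReal.ofReal_mul (Real.rpow_nonneg hA _)]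
    _ = ∫⁻ u in Iio v, ENNReal.ofReal ((A * (-Real.log u - c)) ^ s) ∂unif01 :=
        lintegral_scale hv1 hm
    _ ≤ ∫⁻ u in Iio v, ENNReal.ofReal (Y u ^ s) ∂unif01 := by
        refine setLIntegral_mono_ae' measurableSet_Iio ?_
        filter_upwards [ae_unif01] with u hu huv
        have : c ≤ -Real.log u := by
          have := Real.log_le_log hu.1 (le_of_lt huv)
          rw [hv, Real.log_exp] at this
          linarith
        exact ENNReal.ofReal_le_ofReal
          (Real.rpow_le_rpow (mul_nonneg hA (by linarith)) (hY u hu) hs)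
    _ ≤ _ := setLIntegral_le_lintegral _ _

/-- The variable `Y` on `(0,1)` is nonnegative and differs from the exponential variable `-log u`
by factors between `A` and `B` and a shift of at most `c`. -/
structure NearExp (Y : ℝ → ℝ) (A B c : ℝ) : Prop where
  meas : Measurable Y
  hA : 0 < A
  hB : 0 < B
  hc : 0 ≤ c
  nonneg : ∀ u ∈ Ioo (0 : ℝ) 1, 0 ≤ Y u
  lower : ∀ u ∈ Ioo (0 : ℝ) 1, A * (-Real.log u - c) ≤ Y u
  upper : ∀ u ∈ Ioo (0 : ℝ) 1, Y u ≤ B * (-Real.log u + c)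

theorem NearExp.rpow_nonneg_ae {Y : ℝ → ℝ} {A B c : ℝ} (h : NearExp Y A B c) (s : ℝ) :
    0 ≤ᵐ[unif01] fun u => Y u ^ s := by
  filter_upwards [ae_unif01] with u hu
  exact Real.rpow_nonneg (h.nonneg u hu) s

theorem NearExp.integrable {Y : ℝ → ℝ} {A B c : ℝ} (h : NearExp Y A B c) {s : ℝ} (hs : 0 ≤ s) :
    Integrable (fun u => Y u ^ s) unif01 := by
  refine ⟨(h.meas.pow_const s).aestronglyMeasurable, ?_⟩
  rw [hasFiniteIntegral_iff_ofReal (h.rpow_nonneg_ae s)]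
  exact (lintegral_rpow_le h.hB.le h.hc hs h.nonneg h.upper).trans_lt ENNReal.ofReal_lt_top

theorem NearExp.le_moment {Y : ℝ → ℝ} {A B c : ℝ} (h : NearExp Y A B c) {s : ℝ} (hs : 0 ≤ s) :
    Real.exp (-c) * A ^ s * Real.Gamma (s + 1) ≤ ∫ u, Y u ^ s ∂unif01 := by
  have h1 := le_lintegral_rpow h.hA.le h.hc hs h.lower
  rw [← ofReal_integral_eq_lintegral_ofReal (h.integrable hs) (h.rpow_nonneg_ae s)] at h1
  exact (ENNReal.ofReal_le_ofReal_iff (integral_nonneg_of_ae (h.rpow_nonneg_ae s))).1 h1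

theorem NearExp.moment_le {Y : ℝ → ℝ} {A B c : ℝ} (h : NearExp Y A B c) {s : ℝ} (hs : 0 ≤ s) :
    ∫ u, Y u ^ s ∂unif01 ≤ Real.exp c * B ^ s * Real.Gamma (s + 1) := by
  have h1 := lintegral_rpow_le h.hB.le h.hc hs h.nonneg h.upper
  rw [← ofReal_integral_eq_lintegral_ofReal (h.integrable hs) (h.rpow_nonneg_ae s)] at h1
  have := h.hB
  have := Real.Gamma_pos_of_pos (show 0 < s + 1 by linarith)
  exact (ENNReal.ofReal_le_ofReal_iff (by positivity)).1 h1

theorem Gamma_add_one_le {x : ℝ} (hx : 0 < x) :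
    Real.Gamma (x + 1) ≤ Real.exp 1 * (x + 1) * (x ^ x * Real.exp (-x)) := by
  have hx1 : 0 < x + 1 := by linarith
  have ha : -(1 / (x + 1)) < 0 := by simpa using hx1
  set C : ℝ := ((x + 1) * Real.exp (-1)) ^ x with hC
  -- `t ^ x ≤ C * exp (x t / (x + 1))`, with equality at `t = x + 1`
  have hpt : ∀ t ∈ Ioi (0 : ℝ), Real.exp (-t) * t ^ (x + 1 - 1) ≤
      C * Real.exp (-(1 / (x + 1)) * t) := by
    intro t ht
    have ht : 0 < t := ht
    have h1 : t ≤ (x + 1) * Real.exp (-1) * Real.exp (t / (x + 1)) := by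
      have := Real.add_one_le_exp (t / (x + 1) - 1)
      rw [sub_add_cancel, div_le_iff₀ hx1] at this
      rw [mul_assoc, ← Real.exp_add]
      calc t ≤ Real.exp (t / (x + 1) - 1) * (x + 1) := this
        _ = _ := by rw [mul_comm]; congr 2; ring
    have h2 : t ^ x ≤ C * Real.exp (t / (x + 1) * x) := by
      rw [hC, Real.exp_mul, ← Real.mul_rpow (by positivity) (by positivity)]
      exact Real.rpow_le_rpow ht.le h1 hx.le
    rw [add_sub_cancel_right]
    calc Real.exp (-t) * t ^ x ≤ Real.exp (-t) * (C * Real.exp (t / (x + 1) * x)) := by gcongr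
      _ = C * (Real.exp (-t) * Real.exp (t / (x + 1) * x)) := by ring
      _ = _ := by
        rw [← Real.exp_add]
        congr 2
        field_simp
        ring
  have h3 : Real.Gamma (x + 1) ≤ C * (x + 1) := by
    rw [Real.Gamma_eq_integral hx1]
    calc _ ≤ ∫ t in Ioi (0 : ℝ), C * Real.exp (-(1 / (x + 1)) * t) :=
          setIntegral_mono_on (Real.GammaIntegral_convergent hx1)
            ((integrableOn_exp_mul_Ioi ha 0).const_mul _) measurableSet_Ioi hpt
      _ = C * (x + 1) := by
          rw [integral_const_mul, integral_exp_mul_Ioi ha 0]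
          simp
  have h4 : C ≤ Real.exp 1 * (x ^ x * Real.exp (-x)) := by
    have h5 : (x + 1) ^ x ≤ Real.exp 1 * x ^ x := by
      have h6 : x + 1 ≤ x * Real.exp (1 / x) := by
        have := Real.add_one_le_exp (1 / x)
        calc x + 1 = x * (1 / x + 1) := by field_simp; ring
          _ ≤ _ := by gcongr
      calc (x + 1) ^ x ≤ (x * Real.exp (1 / x)) ^ x := Real.rpow_le_rpow hx1.le h6 hx.le
        _ = Real.exp 1 * x ^ x := by
          rw [Real.mul_rpow hx.le (Real.exp_pos _).le, ← Real.exp_mul, one_div,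
            inv_mul_cancel₀ hx.ne', mul_comm]
    rw [hC, Real.mul_rpow hx1.le (Real.exp_pos _).le, ← Real.exp_mul, neg_one_mul, ← mul_assoc]
    gcongr
  calc _ ≤ C * (x + 1) := h3
    _ ≤ (Real.exp 1 * (x ^ x * Real.exp (-x))) * (x + 1) := by gcongr
    _ = _ := by ring

theorem unif01_Iio {v : ℝ} (hv : v ∈ Ioc (0 : ℝ) 1) : unif01 (Iio v) = ENNReal.ofReal v := by
  have := lintegral_scale hv (f := fun _ => 1) measurable_const
  simpa using this.symm

theorem le_Gamma_add_one {x : ℝ} (hx : 0 ≤ x) :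
    x ^ x * Real.exp (-x) ≤ Real.Gamma (x + 1) := by
  have hv : Real.exp (-x) ∈ Ioc (0 : ℝ) 1 :=
    ⟨Real.exp_pos _, Real.exp_le_one_iff.2 (by linarith)⟩
  have h1 : ENNReal.ofReal (x ^ x * Real.exp (-x)) ≤ ENNReal.ofReal (Real.Gamma (x + 1)) := by
    rw [← lintegral_neg_log_rpow hx, ENNReal.ofReal_mul (Real.rpow_nonneg hx x), ← unif01_Iio hv]
    calc _ = ∫⁻ _ in Iio (Real.exp (-x)), ENNReal.ofReal (x ^ x) ∂unif01 := by simp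
      _ ≤ ∫⁻ u in Iio (Real.exp (-x)), ENNReal.ofReal ((-Real.log u) ^ x) ∂unif01 := by
        refine setLIntegral_mono_ae' measurableSet_Iio ?_
        filter_upwards [ae_unif01] with u hu huv
        have := Real.log_le_log hu.1 (le_of_lt huv)
        rw [Real.log_exp] at this
        exact ENNReal.ofReal_le_ofReal (Real.rpow_le_rpow hx (by linarith) hx)
      _ ≤ _ := setLIntegral_le_lintegral _ _
  exact (ENNReal.ofReal_le_ofReal_iff (Real.Gamma_pos_of_pos (by linarith)).le).1 h1

/-! ### A central limit theorem for triangular arrays -/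

theorem norm_pow_sub_pow_le_mul {z w : ℂ} (hz : ‖z‖ ≤ 1) (hw : ‖w‖ ≤ 1) (k : ℕ) :
    ‖z ^ k - w ^ k‖ ≤ k * ‖z - w‖ := by
  induction k with
  | zero => simp
  | succ k ih =>
    have : z ^ (k + 1) - w ^ (k + 1) = z * (z ^ k - w ^ k) + (z - w) * w ^ k := by ring
    rw [this]
    calc _ ≤ ‖z‖ * ‖z ^ k - w ^ k‖ + ‖z - w‖ * ‖w‖ ^ k := by
          refine (norm_add_le _ _).trans ?_
          rw [norm_mul, norm_mul, norm_pow]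
      _ ≤ 1 * (k * ‖z - w‖) + ‖z - w‖ * 1 := by
          gcongr
          exact pow_le_one₀ (norm_nonneg _) hw
      _ = _ := by push_cast; ring

theorem norm_exp_sub_taylor_le {q : ℝ} (hq2 : 2 ≤ q) (hq3 : q ≤ 3) (x : ℝ) :
    ‖Complex.exp (x * Complex.I) - (1 + x * Complex.I - (x : ℂ) ^ 2 / 2)‖ ≤ 4 * |x| ^ q := by
  have hnorm : ‖(x : ℂ) * Complex.I‖ = |x| := by simp
  rcases le_or_gt |x| 1 with hx | hx
  · have h := Complex.exp_bound (x := x * Complex.I) (by rw [hnorm]; exact hx) (n := 3) (by norm_num)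
    have hsum : ∑ m ∈ Finset.range 3, ((x : ℂ) * Complex.I) ^ m / (m.factorial : ℂ) =
        1 + x * Complex.I - (x : ℂ) ^ 2 / 2 := by
      simp [Finset.sum_range_succ, mul_pow, Nat.factorial]
      ring
    rw [hsum, hnorm] at h
    refine h.trans ?_
    rcases (abs_nonneg x).eq_or_lt with h0 | h0
    · rw [← h0]
      norm_num
      positivity
    · have h3 : |x| ^ (3 : ℕ) ≤ |x| ^ q := by
        rw [← Real.rpow_natCast]
        exact Real.rpow_le_rpow_of_exponent_ge h0 hx (by exact_mod_cast hq3)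
      have : (3 : ℕ).succ * (((3 : ℕ).factorial : ℝ) * (3 : ℕ))⁻¹ ≤ 4 := by
        norm_num [Nat.factorial]
      calc _ ≤ |x| ^ q * 4 := by gcongr
        _ = _ := mul_comm _ _
  · have hx2 : |x| ^ 2 ≤ |x| ^ q := by
      rw [← Real.rpow_natCast]
      exact Real.rpow_le_rpow_of_exponent_le hx.le (by exact_mod_cast hq2)
    have h1 : |x| ≤ |x| ^ 2 := by nlinarith
    calc _ ≤ ‖Complex.exp (x * Complex.I)‖ + (‖(1 : ℂ)‖ + ‖(x : ℂ) * Complex.I‖ +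
          ‖(x : ℂ) ^ 2 / 2‖) :=
          (norm_sub_le _ _).trans (by gcongr; exact (norm_sub_le _ _).trans (by
            gcongr; exact norm_add_le _ _))
      _ = 1 + (1 + |x| + |x| ^ 2 / 2) := by
          rw [hnorm, Complex.norm_exp_ofReal_mul_I]; simp
      _ ≤ 4 * |x| ^ q := by nlinarith

/-- Second order expansion of a characteristic function with a remainder of Lyapunov type. -/
theorem norm_charFun_sub_le {ρ : Measure ℝ} [IsProbabilityMeasure ρ] {ξ : ℝ → ℝ}
    (hξ : Measurable ξ) (h1 : Integrable ξ ρ) (h2 : Integrable (fun x => ξ x ^ 2) ρ)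
    (hm : ∫ x, ξ x ∂ρ = 0) (hv : ∫ x, ξ x ^ 2 ∂ρ = 1) {q : ℝ} (hq2 : 2 ≤ q) (hq3 : q ≤ 3)
    (hq : Integrable (fun x => |ξ x| ^ q) ρ) (s : ℝ) :
    ‖charFun (ρ.map ξ) s - (1 - (s : ℂ) ^ 2 / 2)‖ ≤ 4 * |s| ^ q * ∫ x, |ξ x| ^ q ∂ρ := by
  have hexp : Integrable (fun x => Complex.exp (((s * ξ x : ℝ) : ℂ) * Complex.I)) ρ := by
    refine Integrable.of_bound (Measurable.aestronglyMeasurable (by fun_prop)) 1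
      (Eventually.of_forall fun x => ?_)
    rw [Complex.norm_exp_ofReal_mul_I]
  have hc : charFun (ρ.map ξ) s = ∫ x, Complex.exp (((s * ξ x : ℝ) : ℂ) * Complex.I) ∂ρ := by
    rw [charFun_apply_real, integral_map hξ.aemeasurable (by fun_prop)]
    push_cast; rfl
  have i1 : Integrable (fun x => ((s * ξ x : ℝ) : ℂ) * Complex.I) ρ :=
    ((h1.const_mul s).ofReal (𝕜 := ℂ)).mul_const _
  have i2 : Integrable (fun x => ((s * ξ x : ℝ) : ℂ) ^ 2 / 2) ρ := by
    have : Integrable (fun x => (((s ^ 2 / 2) * ξ x ^ 2 : ℝ) : ℂ)) ρ :=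
      ((h2.const_mul (s ^ 2 / 2)).ofReal (𝕜 := ℂ))
    refine this.congr (Eventually.of_forall fun x => ?_)
    push_cast; ring
  have i3 : Integrable (fun x => 1 + ((s * ξ x : ℝ) : ℂ) * Complex.I) ρ :=
    (integrable_const _).add i1
  have htaylor : (1 - (s : ℂ) ^ 2 / 2) =
      ∫ x, (1 + ((s * ξ x : ℝ) : ℂ) * Complex.I - ((s * ξ x : ℝ) : ℂ) ^ 2 / 2) ∂ρ := by
    have hlin : ∫ x, ((s * ξ x : ℝ) : ℂ) ∂ρ = 0 := by
      have := integral_ofReal (𝕜 := ℂ) (μ := ρ) (f := fun x => s * ξ x)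
      rw [integral_const_mul, hm, mul_zero] at this
      exact this
    rw [integral_sub i3 i2, integral_add (integrable_const _) i1, integral_mul_const, hlin]
    have : ∫ x, ((s * ξ x : ℝ) : ℂ) ^ 2 / 2 ∂ρ = (s : ℂ) ^ 2 / 2 := by
      calc _ = ∫ x, (((s ^ 2 / 2) * ξ x ^ 2 : ℝ) : ℂ) ∂ρ := by
            refine integral_congr_ae (Eventually.of_forall fun x => ?_)
            push_cast; ring
        _ = _ := by
            have := integral_ofReal (𝕜 := ℂ) (μ := ρ) (f := fun x => s ^ 2 / 2 * ξ x ^ 2)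
            rw [integral_const_mul, hv] at this
            refine this.trans ?_
            simp
    rw [this]; simp
  have i4 : Integrable (fun x => 1 + ((s * ξ x : ℝ) : ℂ) * Complex.I -
      ((s * ξ x : ℝ) : ℂ) ^ 2 / 2) ρ := i3.sub i2
  rw [hc, htaylor, ← integral_sub hexp i4]
  calc _ ≤ ∫ x, 4 * |s * ξ x| ^ q ∂ρ := by
        refine norm_integral_le_of_norm_le ?_ (Eventually.of_forall fun x =>
          norm_exp_sub_taylor_le hq2 hq3 _)
        simp only [abs_mul, Real.mul_rpow (abs_nonneg _) (abs_nonneg _)]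
        exact (hq.const_mul _).const_mul _
    _ = _ := by
        simp only [abs_mul, Real.mul_rpow (abs_nonneg _) (abs_nonneg _)]
        rw [integral_const_mul, integral_const_mul, mul_assoc]

theorem charFun_map_sum_pi {ρ : Measure ℝ} [IsProbabilityMeasure ρ] {ξ : ℝ → ℝ}
    (hξ : Measurable ξ) (k : ℕ) (c t : ℝ) :
    charFun ((Measure.pi fun _ : Fin k => ρ).map fun w => c * ∑ i, ξ (w i)) t =
      charFun (ρ.map ξ) (c * t) ^ k := by
  have := Measure.isProbabilityMeasure_map (μ := ρ) hξ.aemeasurable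
  rw [charFun_map_mul_comp (Measurable.aemeasurable (by fun_prop))]
  have h1 : (Measure.pi fun _ : Fin k => ρ).map (fun w => ∑ i, ξ (w i)) =
      (Measure.pi fun _ : Fin k => ρ.map ξ).map (fun w => ∑ i, w i) := by
    rw [← Measure.pi_map_pi (fun _ => hξ.aemeasurable),
      Measure.map_map (by fun_prop) (by fun_prop)]
    rfl
  rw [h1, charFun_map_sum_pi_eq_prod]
  simp

/-- Lyapunov's central limit theorem for row-wise i.i.d. triangular arrays, in terms of
characteristic functions. -/
theorem tendsto_charFun_normalized_sum {ρ : Measure ℝ} [IsProbabilityMeasure ρ] {k : ℕ → ℕ}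
    (hk : Tendsto k atTop atTop) {ξ : ℕ → ℝ → ℝ} (hξ : ∀ n, Measurable (ξ n)) {q : ℝ} (hq2 : 2 < q)
    (hq3 : q ≤ 3)
    (h : ∀ᶠ n in atTop, Integrable (ξ n) ρ ∧ Integrable (fun x => ξ n x ^ 2) ρ ∧
      Integrable (fun x => |ξ n x| ^ q) ρ ∧ ∫ x, ξ n x ∂ρ = 0 ∧ ∫ x, ξ n x ^ 2 ∂ρ = 1)
    (hL : Tendsto (fun n => (k n : ℝ) ^ (1 - q / 2) * ∫ x, |ξ n x| ^ q ∂ρ) atTop (𝓝 0)) (t : ℝ) :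
    Tendsto (fun n => charFun ((Measure.pi fun _ : Fin (k n) => ρ).map
      fun w => (Real.sqrt (k n))⁻¹ * ∑ i, ξ n (w i)) t) atTop
      (𝓝 (charFun (gaussianReal 0 1) t)) := by
  have hkR : Tendsto (fun n => (k n : ℝ)) atTop atTop := tendsto_natCast_atTop_atTop.comp hk
  have hmain : Tendsto (fun n => (1 + (-(t : ℂ) ^ 2 / 2) / (k n : ℂ)) ^ k n) atTop
      (𝓝 (charFun (gaussianReal 0 1) t)) := by
    have := (Complex.tendsto_one_add_div_pow_exp (-(t : ℂ) ^ 2 / 2)).comp hk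
    have hG : charFun (gaussianReal 0 1) t = Complex.exp (-(t : ℂ) ^ 2 / 2) := by
      rw [charFun_gaussianReal]
      congr 1
      simp
      ring
    rw [hG]
    exact this
  have hdiff : Tendsto (fun n => charFun ((Measure.pi fun _ : Fin (k n) => ρ).map
      fun w => (Real.sqrt (k n))⁻¹ * ∑ i, ξ n (w i)) t -
        (1 + (-(t : ℂ) ^ 2 / 2) / (k n : ℂ)) ^ k n) atTop (𝓝 0) := by
    have hlim : Tendsto (fun n => 4 * |t| ^ q * ((k n : ℝ) ^ (1 - q / 2) * ∫ x, |ξ n x| ^ q ∂ρ))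
        atTop (𝓝 0) := by
      simpa using hL.const_mul (4 * |t| ^ q)
    refine squeeze_zero_norm' ?_ hlim
    filter_upwards [h, hkR.eventually_ge_atTop (t ^ 2), hkR.eventually_gt_atTop 0]
      with n ⟨h1, h2, h3, h4, h5⟩ hkt hk0
    have := Measure.isProbabilityMeasure_map (μ := ρ) (hξ n).aemeasurable
    set s : ℝ := (Real.sqrt (k n))⁻¹ * t with hs
    have hs2 : s ^ 2 = t ^ 2 / k n := by
      rw [hs, mul_pow, inv_pow, Real.sq_sqrt hk0.le]; ring
    have hsC : (1 : ℂ) + (-(t : ℂ) ^ 2 / 2) / (k n : ℂ) = 1 - (s : ℂ) ^ 2 / 2 := by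
      have : (s : ℂ) ^ 2 = (t : ℂ) ^ 2 / (k n : ℂ) := by exact_mod_cast congrArg Complex.ofReal hs2
      rw [this]; ring
    have hw : ‖(1 : ℂ) - (s : ℂ) ^ 2 / 2‖ ≤ 1 := by
      have : (1 : ℂ) - (s : ℂ) ^ 2 / 2 = ((1 - s ^ 2 / 2 : ℝ) : ℂ) := by push_cast; ring
      rw [this, Complex.norm_real, Real.norm_eq_abs, abs_le]
      have h6 : s ^ 2 ≤ 1 := by rw [hs2, div_le_one hk0]; exact hkt
      constructor <;> nlinarith [sq_nonneg s]
    rw [charFun_map_sum_pi (hξ n), hsC]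
    refine (norm_pow_sub_pow_le_mul (norm_charFun_le_one _) hw _).trans ?_
    calc _ ≤ (k n : ℝ) * (4 * |s| ^ q * ∫ x, |ξ n x| ^ q ∂ρ) := by
          gcongr
          exact norm_charFun_sub_le (hξ n) h1 h2 h4 h5 hq2.le hq3 h3 s
      _ = _ := by
          have : |s| ^ q = (k n : ℝ) ^ (-(q / 2)) * |t| ^ q := by
            rw [hs, abs_mul, Real.mul_rpow (abs_nonneg _) (abs_nonneg _), abs_inv,
              abs_of_nonneg (Real.sqrt_nonneg _), Real.sqrt_eq_rpow, ← Real.rpow_neg hk0.le,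
              ← Real.rpow_mul hk0.le]
            congr 2; ring
          rw [this, sub_eq_add_neg, Real.rpow_add hk0, Real.rpow_one]
          ring
  simpa using hdiff.add hmain

/-- Convergence in law is not affected by transformations that tend to the identity locally
uniformly. -/
theorem tendsto_charFun_map_of_locally_unif {μs : ℕ → Measure ℝ} [∀ n, IsProbabilityMeasure (μs n)]
    {μ₀ : Measure ℝ} [IsProbabilityMeasure μ₀]
    (h : ∀ t, Tendsto (fun n => charFun (μs n) t) atTop (𝓝 (charFun μ₀ t)))
    {g : ℕ → ℝ → ℝ} (hg : ∀ n, Measurable (g n))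
    (hloc : ∀ M : ℝ, ∀ ε > 0, ∀ᶠ n in atTop, ∀ y, |y| ≤ M → |g n y - y| ≤ ε) (t : ℝ) :
    Tendsto (fun n => charFun ((μs n).map (g n)) t) atTop (𝓝 (charFun μ₀ t)) := by
  have htight : IsTightMeasureSet (range μs) := isTightMeasureSet_of_tendsto_charFun
    (f := charFun μ₀) (continuous_charFun.continuousAt) h
  have hdiff : Tendsto (fun n => charFun ((μs n).map (g n)) t - charFun (μs n) t) atTop (𝓝 0) := by
    rw [Metric.tendsto_nhds]
    intro ε hε
    obtain ⟨K, hK, hKμ⟩ := isTightMeasureSet_iff_exists_isCompact_measure_compl_le.1 htight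
      (ENNReal.ofReal (ε / 8)) (by simpa using hε)
    obtain ⟨M, hM⟩ := hK.isBounded.exists_norm_le
    set δ : ℝ := ε / (4 * (|t| + 1)) with hδ
    have hδ0 : 0 < δ := by positivity
    filter_upwards [hloc M δ hδ0] with n hn
    have hb : ∀ f : ℝ → ℝ, Measurable f →
        Integrable (fun y => Complex.exp (((t * f y : ℝ) : ℂ) * Complex.I)) (μs n) := by
      intro f hf
      refine Integrable.of_bound (Measurable.aestronglyMeasurable (by fun_prop)) 1
        (Eventually.of_forall fun x => ?_)
      rw [Complex.norm_exp_ofReal_mul_I]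
    have hKm : (μs n).real Kᶜ ≤ ε / 8 := by
      refine ENNReal.toReal_le_of_le_ofReal (by positivity) (hKμ _ ⟨n, rfl⟩)
    have e1 : charFun ((μs n).map (g n)) t - charFun (μs n) t =
        ∫ y, (Complex.exp (((t * g n y : ℝ) : ℂ) * Complex.I) -
          Complex.exp (((t * y : ℝ) : ℂ) * Complex.I)) ∂μs n := by
      have hid : Integrable (fun y : ℝ => Complex.exp (((t * y : ℝ) : ℂ) * Complex.I)) (μs n) :=
        hb _ measurable_id
      rw [integral_sub (hb _ (hg n)) hid, charFun_apply_real, charFun_apply_real,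
        integral_map (hg n).aemeasurable (by fun_prop)]
      push_cast; rfl
    rw [dist_zero_right, e1]
    have hpt : ∀ y, ‖Complex.exp (((t * g n y : ℝ) : ℂ) * Complex.I) -
          Complex.exp (((t * y : ℝ) : ℂ) * Complex.I)‖ ≤
          ε / 4 + Kᶜ.indicator (fun _ => (2 : ℝ)) y := by
      intro y
      by_cases hy : y ∈ K
      · have hyc : y ∉ Kᶜ := fun h => h hy
        rw [indicator_of_notMem hyc, add_zero]
        have h1 := hn y (by simpa using hM y hy)
        have h2 : Complex.exp (((t * g n y : ℝ) : ℂ) * Complex.I) -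
            Complex.exp (((t * y : ℝ) : ℂ) * Complex.I) =
            Complex.exp (((t * y : ℝ) : ℂ) * Complex.I) *
              (Complex.exp (Complex.I * ((t * (g n y - y) : ℝ) : ℂ)) - 1) := by
          rw [mul_sub, mul_one, ← Complex.exp_add]
          congr 2
          push_cast; ring
        rw [h2, norm_mul, Complex.norm_exp_ofReal_mul_I, one_mul]
        calc _ ≤ ‖t * (g n y - y)‖ := Real.norm_exp_I_mul_ofReal_sub_one_le
          _ ≤ |t| * δ := by rw [Real.norm_eq_abs, abs_mul]; gcongr
          _ ≤ (|t| + 1) * δ := by gcongr; linarith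
          _ = ε / 4 := by rw [hδ]; field_simp
      · rw [indicator_of_mem (by exact hy)]
        calc _ ≤ (1 : ℝ) + 1 := (norm_sub_le _ _).trans (by
              rw [Complex.norm_exp_ofReal_mul_I, Complex.norm_exp_ofReal_mul_I])
          _ ≤ _ := by linarith
    have hi : Integrable (Kᶜ.indicator (fun _ => (2 : ℝ))) (μs n) :=
      (integrable_const _).indicator hK.measurableSet.compl
    calc _ ≤ ∫ y, (ε / 4 + Kᶜ.indicator (fun _ => (2 : ℝ)) y) ∂μs n :=
          norm_integral_le_of_norm_le ((integrable_const _).add hi) (Eventually.of_forall hpt)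
      _ = ε / 4 + (μs n).real Kᶜ * 2 := by
          rw [integral_add (integrable_const _) hi, integral_indicator hK.measurableSet.compl]
          simp
      _ < ε := by linarith
  simpa using hdiff.add (h t)

/-! ### Potter bounds for the excess variables -/

/-- Potter bounds. For monotone functions these only need the regular variation along the
ratio `e⁻¹`, iterated; the rounding of `-log u` to an integer accounts for the shift by `1`. -/
theorem nearExp_logExcess {Q : ℝ → ℝ} (hQm : Measurable Q)
    (hanti : AntitoneOn (fun u => Q (1 - u)) (Ioo 0 1)) {γ : ℝ} {ℓ : ℝ → ℝ}
    (hℓ : SlowlyVaryingAtZero ℓ) (hQ : ∀ s ∈ Ioo (0 : ℝ) 1, Q (1 - s) = s ^ (-γ) * ℓ s)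
    {ε : ℝ} (hε : 0 < ε) (hεγ : ε < γ) :
    ∀ᶠ v in 𝓝[>] (0 : ℝ), NearExp (logExcess γ Q v) (γ - ε) (γ + ε) 1 := by
  obtain ⟨⟨δ, hδ, hpos, -⟩, hlim⟩ := hℓ
  set g : ℝ → ℝ := fun u => Q (1 - u) with hg
  have hgpos : ∀ s ∈ Ioo 0 (min δ 1), 0 < g s := by
    intro s hs
    have h1 := lt_min_iff.1 hs.2
    rw [hg]
    simp only
    rw [hQ s ⟨hs.1, h1.2⟩]
    exact mul_pos (Real.rpow_pos_of_pos hs.1 _) (hpos s ⟨hs.1, h1.1⟩)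
  set e : ℝ := Real.exp (-1) with he
  have he0 : 0 < e := Real.exp_pos _
  have he1 : e < 1 := Real.exp_lt_one_iff.2 (by norm_num)
  have hstep : ∀ᶠ s in 𝓝[>] (0 : ℝ), γ - ε < Real.log (g (e * s)) - Real.log (g s) ∧
      Real.log (g (e * s)) - Real.log (g s) < γ + ε := by
    have h1 : Tendsto (fun s => γ + Real.log (ℓ (e * s) / ℓ s)) (𝓝[>] 0) (𝓝 (γ + 0)) := by
      have h2 := hlim e he0
      rw [Real.rpow_zero] at h2
      have h3 := (Real.continuousAt_log one_ne_zero).tendsto.comp h2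
      rw [Real.log_one] at h3
      exact h3.const_add γ
    rw [add_zero] at h1
    have h4 := h1.eventually (Ioo_mem_nhds (show γ - ε < γ by linarith)
      (show γ < γ + ε by linarith))
    filter_upwards [h4, Ioo_mem_nhdsGT (show (0 : ℝ) < min δ 1 by positivity)] with s hs hs1
    have hs2 := lt_min_iff.1 hs1.2
    have hes : e * s ∈ Ioo 0 (min δ 1) :=
      ⟨mul_pos he0 hs1.1, lt_of_le_of_lt (by nlinarith [hs1.1]) hs1.2⟩
    have hes2 := lt_min_iff.1 hes.2
    have h5 : Real.log (g (e * s)) - Real.log (g s) = γ + Real.log (ℓ (e * s) / ℓ s) := by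
      simp only [hg]
      rw [hQ s ⟨hs1.1, hs2.2⟩, hQ (e * s) ⟨hes.1, hes2.2⟩,
        Real.log_mul (Real.rpow_pos_of_pos hes.1 _).ne' (hpos _ ⟨hes.1, hes2.1⟩).ne',
        Real.log_mul (Real.rpow_pos_of_pos hs1.1 _).ne' (hpos _ ⟨hs1.1, hs2.1⟩).ne',
        Real.log_rpow hes.1, Real.log_rpow hs1.1, Real.log_mul he0.ne' hs1.1.ne', he,
        Real.log_exp, ← he, Real.log_div (hpos _ ⟨hes.1, hes2.1⟩).ne' (hpos _ ⟨hs1.1, hs2.1⟩).ne']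
      ring
    rw [h5]
    exact hs
  obtain ⟨v₀, hv₀, hstep⟩ := (mem_nhdsGT_iff_exists_Ioo_subset).1 hstep
  have hv₀ : 0 < v₀ := hv₀
  set v₁ := min v₀ (min δ 1) with hv₁
  have hv₁0 : 0 < v₁ := by positivity
  filter_upwards [Ioo_mem_nhdsGT hv₁0] with v hv
  have hmem : ∀ j : ℕ, Real.exp (-j) * v ∈ Ioo 0 v₁ := fun j =>
    ⟨mul_pos (Real.exp_pos _) hv.1, lt_of_le_of_lt (by
      have : Real.exp (-(j : ℝ)) ≤ 1 := Real.exp_le_one_iff.2 (by simp)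
      nlinarith [hv.1]) hv.2⟩
  have hiter : ∀ j : ℕ, j * (γ - ε) ≤ Real.log (g (Real.exp (-j) * v)) - Real.log (g v) ∧
      Real.log (g (Real.exp (-j) * v)) - Real.log (g v) ≤ j * (γ + ε) := by
    intro j
    induction j with
    | zero => simp
    | succ j ih =>
      have h1 := hstep ⟨(hmem j).1, (hmem j).2.trans_le (min_le_left _ _)⟩
      have h2 : e * (Real.exp (-(j : ℝ)) * v) = Real.exp (-((j + 1 : ℕ) : ℝ)) * v := by
        rw [he, ← mul_assoc, ← Real.exp_add]; congr 2; push_cast; ring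
      rw [mem_ofPred_eq, h2] at h1
      push_cast at h1 ⊢
      constructor
      · linarith [ih.1, h1.1]
      · linarith [ih.2, h1.2]
  have hlogle : ∀ s t, s ∈ Ioo 0 v₁ → t ∈ Ioo 0 v₁ → s ≤ t → Real.log (g t) ≤ Real.log (g s) := by
    intro s t hs ht hst
    have h1 : v₁ ≤ min δ 1 := min_le_right _ _
    have h2 : v₁ ≤ 1 := h1.trans (min_le_right _ _)
    exact Real.log_le_log (hgpos t ⟨ht.1, ht.2.trans_le h1⟩)
      (hanti ⟨hs.1, hs.2.trans_le h2⟩ ⟨ht.1, ht.2.trans_le h2⟩ hst)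
  have hY : ∀ u ∈ Ioo (0 : ℝ) 1, u * v ∈ Ioo 0 v₁ ∧
      logExcess γ Q v u = Real.log (g (u * v)) - Real.log (g v) := by
    intro u hu
    have huv : u * v ∈ Ioo 0 v₁ :=
      ⟨mul_pos hu.1 hv.1, lt_of_le_of_lt (by nlinarith [hv.1, hu.2]) hv.2⟩
    refine ⟨huv, ?_⟩
    rw [logExcess, if_neg hv.1.ne', Real.log_div]
    · exact (hgpos _ ⟨huv.1, huv.2.trans_le (min_le_right _ _)⟩).ne'
    · exact (hgpos _ ⟨hv.1, hv.2.trans_le (min_le_right _ _)⟩).ne'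
  refine ⟨measurable_logExcess_right hQm γ v, by linarith, by linarith, zero_le_one, ?_, ?_, ?_⟩
  · intro u hu
    obtain ⟨huv, h⟩ := hY u hu
    rw [h, sub_nonneg]
    exact hlogle _ _ huv hv (by nlinarith [hv.1, hu.2])
  · intro u hu
    obtain ⟨huv, h⟩ := hY u hu
    have hE : 0 < -Real.log u := by linarith [Real.log_neg hu.1 hu.2]
    set j := ⌊-Real.log u⌋₊ with hj
    have hj1 : (j : ℝ) ≤ -Real.log u := Nat.floor_le hE.le
    have hj2 : -Real.log u < j + 1 := Nat.lt_floor_add_one _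
    have h1 : u * v ≤ Real.exp (-j) * v := by
      have : u ≤ Real.exp (-j) := by
        rw [← Real.log_le_iff_le_exp hu.1]; linarith
      exact mul_le_mul_of_nonneg_right this hv.1.le
    have h2 := hlogle _ _ huv (hmem j) h1
    rw [h]
    nlinarith [(hiter j).1]
  · intro u hu
    obtain ⟨huv, h⟩ := hY u hu
    have hE : 0 < -Real.log u := by linarith [Real.log_neg hu.1 hu.2]
    set j := ⌊-Real.log u⌋₊ with hj
    have hj1 : (j : ℝ) ≤ -Real.log u := Nat.floor_le hE.le
    have hj2 : -Real.log u < j + 1 := Nat.lt_floor_add_one _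
    have h1 : Real.exp (-((j + 1 : ℕ) : ℝ)) * v ≤ u * v := by
      have : Real.exp (-((j + 1 : ℕ) : ℝ)) ≤ u := by
        rw [← Real.le_log_iff_exp_le hu.1]; push_cast; linarith
      exact mul_le_mul_of_nonneg_right this hv.1.le
    have h2 := hlogle _ _ (hmem (j + 1)) huv h1
    have h3 := (hiter (j + 1)).2
    push_cast at h2 h3
    rw [h]
    nlinarith

theorem nearExp_logExcess_zero {Q : ℝ → ℝ} (hQm : Measurable Q) {γ : ℝ} (hγ : 0 < γ) :
    NearExp (logExcess γ Q 0) γ γ 0 := by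
  have h : ∀ u, logExcess γ Q 0 u = γ * (-Real.log u) := fun u => by simp [logExcess]
  refine ⟨measurable_logExcess_right hQm γ 0, hγ, hγ, le_rfl, fun u hu => ?_, fun u _ => ?_,
    fun u _ => ?_⟩
  · rw [h]
    exact mul_nonneg hγ.le (by linarith [Real.log_neg hu.1 hu.2])
  · rw [h]; simp
  · rw [h]; simp

/-! ### Moment ratios of high order -/

theorem NearExp.moment_pos {Y : ℝ → ℝ} {A B c : ℝ} (h : NearExp Y A B c) {s : ℝ} (hs : 0 ≤ s) :
    0 < ∫ u, Y u ^ s ∂unif01 := by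
  refine lt_of_lt_of_le ?_ (h.le_moment hs)
  have := h.hA
  have := Real.Gamma_pos_of_pos (show 0 < s + 1 by linarith)
  positivity

/-- Comparison of the moments of orders `r * a` and `a`, by Stirling's bounds. -/
theorem NearExp.moment_ratio_le {Y : ℝ → ℝ} {A B c : ℝ} (h : NearExp Y A B c) {a r : ℝ}
    (ha : 0 < a) (hr : 0 < r) :
    ∫ u, Y u ^ (r * a) ∂unif01 ≤ Real.exp (c + 1 + c * r) * (r * a + 1) *
      (r * (B / A)) ^ (r * a) * (∫ u, Y u ^ a ∂unif01) ^ r := by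
  have hA := h.hA
  have hB := h.hB
  have hra : 0 < r * a := mul_pos hr ha
  have h1 : Real.exp (-c) * A ^ a * (a ^ a * Real.exp (-a)) ≤ ∫ u, Y u ^ a ∂unif01 := by
    refine le_trans ?_ (h.le_moment ha.le)
    gcongr
    exact le_Gamma_add_one ha.le
  have h2 := Real.rpow_le_rpow (by positivity) h1 hr.le
  calc ∫ u, Y u ^ (r * a) ∂unif01
      ≤ Real.exp c * B ^ (r * a) *
        (Real.exp 1 * (r * a + 1) * ((r * a) ^ (r * a) * Real.exp (-(r * a)))) := by
        refine (h.moment_le hra.le).trans ?_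
        gcongr
        exact Gamma_add_one_le hra
    _ = Real.exp (c + 1 + c * r) * (r * a + 1) * (r * (B / A)) ^ (r * a) *
        (Real.exp (-c) * A ^ a * (a ^ a * Real.exp (-a))) ^ r := by
        have e0 : (Real.exp (-c) * A ^ a * (a ^ a * Real.exp (-a))) ^ r =
            Real.exp (-c * r) * A ^ (r * a) * (a ^ (r * a) * Real.exp (-(r * a))) := by
          rw [Real.mul_rpow (by positivity : (0 : ℝ) ≤ Real.exp (-c) * A ^ a) (by positivity),
            Real.mul_rpow (by positivity : (0 : ℝ) ≤ Real.exp (-c)) (by positivity),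
            Real.mul_rpow (by positivity : (0 : ℝ) ≤ a ^ a) (by positivity), ← Real.exp_mul,
            ← Real.exp_mul, ← Real.rpow_mul hA.le, ← Real.rpow_mul ha.le, mul_comm a r]
          congr 3
          ring
        have e2 : A ^ (r * a) ≠ 0 := (Real.rpow_pos_of_pos hA _).ne'
        rw [e0, Real.mul_rpow hr.le (by positivity : 0 ≤ B / A), Real.div_rpow hB.le hA.le,
          Real.mul_rpow hr.le ha.le, Real.exp_add, Real.exp_add]
        field_simp
        rw [← Real.exp_add]
        simp
    _ ≤ _ := by gcongr

/-- The variance of `Y ^ p`. -/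
theorem NearExp.variance_eq {Y : ℝ → ℝ} {A B c : ℝ} (h : NearExp Y A B c) {p : ℝ} (hp : 0 ≤ p) :
    variance (fun u => Y u ^ p) unif01 =
      ∫ u, Y u ^ (2 * p) ∂unif01 - (∫ u, Y u ^ p ∂unif01) ^ 2 := by
  have hsq : ∀ᵐ u ∂unif01, (Y u ^ p) ^ 2 = Y u ^ (2 * p) := by
    filter_upwards [ae_unif01] with u hu
    rw [← Real.rpow_natCast, ← Real.rpow_mul (h.nonneg u hu), mul_comm]
    norm_num
  have hL : MemLp (fun u => Y u ^ p) 2 unif01 := by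
    rw [memLp_two_iff_integrable_sq (h.meas.pow_const p).aestronglyMeasurable]
    exact (h.integrable (by positivity : (0 : ℝ) ≤ 2 * p)).congr (hsq.mono fun u hu => hu.symm)
  rw [variance_eq_sub hL]
  congr 1
  exact integral_congr_ae hsq

/-! ### Asymptotics of the moments -/

theorem tendsto_linear_mul_exp {p : ℕ → ℝ} (hp : Tendsto p atTop atTop) (C D : ℝ) {b : ℝ}
    (hb : 0 < b) : Tendsto (fun n => C * (D * p n + 1) * Real.exp (-b * p n)) atTop (𝓝 0) := by
  have h1 : Tendsto (fun x : ℝ => x * Real.exp (-b * x)) atTop (𝓝 0) := by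
    simpa using tendsto_rpow_mul_exp_neg_mul_atTop_nhds_zero 1 b hb
  have h2 : Tendsto (fun x : ℝ => Real.exp (-b * x)) atTop (𝓝 0) :=
    Real.tendsto_exp_atBot.comp ((tendsto_const_mul_atBot_of_neg (by linarith)).2 tendsto_id)
  have h3 := ((h1.const_mul (C * D)).add (h2.const_mul C)).comp hp
  simp only [mul_zero, add_zero] at h3
  refine h3.congr fun n => ?_
  simp only [Function.comp_apply]
  ring

/-- The Lyapunov ratio: the moments of order `2rp`, relative to the `r`-th power of those of order
`2p`, are negligible against `k ^ (r - 1)`. -/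
theorem tendsto_lyapunov_ratio {p : ℕ → ℝ} (hp : Tendsto p atTop atTop) {k : ℕ → ℕ} {α : ℝ}
    (hk : ∀ᶠ n in atTop, (k n : ℝ) = Real.exp (α * p n)) {Y : ℕ → ℝ → ℝ} {A B c r : ℝ}
    (hA : 0 < A) (hB : 0 < B) (hY : ∀ᶠ n in atTop, NearExp (Y n) A B c) (hr : 0 < r)
    (hR : 2 * r * Real.log (r * (B / A)) < α * (r - 1)) :
    Tendsto (fun n => (k n : ℝ) ^ (1 - r) * (∫ u, Y n u ^ (r * (2 * p n)) ∂unif01) /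
      (∫ u, Y n u ^ (2 * p n) ∂unif01) ^ r) atTop (𝓝 0) := by
  have hlim := tendsto_linear_mul_exp hp (Real.exp (c + 1 + c * r)) (2 * r) (sub_pos.2 hR)
  refine squeeze_zero' ?_ ?_ hlim
  · filter_upwards [hY, hp.eventually_gt_atTop 0] with n hn hpn
    have h1 := hn.moment_pos (s := r * (2 * p n)) (by positivity)
    have h2 := hn.moment_pos (s := 2 * p n) (by positivity)
    positivity
  · filter_upwards [hY, hp.eventually_gt_atTop 0, hk] with n hn hpn hkn
    have h2 := hn.moment_pos (s := 2 * p n) (by positivity)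
    have h3 := hn.moment_ratio_le (a := 2 * p n) (by positivity) hr
    rw [div_le_iff₀ (by positivity)]
    calc _ ≤ (k n : ℝ) ^ (1 - r) * (Real.exp (c + 1 + c * r) * (r * (2 * p n) + 1) *
          (r * (B / A)) ^ (r * (2 * p n)) * (∫ u, Y n u ^ (2 * p n) ∂unif01) ^ r) := by gcongr
      _ = _ := by
        rw [hkn, ← Real.exp_mul, Real.rpow_def_of_pos (by positivity : 0 < r * (B / A))]
        have : Real.exp (-(α * (r - 1) - 2 * r * Real.log (r * (B / A))) * p n) =
            Real.exp (α * p n * (1 - r)) * Real.exp (Real.log (r * (B / A)) * (r * (2 * p n))) := by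
          rw [← Real.exp_add]; congr 1; ring
        rw [this]
        ring

/-- The second moment of `Y ^ p` dominates the square of its mean. -/
theorem tendsto_mean_div_sqrt {p : ℕ → ℝ} (hp : Tendsto p atTop atTop) {Y : ℕ → ℝ → ℝ} {A B c : ℝ}
    (hA : 0 < A) (hB : 0 < B) (hY : ∀ᶠ n in atTop, NearExp (Y n) A B c) (hR : B / A < 2) :
    Tendsto (fun n => (∫ u, Y n u ^ (p n) ∂unif01) / Real.sqrt (∫ u, Y n u ^ (2 * p n) ∂unif01))
      atTop (𝓝 0) := by
  have hb : 0 < -Real.log (1 / 2 * (B / A)) := by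
    rw [neg_pos]
    exact Real.log_neg (by positivity) (by linarith)
  have hlim := tendsto_linear_mul_exp hp (Real.exp (c + 1 + c * (1 / 2))) 1 hb
  refine squeeze_zero' ?_ ?_ hlim
  · filter_upwards [hY, hp.eventually_gt_atTop 0] with n hn hpn
    have h1 := hn.moment_pos (s := p n) hpn.le
    positivity
  · filter_upwards [hY, hp.eventually_gt_atTop 0] with n hn hpn
    have h2 := hn.moment_pos (s := 2 * p n) (by positivity)
    have h3 := hn.moment_ratio_le (a := 2 * p n) (r := 1 / 2) (by positivity) (by norm_num)
    rw [show (1 : ℝ) / 2 * (2 * p n) = p n by ring, ← Real.sqrt_eq_rpow] at h3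
    rw [div_le_iff₀ (Real.sqrt_pos.2 h2)]
    refine h3.trans_eq ?_
    rw [Real.rpow_def_of_pos (by positivity : 0 < 1 / 2 * (B / A)), one_mul, neg_neg]

/-- The coefficient of variation of the mean of `k` copies of `Y ^ p` tends to zero. -/
theorem tendsto_sqrt_div_mean {p : ℕ → ℝ} (hp : Tendsto p atTop atTop) {k : ℕ → ℕ} {α : ℝ}
    (hk : ∀ᶠ n in atTop, (k n : ℝ) = Real.exp (α * p n)) {Y : ℕ → ℝ → ℝ} {A B c : ℝ}
    (hA : 0 < A) (hB : 0 < B) (hY : ∀ᶠ n in atTop, NearExp (Y n) A B c)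
    (hR : 2 * Real.log (2 * (B / A)) < α) :
    Tendsto (fun n => Real.sqrt (∫ u, Y n u ^ (2 * p n) ∂unif01) /
      (Real.sqrt (k n) * ∫ u, Y n u ^ (p n) ∂unif01)) atTop (𝓝 0) := by
  have hlim := (Real.continuous_sqrt.tendsto 0).comp
    (tendsto_linear_mul_exp hp (Real.exp (c + 1 + c * 2)) 2 (sub_pos.2 hR))
  rw [Real.sqrt_zero] at hlim
  refine squeeze_zero' ?_ ?_ hlim
  · filter_upwards [hY, hp.eventually_gt_atTop 0] with n hn hpn
    have h1 := hn.moment_pos (s := p n) hpn.le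
    positivity
  · filter_upwards [hY, hp.eventually_gt_atTop 0, hk] with n hn hpn hkn
    have h1 := hn.moment_pos (s := p n) hpn.le
    have h3 := hn.moment_ratio_le (a := p n) (r := 2) hpn (by norm_num)
    have hk0 : (0 : ℝ) < k n := by rw [hkn]; exact Real.exp_pos _
    rw [Function.comp_apply]
    refine Real.le_sqrt_of_sq_le ?_
    rw [div_pow, mul_pow, Real.sq_sqrt hk0.le,
      Real.sq_sqrt (hn.moment_pos (s := 2 * p n) (by positivity)).le,
      div_le_iff₀ (by positivity)]
    refine h3.trans_eq ?_
    rw [hkn, Real.rpow_def_of_pos (by positivity : 0 < 2 * (B / A)), Real.rpow_two]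
    have : Real.exp (Real.log (2 * (B / A)) * (2 * p n)) =
        Real.exp (-(α - 2 * Real.log (2 * (B / A))) * p n) * Real.exp (α * p n) := by
      rw [← Real.exp_add]; congr 1; ring
    rw [this]
    ring

/-- The standard deviation of `Y ^ p` is asymptotically the root of its second moment. -/
theorem tendsto_std_div_sqrt {p : ℕ → ℝ} (hp : Tendsto p atTop atTop) {Y : ℕ → ℝ → ℝ} {A B c : ℝ}
    (hA : 0 < A) (hB : 0 < B) (hY : ∀ᶠ n in atTop, NearExp (Y n) A B c) (hR : B / A < 2) :
    Tendsto (fun n => Real.sqrt (variance (fun u => Y n u ^ p n) unif01) /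
      Real.sqrt (∫ u, Y n u ^ (2 * p n) ∂unif01)) atTop (𝓝 1) := by
  have h1 := tendsto_mean_div_sqrt hp hA hB hY hR
  have h2 : Tendsto (fun n => Real.sqrt (1 - ((∫ u, Y n u ^ (p n) ∂unif01) /
      Real.sqrt (∫ u, Y n u ^ (2 * p n) ∂unif01)) ^ 2)) atTop (𝓝 (Real.sqrt (1 - 0 ^ 2))) :=
    (Real.continuous_sqrt.tendsto _).comp ((h1.pow 2).const_sub 1)
  norm_num at h2
  refine h2.congr' ?_
  filter_upwards [hY, hp.eventually_gt_atTop 0] with n hn hpn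
  have h3 := hn.moment_pos (s := 2 * p n) (by positivity)
  rw [hn.variance_eq hpn.le, ← Real.sqrt_div' _ h3.le, div_pow, Real.sq_sqrt h3.le, sub_div,
    div_self h3.ne']

/-- Central limit theorem for means of `Y ^ p` with `p` growing with the sample size. -/
theorem tendsto_charFun_powerMean {p : ℕ → ℝ} (hp : Tendsto p atTop atTop) {k : ℕ → ℕ} {α : ℝ}
    (hα : 0 < α) (hk : ∀ᶠ n in atTop, (k n : ℝ) = Real.exp (α * p n)) {Y : ℕ → ℝ → ℝ} {A B c r : ℝ}
    (hA : 0 < A) (hB : 0 < B) (hYm : ∀ n, Measurable (Y n))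
    (hY : ∀ᶠ n in atTop, NearExp (Y n) A B c) (hR : B / A < 2) (hr : 1 < r) (hr2 : r ≤ 3 / 2)
    (hR3 : 2 * r * Real.log (r * (B / A)) < α * (r - 1)) (t : ℝ) :
    Tendsto (fun n => charFun ((Measure.pi fun _ : Fin (k n) => unif01).map fun w =>
      Real.sqrt (k n) / Real.sqrt (variance (fun u => Y n u ^ p n) unif01) *
        ((1 / (k n : ℝ)) * ∑ i, Y n (w i) ^ p n - ∫ u, Y n u ^ p n ∂unif01)) t) atTop
      (𝓝 (charFun (gaussianReal 0 1) t)) := by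
  set σ : ℕ → ℝ := fun n => Real.sqrt (variance (fun u => Y n u ^ p n) unif01) with hσ
  set m : ℕ → ℝ := fun n => ∫ u, Y n u ^ p n ∂unif01 with hm
  set M : ℕ → ℝ := fun n => ∫ u, Y n u ^ (2 * p n) ∂unif01 with hM
  have hkR : Tendsto (fun n => (k n : ℝ)) atTop atTop := by
    refine (Real.tendsto_exp_atTop.comp (hp.const_mul_atTop hα)).congr' ?_
    filter_upwards [hk] with n hn using hn.symm
  have hkN : Tendsto k atTop atTop := tendsto_natCast_atTop_iff.1 hkR
  have hmM := tendsto_mean_div_sqrt hp hA hB hY hR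
  have hLy := tendsto_lyapunov_ratio hp hk hA hB hY (by linarith) hR3
  -- eventually `M ≤ 2 σ²` and `m ≤ σ`
  have hσM : ∀ᶠ n in atTop, 0 < σ n ∧ M n ≤ 2 * σ n ^ 2 ∧ m n ≤ σ n := by
    filter_upwards [hY, hp.eventually_gt_atTop 0, hmM.eventually_lt_const
      (show (0 : ℝ) < 1 / 2 by norm_num)] with n hn hpn h1
    have hM0 : 0 < M n := hn.moment_pos (s := 2 * p n) (by positivity)
    have hm0 : 0 < m n := hn.moment_pos (s := p n) hpn.le
    have hs0 := Real.sqrt_pos.2 hM0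
    have h2 : m n < 1 / 2 * Real.sqrt (M n) := (div_lt_iff₀ hs0).1 h1
    have hss : Real.sqrt (M n) ^ 2 = M n := Real.sq_sqrt hM0.le
    have hvar : variance (fun u => Y n u ^ p n) unif01 = M n - m n ^ 2 := hn.variance_eq hpn.le
    have hm2 : m n ^ 2 < M n / 4 := by nlinarith
    have hσ2 : σ n ^ 2 = M n - m n ^ 2 := by
      rw [hσ]; simp only; rw [hvar, Real.sq_sqrt]; nlinarith
    have hσ0 : 0 < σ n := by
      rw [hσ]; simp only; rw [hvar]; exact Real.sqrt_pos.2 (by nlinarith)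
    refine ⟨hσ0, by nlinarith, ?_⟩
    refine le_of_sq_le_sq ?_ hσ0.le
    nlinarith
  set ξ : ℕ → ℝ → ℝ := fun n u => (Y n u ^ p n - m n) / σ n with hξ
  have hξm : ∀ n, Measurable (ξ n) := fun n => (((hYm n).pow_const _).sub_const _).div_const _
  have hpt : ∀ᶠ n in atTop, ∀ᵐ u ∂unif01, |ξ n u| ^ (2 * r) ≤
      Y n u ^ (r * (2 * p n)) / σ n ^ (2 * r) + 1 := by
    filter_upwards [hY, hσM, hp.eventually_gt_atTop 0] with n hn ⟨hσ0, h2, h3⟩ hpn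
    filter_upwards [ae_unif01] with u hu
    have hY0 := hn.nonneg u hu
    have hYp : 0 ≤ Y n u ^ p n := Real.rpow_nonneg hY0 _
    have hm0 : 0 < m n := hn.moment_pos (s := p n) hpn.le
    have e1 : Y n u ^ (r * (2 * p n)) / σ n ^ (2 * r) = (Y n u ^ p n / σ n) ^ (2 * r) := by
      rw [Real.div_rpow hYp hσ0.le, ← Real.rpow_mul hY0]
      congr 2; ring
    rw [e1, hξ]
    simp only
    rcases le_total (Y n u ^ p n) (m n) with h | h
    · have : |(Y n u ^ p n - m n) / σ n| ≤ 1 := by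
        rw [abs_div, abs_of_pos hσ0, div_le_one hσ0, abs_sub_comm, abs_of_nonneg (by linarith)]
        linarith
      have h5 := Real.rpow_le_one (abs_nonneg _) this (by linarith : 0 ≤ 2 * r)
      have h6 : 0 ≤ (Y n u ^ p n / σ n) ^ (2 * r) := by positivity
      linarith
    · have : |(Y n u ^ p n - m n) / σ n| ≤ Y n u ^ p n / σ n := by
        rw [abs_div, abs_of_pos hσ0, abs_of_nonneg (by linarith)]
        gcongr; linarith
      have h5 := Real.rpow_le_rpow (abs_nonneg _) this (by linarith : 0 ≤ 2 * r)
      linarith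
  have hint : ∀ᶠ n in atTop, Integrable (fun u => |ξ n u| ^ (2 * r)) unif01 ∧
      ∫ u, |ξ n u| ^ (2 * r) ∂unif01 ≤
        (∫ u, Y n u ^ (r * (2 * p n)) ∂unif01) / σ n ^ (2 * r) + 1 := by
    filter_upwards [hY, hpt, hp.eventually_gt_atTop 0] with n hn h1 hpn
    have hi : Integrable (fun u => Y n u ^ (r * (2 * p n)) / σ n ^ (2 * r) + 1) unif01 :=
      ((hn.integrable (by positivity)).div_const _).add (integrable_const _)
    have hi2 : Integrable (fun u => |ξ n u| ^ (2 * r)) unif01 := by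
      refine hi.mono' ((hξm n).abs.pow_const _).aestronglyMeasurable ?_
      filter_upwards [h1] with u hu
      rw [Real.norm_of_nonneg (by positivity)]
      exact hu
    refine ⟨hi2, (integral_mono_ae hi2 hi h1).trans_eq ?_⟩
    rw [integral_add ((hn.integrable (by positivity)).div_const _) (integrable_const _),
      integral_div]
    simp
  have hcond : ∀ᶠ n in atTop, Integrable (ξ n) unif01 ∧
      Integrable (fun x => ξ n x ^ 2) unif01 ∧ Integrable (fun x => |ξ n x| ^ (2 * r)) unif01 ∧
      ∫ x, ξ n x ∂unif01 = 0 ∧ ∫ x, ξ n x ^ 2 ∂unif01 = 1 := by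
    filter_upwards [hY, hint, hσM, hp.eventually_gt_atTop 0] with n hn h1 h2 hpn
    have hYi := hn.integrable hpn.le
    have hvar : ∫ u, (Y n u ^ p n - m n) ^ 2 ∂unif01 = σ n ^ 2 := by
      rw [hσ]; simp only
      rw [Real.sq_sqrt (variance_nonneg _ _), variance_eq_integral
        ((hn.meas.pow_const _).aemeasurable)]
    have hi : Integrable (ξ n) unif01 := (hYi.sub (integrable_const _)).div_const _
    have hsq : ∫ x, ξ n x ^ 2 ∂unif01 = 1 := by
      simp only [hξ, div_pow]
      rw [integral_div, hvar, div_self (pow_pos h2.1 2).ne']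
    refine ⟨hi, ?_, h1.1, ?_, hsq⟩
    · by_contra hcon
      rw [integral_undef hcon] at hsq
      exact zero_ne_one hsq
    · simp only [hξ]
      rw [integral_div, integral_sub hYi (integrable_const _)]
      simp [hm]
  have hL : Tendsto (fun n => (k n : ℝ) ^ (1 - 2 * r / 2) * ∫ x, |ξ n x| ^ (2 * r) ∂unif01) atTop
      (𝓝 0) := by
    have hk1 : Tendsto (fun n => (k n : ℝ) ^ (1 - r)) atTop (𝓝 0) := by
      have := (tendsto_rpow_neg_atTop (show 0 < r - 1 by linarith)).comp hkR
      refine this.congr fun n => ?_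
      rw [Function.comp_apply, neg_sub]
    have hlim := (hLy.const_mul ((2 : ℝ) ^ r)).add hk1
    rw [mul_zero, add_zero] at hlim
    refine squeeze_zero' (Eventually.of_forall fun n => ?_) ?_ hlim
    · have : 0 ≤ ∫ x, |ξ n x| ^ (2 * r) ∂unif01 := integral_nonneg fun x => by positivity
      positivity
    · filter_upwards [hint, hσM, hY, hp.eventually_gt_atTop 0] with n h1 ⟨h2, h3, _⟩ hn hpn
      have hM0 : 0 < M n := hn.moment_pos (s := 2 * p n) (by positivity)
      have hMr0 := hn.moment_pos (s := r * (2 * p n)) (by positivity)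
      have h5 : M n ^ r ≤ 2 ^ r * σ n ^ (2 * r) := by
        calc M n ^ r ≤ (2 * σ n ^ 2) ^ r := Real.rpow_le_rpow hM0.le h3 (by linarith)
          _ = _ := by
            rw [Real.mul_rpow (by norm_num) (by positivity), Real.rpow_mul h2.le, Real.rpow_two]
      have h6 : (∫ u, Y n u ^ (r * (2 * p n)) ∂unif01) / σ n ^ (2 * r) ≤
          2 ^ r * ((∫ u, Y n u ^ (r * (2 * p n)) ∂unif01) / M n ^ r) := by
        rw [div_le_iff₀ (by positivity)]
        calc _ = (∫ u, Y n u ^ (r * (2 * p n)) ∂unif01) / M n ^ r * M n ^ r := by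
              field_simp
          _ ≤ (∫ u, Y n u ^ (r * (2 * p n)) ∂unif01) / M n ^ r * (2 ^ r * σ n ^ (2 * r)) := by
              gcongr
          _ = _ := by ring
      rw [mul_div_cancel_left₀ _ two_ne_zero]
      calc _ ≤ (k n : ℝ) ^ (1 - r) *
            (2 ^ r * ((∫ u, Y n u ^ (r * (2 * p n)) ∂unif01) / M n ^ r) + 1) := by
            gcongr
            exact h1.2.trans (by linarith)
        _ = _ := by ring
  have hclt := tendsto_charFun_normalized_sum (ρ := unif01) hkN hξm (q := 2 * r) (by linarith)
    (by linarith) hcond hL t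
  refine hclt.congr' ?_
  filter_upwards [hσM, hkR.eventually_gt_atTop 0] with n ⟨h1, _, _⟩ hk0
  congr 2
  ext w
  have hsk : Real.sqrt (k n) ≠ 0 := (Real.sqrt_pos.2 hk0).ne'
  change _ = Real.sqrt (k n) / σ n * (1 / (k n : ℝ) * ∑ i, Y n (w i) ^ p n - m n)
  simp only [hξ]
  rw [← Finset.sum_div, Finset.sum_sub_distrib]
  simp only [Finset.sum_const, Finset.card_univ, Fintype.card_fin, nsmul_eq_mul]
  field_simp
  rw [Real.sq_sqrt hk0.le]

/-! ### The delta method for `p`-th roots -/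

/-- Linearization of the `p`-th root with an error bound that does not depend on `p`. -/
theorem abs_root_sub_le {p x : ℝ} (hp : 1 ≤ p) (hx : |x| ≤ 1 / 2) :
    |p * ((1 + x) ^ (1 / p) - 1) - x| ≤ 2 * x ^ 2 := by
  have hx' := abs_le.1 hx
  have hp0 : 0 < p := by linarith
  have h1x : 0 < 1 + x := by linarith
  have hup : (1 + x) ^ (1 / p) ≤ 1 + 1 / p * x :=
    rpow_one_add_le_one_add_mul_self (by linarith) (by positivity)
      (by rw [div_le_one hp0]; exact hp)
  have hlo : 1 + Real.log (1 + x) / p ≤ (1 + x) ^ (1 / p) := by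
    rw [Real.rpow_def_of_pos h1x]
    have := Real.add_one_le_exp (Real.log (1 + x) * (1 / p))
    rw [div_eq_mul_one_div]; linarith
  have hlog : x - 2 * x ^ 2 ≤ Real.log (1 + x) := by
    refine le_trans ?_ (Real.one_sub_inv_le_log_of_pos h1x)
    rw [← sub_nonneg]
    have : 1 - (1 + x)⁻¹ - (x - 2 * x ^ 2) = x ^ 2 * (1 + 2 * x) / (1 + x) := by
      field_simp; ring
    rw [this]
    have : 0 ≤ 1 + 2 * x := by linarith
    positivity
  have h1 : p * (1 + x) ^ (1 / p) ≤ p + x := by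
    calc _ ≤ p * (1 + 1 / p * x) := by gcongr
      _ = _ := by field_simp
  have h2 : p + Real.log (1 + x) ≤ p * (1 + x) ^ (1 / p) := by
    calc p + Real.log (1 + x) = p * (1 + Real.log (1 + x) / p) := by field_simp
      _ ≤ _ := by gcongr
  rw [abs_le]
  constructor
  · linarith
  · nlinarith [sq_nonneg x]

/-- If a statistic deviates from its mean, relatively, by `τ y` with `τ → 0`, then `p` times the
relative deviation of its `p`-th root is `τ y` to first order. Asymptotically correct changes of scale
(`c → 1`) and location (`d → 0`) do not matter, and the convergence is locally uniform in `y`. -/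
theorem root_transform_locally_unif {p τ c d : ℕ → ℝ} (hp : Tendsto p atTop atTop)
    (hτ0 : ∀ᶠ n in atTop, 0 < τ n) (hτ : Tendsto τ atTop (𝓝 0)) (hc : Tendsto c atTop (𝓝 1))
    (hd : Tendsto d atTop (𝓝 0)) (M ε : ℝ) (hε : 0 < ε) :
    ∀ᶠ n in atTop, ∀ y, |y| ≤ M →
      |(τ n)⁻¹ * (p n * ((1 + τ n * (c n * y + d n)) ^ (1 / p n) - 1)) - y| ≤ ε := by
  rcases lt_or_ge M 0 with hM | hM
  · exact Eventually.of_forall fun n y hy => absurd (hy.trans_lt hM) (not_lt.2 (abs_nonneg y))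
  set K : ℝ := 2 * M + 1 with hK
  have h1 : ∀ᶠ n in atTop, τ n * K < 1 / 2 := by
    have := hτ.mul_const K
    rw [zero_mul] at this
    exact this.eventually_lt_const (by norm_num)
  have h2 : ∀ᶠ n in atTop, 2 * τ n * K ^ 2 + (|c n - 1| * M + |d n|) < ε := by
    have e1 : Tendsto (fun n => 2 * τ n * K ^ 2 + (|c n - 1| * M + |d n|)) atTop
        (𝓝 (2 * 0 * K ^ 2 + (|(1 : ℝ) - 1| * M + |(0 : ℝ)|))) :=
      ((hτ.const_mul 2).mul_const _).add ((((hc.sub_const 1).abs).mul_const M).add hd.abs)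
    refine e1.eventually_lt_const ?_
    simpa using hε
  have h3 : ∀ᶠ n in atTop, |c n - 1| < 1 := by
    have := (hc.sub_const 1).abs
    rw [sub_self, abs_zero] at this
    exact this.eventually_lt_const one_pos
  have h4 : ∀ᶠ n in atTop, |d n| < 1 := by
    have := hd.abs
    rw [abs_zero] at this
    exact this.eventually_lt_const one_pos
  filter_upwards [h1, h2, h3, h4, hτ0, hp.eventually_ge_atTop 1] with n h1 h2 h3 h4 hτ0 hp1 y hy
  set z := c n * y + d n with hz
  have hzy : |z - y| ≤ |c n - 1| * M + |d n| := by
    have : z - y = (c n - 1) * y + d n := by rw [hz]; ring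
    rw [this]
    refine (abs_add_le _ _).trans ?_
    rw [abs_mul]
    gcongr
  have hzK : |z| ≤ K := by
    have e1 : |z| ≤ |z - y| + |y| := by
      have := abs_add_le (z - y) y
      rwa [sub_add_cancel] at this
    have e2 : |c n - 1| * M ≤ 1 * M := by gcongr
    rw [hK]; linarith
  have hx : |τ n * z| ≤ 1 / 2 := by
    rw [abs_mul, abs_of_pos hτ0]
    exact (mul_le_mul_of_nonneg_left hzK hτ0.le).trans h1.le
  have h5 := abs_root_sub_le hp1 hx
  have h6 : |(τ n)⁻¹ * (p n * ((1 + τ n * z) ^ (1 / p n) - 1)) - z| ≤ 2 * τ n * K ^ 2 := by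
    have e1 : (τ n)⁻¹ * (p n * ((1 + τ n * z) ^ (1 / p n) - 1)) - z =
        (τ n)⁻¹ * (p n * ((1 + τ n * z) ^ (1 / p n) - 1) - τ n * z) := by
      field_simp
    rw [e1, abs_mul, abs_of_pos (inv_pos.2 hτ0)]
    calc _ ≤ (τ n)⁻¹ * (2 * (τ n * z) ^ 2) := by gcongr
      _ = 2 * τ n * z ^ 2 := by field_simp
      _ ≤ _ := by
        have : z ^ 2 ≤ K ^ 2 := sq_le_sq' (by linarith [(abs_le.1 hzK).1]) (abs_le.1 hzK).2
        gcongr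
  calc _ ≤ |(τ n)⁻¹ * (p n * ((1 + τ n * z) ^ (1 / p n) - 1)) - z| + |z - y| :=
        abs_sub_le _ _ _
    _ ≤ ε := by linarith

/-- Central limit theorem for `p`-th roots of means of `Y ^ p`, with centering `m'` and norming
`σ'` that are sufficiently close to the mean and the standard deviation of `Y ^ p`. -/
theorem tendsto_charFun_rootMean {p : ℕ → ℝ} (hp : Tendsto p atTop atTop) {k : ℕ → ℕ} {α : ℝ}
    (hα : 0 < α) (hk : ∀ᶠ n in atTop, (k n : ℝ) = Real.exp (α * p n)) {Y : ℕ → ℝ → ℝ} {A B c r : ℝ}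
    (hA : 0 < A) (hB : 0 < B) (hYm : ∀ n, Measurable (Y n))
    (hY : ∀ᶠ n in atTop, NearExp (Y n) A B c) (hR : B / A < 2) (hr : 1 < r) (hr2 : r ≤ 3 / 2)
    (hR3 : 2 * r * Real.log (r * (B / A)) < α * (r - 1)) {m' σ' : ℕ → ℝ}
    (hm' : ∀ᶠ n in atTop, 0 < m' n) (hσ' : ∀ᶠ n in atTop, 0 < σ' n)
    (hτ : Tendsto (fun n => σ' n / (Real.sqrt (k n) * m' n)) atTop (𝓝 0))
    (hc : Tendsto (fun n => Real.sqrt (variance (fun u => Y n u ^ p n) unif01) / σ' n) atTop (𝓝 1))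
    (hd : Tendsto (fun n => Real.sqrt (k n) * (∫ u, Y n u ^ p n ∂unif01 - m' n) / σ' n) atTop
      (𝓝 0)) (t : ℝ) :
    Tendsto (fun n => charFun ((Measure.pi fun _ : Fin (k n) => unif01).map fun w =>
      Real.sqrt (k n) * m' n / σ' n *
        (p n * ((((1 / (k n : ℝ)) * ∑ i, Y n (w i) ^ p n) / m' n) ^ (1 / p n) - 1))) t) atTop
      (𝓝 (charFun (gaussianReal 0 1) t)) := by
  have hclt := fun t => tendsto_charFun_powerMean hp hα hk hA hB hYm hY hR hr hr2 hR3 t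
  have hTm : ∀ n, Measurable fun w : Fin (k n) → ℝ =>
      Real.sqrt (k n) / Real.sqrt (variance (fun u => Y n u ^ p n) unif01) *
        ((1 / (k n : ℝ)) * ∑ i, Y n (w i) ^ p n - ∫ u, Y n u ^ p n ∂unif01) := fun n =>
    (((Finset.measurable_sum _ fun i _ => ((hYm n).comp (measurable_pi_apply i)).pow_const _).const_mul
      _).sub_const _).const_mul _
  have hprob := fun n => Measure.isProbabilityMeasure_map
    (μ := Measure.pi fun _ : Fin (k n) => unif01) (hTm n).aemeasurable
  have hτ0 : ∀ᶠ n in atTop, 0 < σ' n / (Real.sqrt (k n) * m' n) := by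
    filter_upwards [hm', hσ', hk] with n h1 h2 h3
    have : 0 < Real.sqrt (k n) := by rw [h3]; exact Real.sqrt_pos.2 (Real.exp_pos _)
    positivity
  have hloc := root_transform_locally_unif hp hτ0 hτ hc hd
  refine (tendsto_charFun_map_of_locally_unif hclt (fun n => by fun_prop) hloc t).congr' ?_
  have hσ0 : ∀ᶠ n in atTop, 0 < Real.sqrt (variance (fun u => Y n u ^ p n) unif01) := by
    filter_upwards [hc.eventually_const_lt one_pos, hσ'] with n h1 h2
    by_contra h3
    exact absurd h1 (not_lt.2 (div_nonpos_of_nonpos_of_nonneg (not_lt.1 h3) h2.le))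
  filter_upwards [hm', hσ', hk, hσ0] with n h1 h2 h3 h4
  rw [Measure.map_map (by fun_prop) (hTm n)]
  congr 2
  ext w
  have hsk : 0 < Real.sqrt (k n) := by rw [h3]; exact Real.sqrt_pos.2 (Real.exp_pos _)
  simp only [Function.comp_apply]
  set S := (1 / (k n : ℝ)) * ∑ i, Y n (w i) ^ p n
  set m := ∫ u, Y n u ^ p n ∂unif01
  set σ := Real.sqrt (variance (fun u => Y n u ^ p n) unif01)
  have e1 : 1 + σ' n / (Real.sqrt (k n) * m' n) * (σ / σ' n * (Real.sqrt (k n) / σ * (S - m)) +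
      Real.sqrt (k n) * (m - m' n) / σ' n) = S / m' n := by
    field_simp
    ring
  rw [e1, inv_div]

/-- The margins used in the central limit theorem: for `α > 2` there are a Lyapunov exponent
`r > 1` and a Potter error `ε` such that all the error terms are negligible. -/
theorem exists_margins {α γ : ℝ} (hα : 2 < α) (hγ : 0 < γ) : ∃ r ε : ℝ, 1 < r ∧ r ≤ 3 / 2 ∧
    0 < ε ∧ ε < γ ∧ (γ + ε) / (γ - ε) < 2 ∧ 2 * Real.log (2 * ((γ + ε) / (γ - ε))) < α ∧
    2 * r * Real.log (r * ((γ + ε) / (γ - ε))) < α * (r - 1) := by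
  set r : ℝ := 1 + min (1 / 2) ((α - 2) / 4) with hr
  have hmin : 0 < min (1 / 2) ((α - 2) / 4) := lt_min (by norm_num) (by linarith)
  have hr1 : 1 < r := by rw [hr]; linarith
  have hr2 : r ≤ 3 / 2 := by rw [hr]; linarith [min_le_left (1 / 2) ((α - 2) / 4)]
  have hr3 : 2 * r < α := by rw [hr]; linarith [min_le_right (1 / 2) ((α - 2) / 4)]
  have hR : Tendsto (fun ε : ℝ => (γ + ε) / (γ - ε)) (𝓝[>] 0) (𝓝 1) := by
    have : ContinuousAt (fun ε : ℝ => (γ + ε) / (γ - ε)) 0 :=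
      ContinuousAt.div (by fun_prop) (by fun_prop) (by simpa using hγ.ne')
    have h := this.tendsto
    simp only [add_zero, sub_zero, div_self hγ.ne'] at h
    exact h.mono_left nhdsWithin_le_nhds
  have h1 : ∀ᶠ ε in 𝓝[>] (0 : ℝ), (γ + ε) / (γ - ε) < 2 := hR.eventually_lt_const (by norm_num)
  have h2 : ∀ᶠ ε in 𝓝[>] (0 : ℝ), 2 * Real.log (2 * ((γ + ε) / (γ - ε))) < α := by
    have := ((hR.const_mul 2).log (by norm_num)).const_mul 2
    refine this.eventually_lt_const ?_
    rw [mul_one]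
    linarith [Real.log_two_lt_d9]
  have h3 : ∀ᶠ ε in 𝓝[>] (0 : ℝ), 2 * r * Real.log (r * ((γ + ε) / (γ - ε))) < α * (r - 1) := by
    have := ((hR.const_mul r).log (by linarith)).const_mul (2 * r)
    refine this.eventually_lt_const ?_
    rw [mul_one]
    have : Real.log r ≤ r - 1 := Real.log_le_sub_one_of_pos (by linarith)
    calc _ ≤ 2 * r * (r - 1) := by gcongr
      _ < _ := mul_lt_mul_of_pos_right hr3 (by linarith)
  obtain ⟨ε, ⟨⟨e1, e2⟩, e3⟩, e4⟩ := (((h1.and h2).and h3).and (Ioo_mem_nhdsGT hγ)).exists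
  exact ⟨r, ε, hr1, hr2, e4.1, e4.2, e1, e2, e3⟩

/-! ### Consistency for deterministic values of the order statistic -/

/-- Upper tail, by Markov's inequality. -/
theorem tendsto_measure_powerMean_ge {p : ℕ → ℝ} (hp : Tendsto p atTop atTop) {k : ℕ → ℕ}
    (hk : ∀ᶠ n in atTop, 0 < k n) {Y : ℕ → ℝ → ℝ} {A B c D : ℝ} (hB : 0 < B)
    (hY : ∀ᶠ n in atTop, NearExp (Y n) A B c) (hD : B < D) :
    Tendsto (fun n => (Measure.pi fun _ : Fin (k n) => unif01) {w |
      D ^ p n * Real.Gamma (p n + 1) ≤ (1 / (k n : ℝ)) * ∑ i, Y n (w i) ^ p n}) atTop (𝓝 0) := by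
  have hD0 : 0 < D := hB.trans hD
  have hb : 0 < -Real.log (B / D) := by
    rw [neg_pos]; exact Real.log_neg (by positivity) ((div_lt_one hD0).2 hD)
  have hlim := (ENNReal.continuous_ofReal.tendsto 0).comp
    (tendsto_linear_mul_exp hp (Real.exp c) 0 hb)
  rw [ENNReal.ofReal_zero] at hlim
  refine tendsto_of_tendsto_of_tendsto_of_le_of_le' tendsto_const_nhds hlim
    (Eventually.of_forall fun _ => zero_le) ?_
  filter_upwards [hY, hk, hp.eventually_gt_atTop 0] with n hn hk0 hpn
  have hk0' : (0 : ℝ) < k n := by exact_mod_cast hk0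
  have hΓ := Real.Gamma_pos_of_pos (show 0 < p n + 1 by linarith)
  set π := Measure.pi fun _ : Fin (k n) => unif01
  set S : (Fin (k n) → ℝ) → ℝ := fun w => (1 / (k n : ℝ)) * ∑ i, Y n (w i) ^ p n with hS
  have hYi := hn.integrable hpn.le
  have hterm : ∀ i : Fin (k n), Integrable (fun w : Fin (k n) → ℝ => Y n (w i) ^ p n) π :=
    fun i => integrable_comp_eval (μ := fun _ : Fin (k n) => unif01) (f := fun u => Y n u ^ p n) hYi
  have hSi : Integrable S π := (integrable_finsetSum _ fun i _ => hterm i).const_mul _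
  have hS0 : 0 ≤ᵐ[π] S := by
    filter_upwards [ae_pi_unif01 (Fin (k n))] with w hw
    have : 0 ≤ ∑ i, Y n (w i) ^ p n :=
      Finset.sum_nonneg fun i _ => Real.rpow_nonneg (hn.nonneg _ (hw i)) _
    simp only [hS, Pi.zero_apply]
    positivity
  have hSm : ∫ w, S w ∂π = ∫ u, Y n u ^ p n ∂unif01 := by
    simp only [hS]
    rw [integral_const_mul, integral_finsetSum _ fun i _ => hterm i]
    have h1 : ∀ i : Fin (k n), ∫ w, Y n (w i) ^ p n ∂π = ∫ u, Y n u ^ p n ∂unif01 := fun i =>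
      integral_comp_eval (μ := fun _ : Fin (k n) => unif01) (f := fun u => Y n u ^ p n)
        hYi.aestronglyMeasurable
    simp only [h1, Finset.sum_const, Finset.card_univ, Fintype.card_fin, nsmul_eq_mul]
    field_simp
  have hT : 0 < D ^ p n * Real.Gamma (p n + 1) := by positivity
  have hmk := mul_meas_ge_le_integral_of_nonneg hS0 hSi (D ^ p n * Real.Gamma (p n + 1))
  rw [hSm] at hmk
  have h2 : π.real {w | D ^ p n * Real.Gamma (p n + 1) ≤ S w} ≤
      Real.exp c * (0 * p n + 1) * Real.exp (-(-Real.log (B / D)) * p n) := by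
    rw [← mul_le_mul_iff_right₀ hT]
    refine hmk.trans ((hn.moment_le hpn.le).trans_eq ?_)
    rw [neg_neg, ← Real.rpow_def_of_pos (by positivity), Real.div_rpow hB.le hD0.le]
    field_simp
    ring
  rw [Function.comp_apply, ← ofReal_measureReal]
  exact ENNReal.ofReal_le_ofReal h2

/-- Lower tail: already the terms with `Y` of the order `p`, whose number is concentrated by
Chebyshev's inequality, contribute enough to the mean. -/
theorem tendsto_measure_powerMean_le {p : ℕ → ℝ} (hp : Tendsto p atTop atTop) {k : ℕ → ℕ} {α : ℝ}
    (hα : 1 < α) (hk : ∀ᶠ n in atTop, (k n : ℝ) = Real.exp (α * p n)) {Y : ℕ → ℝ → ℝ} {A B c D : ℝ}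
    (hA : 0 < A) (hY : ∀ᶠ n in atTop, NearExp (Y n) A B c) (hD0 : 0 < D) (hD : D < A) :
    Tendsto (fun n => (Measure.pi fun _ : Fin (k n) => unif01) {w |
      (1 / (k n : ℝ)) * ∑ i, Y n (w i) ^ p n ≤ D ^ p n * Real.Gamma (p n + 1)}) atTop (𝓝 0) := by
  have hlim := (ENNReal.continuous_ofReal.tendsto 0).comp
    (tendsto_linear_mul_exp hp (4 * Real.exp c) 0 (sub_pos.2 hα))
  rw [ENNReal.ofReal_zero] at hlim
  have hb : 0 < -Real.log (D / A) := by
    rw [neg_pos]; exact Real.log_neg (by positivity) ((div_lt_one hA).2 hD)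
  have hsmall := (tendsto_linear_mul_exp hp (2 * Real.exp (c + 1)) 1 hb).eventually_lt_const one_pos
  refine tendsto_of_tendsto_of_tendsto_of_le_of_le' tendsto_const_nhds hlim
    (Eventually.of_forall fun _ => zero_le) ?_
  filter_upwards [hY, hk, hp.eventually_gt_atTop 0, hsmall] with n hn hkn hpn hsm
  have hk0 : (0 : ℝ) < k n := by rw [hkn]; exact Real.exp_pos _
  set x : ℝ := Real.exp (-(p n + c)) with hx
  have hx0 : 0 < x := Real.exp_pos _
  have hx1 : x ∈ Ioc (0 : ℝ) 1 := ⟨hx0, Real.exp_le_one_iff.2 (by linarith [hn.hc])⟩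
  have hreal : unif01.real (Iio x) = x := by
    rw [Measure.real, unif01_Iio hx1, ENNReal.toReal_ofReal hx0.le]
  have hcount := measure_count_le (Fin (k n)) unif01 (measurableSet_Iio (a := x))
    (by rw [hreal, Fintype.card_fin]; positivity)
  rw [hreal, Fintype.card_fin] at hcount
  have hfin : ENNReal.ofReal (4 / ((k n : ℝ) * x)) =
      ENNReal.ofReal (4 * Real.exp c * (0 * p n + 1) * Real.exp (-(α - 1) * p n)) := by
    congr 1
    have : Real.exp c * Real.exp (-(α - 1) * p n) = ((k n : ℝ) * x)⁻¹ := by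
      rw [hkn, hx, ← Real.exp_add, ← Real.exp_add, ← Real.exp_neg]; congr 1; ring
    rw [div_eq_mul_inv, ← this]; ring
  rw [Function.comp_apply, ← hfin]
  refine le_trans (measure_mono_ae ?_) hcount
  filter_upwards [ae_pi_unif01 (Fin (k n))] with w hw hle
  have hle : (1 / (k n : ℝ)) * ∑ i, Y n (w i) ^ p n ≤ D ^ p n * Real.Gamma (p n + 1) := hle
  change ∑ i, (Iio x).indicator (fun _ => (1 : ℝ)) (w i) ≤ k n * x / 2
  by_contra hN
  rw [not_le] at hN
  have h1 : (A * p n) ^ p n * ∑ i, (Iio x).indicator (fun _ => (1 : ℝ)) (w i) ≤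
      ∑ i, Y n (w i) ^ p n := by
    rw [Finset.mul_sum]
    refine Finset.sum_le_sum fun i _ => ?_
    by_cases hi : w i ∈ Iio x
    · rw [indicator_of_mem hi, mul_one]
      refine Real.rpow_le_rpow (by positivity) (le_trans ?_ (hn.lower _ (hw i))) hpn.le
      have := Real.log_le_log (hw i).1 (le_of_lt hi)
      rw [hx, Real.log_exp] at this
      gcongr
      linarith
    · rw [indicator_of_notMem hi, mul_zero]
      exact Real.rpow_nonneg (hn.nonneg _ (hw i)) _
  have h2 : (A * p n) ^ p n * (k n * x / 2) < k n * (D ^ p n * Real.Gamma (p n + 1)) := by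
    calc _ < (A * p n) ^ p n * ∑ i, (Iio x).indicator (fun _ => (1 : ℝ)) (w i) := by gcongr
      _ ≤ ∑ i, Y n (w i) ^ p n := h1
      _ = k n * ((1 / (k n : ℝ)) * ∑ i, Y n (w i) ^ p n) := by field_simp
      _ ≤ _ := by gcongr
  have h3 : (A * p n) ^ p n * x < 2 * (D ^ p n * Real.Gamma (p n + 1)) := by
    have e1 : (A * p n) ^ p n * (k n * x / 2) = k n * ((A * p n) ^ p n * x / 2) := by ring
    rw [e1] at h2
    have := lt_of_mul_lt_mul_left h2 hk0.le
    linarith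
  have h4 := Gamma_add_one_le hpn
  have h5 : (A * p n) ^ p n * x < 2 * (D ^ p n * (Real.exp 1 * (p n + 1) *
      (p n ^ p n * Real.exp (-p n)))) := h3.trans_le (by gcongr)
  have hx2 : x = Real.exp (-p n) * Real.exp (-c) := by
    rw [hx, ← Real.exp_add]; congr 1; ring
  rw [Real.mul_rpow hA.le hpn.le, hx2] at h5
  have h6 : Real.exp (-(-Real.log (D / A)) * p n) = D ^ p n / A ^ p n := by
    rw [neg_neg, ← Real.rpow_def_of_pos (by positivity), Real.div_rpow hD0.le hA.le]
  rw [h6, Real.exp_add] at hsm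
  have hpp : 0 < p n ^ p n * Real.exp (-p n) := by positivity
  have hcc : Real.exp c * Real.exp (-c) = 1 := by rw [← Real.exp_add]; simp
  have hAp : 0 < A ^ p n := by positivity
  have h7 : 2 * (Real.exp c * Real.exp 1) * (1 * p n + 1) * D ^ p n < A ^ p n := by
    have := mul_lt_mul_of_pos_right hsm hAp
    calc _ = 2 * (Real.exp c * Real.exp 1) * (1 * p n + 1) * (D ^ p n / A ^ p n) * A ^ p n := by
          field_simp
      _ < _ := by linarith
  have h8 : A ^ p n * Real.exp (-c) < 2 * Real.exp 1 * (p n + 1) * D ^ p n := by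
    have e1 : (p n ^ p n * Real.exp (-p n)) * (A ^ p n * Real.exp (-c)) <
        (p n ^ p n * Real.exp (-p n)) * (2 * Real.exp 1 * (p n + 1) * D ^ p n) := by
      calc _ = A ^ p n * p n ^ p n * (Real.exp (-p n) * Real.exp (-c)) := by ring
        _ < _ := h5
        _ = _ := by ring
    exact lt_of_mul_lt_mul_left e1 hpp.le
  have h9 := mul_lt_mul_of_pos_left h8 (Real.exp_pos c)
  have e2 : Real.exp c * (A ^ p n * Real.exp (-c)) = A ^ p n := by
    rw [mul_left_comm, hcc, mul_one]
  rw [e2] at h9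
  linarith

/-- Consistency of the `p`-th root estimator along deterministic values of the order statistic. -/
theorem tendsto_measure_root_far {p : ℕ → ℝ} (hp : Tendsto p atTop atTop) {k : ℕ → ℕ} {α γ ε : ℝ}
    (hα : 1 < α) (hk : ∀ᶠ n in atTop, (k n : ℝ) = Real.exp (α * p n)) (hε : 0 < ε) (hεγ : ε < γ)
    {Y : ℕ → ℝ → ℝ} (hY : ∀ᶠ n in atTop, NearExp (Y n) (γ - ε / 2) (γ + ε / 2) 1) :
    Tendsto (fun n => (Measure.pi fun _ : Fin (k n) => unif01) {w |
      ε ≤ dist ((((1 / (k n : ℝ)) * ∑ i, Y n (w i) ^ p n) / Real.Gamma (p n + 1)) ^ (1 / p n)) γ})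
      atTop (𝓝 0) := by
  have hkpos : ∀ᶠ n in atTop, 0 < k n := by
    filter_upwards [hk] with n hn
    have : (0 : ℝ) < k n := by rw [hn]; exact Real.exp_pos _
    exact_mod_cast this
  have h1 := tendsto_measure_powerMean_ge hp hkpos (by linarith) hY
    (show γ + ε / 2 < γ + ε by linarith)
  have h2 := tendsto_measure_powerMean_le hp hα hk (by linarith) hY
    (show 0 < γ - ε by linarith) (show γ - ε < γ - ε / 2 by linarith)
  have hlim := h1.add h2
  rw [add_zero] at hlim
  refine tendsto_of_tendsto_of_tendsto_of_le_of_le' tendsto_const_nhds hlim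
    (Eventually.of_forall fun _ => zero_le) ?_
  filter_upwards [hY, hkpos, hp.eventually_gt_atTop 0] with n hn hk0 hpn
  refine le_trans (measure_mono_ae ?_) (measure_union_le _ _)
  filter_upwards [ae_pi_unif01 (Fin (k n))] with w hw hfar
  have hΓ := Real.Gamma_pos_of_pos (show 0 < p n + 1 by linarith)
  set S := (1 / (k n : ℝ)) * ∑ i, Y n (w i) ^ p n with hS
  have hS0 : 0 ≤ S := by
    have : 0 ≤ ∑ i, Y n (w i) ^ p n :=
      Finset.sum_nonneg fun i _ => Real.rpow_nonneg (hn.nonneg _ (hw i)) _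
    positivity
  have hroot : ∀ D : ℝ, 0 < D → (D ^ p n * Real.Gamma (p n + 1) / Real.Gamma (p n + 1)) ^
      (1 / p n) = D := by
    intro D hD
    rw [mul_div_cancel_right₀ _ hΓ.ne', ← Real.rpow_mul hD.le, mul_one_div_cancel hpn.ne',
      Real.rpow_one]
  have hfar : ε ≤ dist ((S / Real.Gamma (p n + 1)) ^ (1 / p n)) γ := hfar
  by_contra hcon
  have hcon1 : S < (γ + ε) ^ p n * Real.Gamma (p n + 1) := not_le.1 fun h => hcon (Or.inl h)
  have hcon2 : (γ - ε) ^ p n * Real.Gamma (p n + 1) < S := not_le.1 fun h => hcon (Or.inr h)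
  have e1 : (S / Real.Gamma (p n + 1)) ^ (1 / p n) < γ + ε := by
    rw [← hroot (γ + ε) (by linarith)]
    exact Real.rpow_lt_rpow (by positivity) (by gcongr) (by positivity)
  have e2 : γ - ε < (S / Real.Gamma (p n + 1)) ^ (1 / p n) := by
    rw [← hroot (γ - ε) (by linarith)]
    have : 0 < γ - ε := by linarith
    exact Real.rpow_lt_rpow (by positivity) (by gcongr) (by positivity)
  rw [Real.dist_eq] at hfar
  exact absurd (abs_lt.2 ⟨by linarith, by linarith⟩) (not_lt.2 hfar)

/-! ### Asymptotic normality for deterministic values of the order statistic -/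

/-- Eventual positivity of the mean and the standard deviation. -/
theorem eventually_std_pos {p : ℕ → ℝ} (hp : Tendsto p atTop atTop) {Y : ℕ → ℝ → ℝ} {A B c : ℝ}
    (hA : 0 < A) (hB : 0 < B) (hY : ∀ᶠ n in atTop, NearExp (Y n) A B c) (hR : B / A < 2) :
    ∀ᶠ n in atTop, 0 < Real.sqrt (variance (fun u => Y n u ^ p n) unif01) := by
  filter_upwards [(tendsto_std_div_sqrt hp hA hB hY hR).eventually_const_lt one_pos] with n hn
  by_contra h
  exact absurd hn (not_lt.2 (div_nonpos_of_nonpos_of_nonneg (not_lt.1 h) (Real.sqrt_nonneg _)))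

theorem tendsto_std_div_mean {p : ℕ → ℝ} (hp : Tendsto p atTop atTop) {k : ℕ → ℕ} {α : ℝ}
    (hk : ∀ᶠ n in atTop, (k n : ℝ) = Real.exp (α * p n)) {Y : ℕ → ℝ → ℝ} {A B c : ℝ}
    (hA : 0 < A) (hB : 0 < B) (hY : ∀ᶠ n in atTop, NearExp (Y n) A B c) (hR1 : B / A < 2)
    (hR : 2 * Real.log (2 * (B / A)) < α) :
    Tendsto (fun n => Real.sqrt (variance (fun u => Y n u ^ p n) unif01) /
      (Real.sqrt (k n) * ∫ u, Y n u ^ (p n) ∂unif01)) atTop (𝓝 0) := by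
  have h := (tendsto_std_div_sqrt hp hA hB hY hR1).mul (tendsto_sqrt_div_mean hp hk hA hB hY hR)
  rw [one_mul] at h
  refine h.congr' ?_
  filter_upwards [hY, hp.eventually_gt_atTop 0] with n hn hpn
  have := Real.sqrt_pos.2 (hn.moment_pos (s := 2 * p n) (by positivity))
  field_simp

/-- Asymptotic normality with the centering and norming that belong to the given value of the
order statistic. -/
theorem tendsto_charFun_random_centering {p : ℕ → ℝ} (hp : Tendsto p atTop atTop) {k : ℕ → ℕ}
    {α : ℝ} (hα : 2 < α) (hk : ∀ᶠ n in atTop, (k n : ℝ) = Real.exp (α * p n)) {Q : ℝ → ℝ} {γ : ℝ}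
    (hγ : 0 < γ) (hQm : Measurable Q) (hpotter : ∀ ε, 0 < ε → ε < γ →
      ∀ᶠ v in 𝓝[>] (0 : ℝ), NearExp (logExcess γ Q v) (γ - ε) (γ + ε) 1)
    {v : ℕ → ℝ} (hv : Tendsto v atTop (𝓝[>] 0)) (t : ℝ) :
    Tendsto (fun n => charFun ((Measure.pi fun _ : Fin (k n) => unif01).map fun w =>
      Real.sqrt (k n) * excessMean γ Q (p n) (v n) / excessStd γ Q (p n) (v n) *
        (p n * ((sampleMean γ Q (k n) (p n) (v n) w / excessMean γ Q (p n) (v n)) ^ (1 / p n) - 1)))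
        t) atTop (𝓝 (charFun (gaussianReal 0 1) t)) := by
  obtain ⟨r, ε, hr1, hr2, hε0, hεγ, hR1, hR2, hR3⟩ := exists_margins hα hγ
  have hA : 0 < γ - ε := by linarith
  have hB : 0 < γ + ε := by linarith
  have hY : ∀ᶠ n in atTop, NearExp (logExcess γ Q (v n)) (γ - ε) (γ + ε) 1 :=
    hv.eventually (hpotter ε hε0 hεγ)
  have hm : ∀ᶠ n in atTop, 0 < excessMean γ Q (p n) (v n) := by
    filter_upwards [hY, hp.eventually_ge_atTop 0] with n hn hpn
    exact hn.moment_pos hpn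
  have hσ : ∀ᶠ n in atTop, 0 < excessStd γ Q (p n) (v n) := eventually_std_pos hp hA hB hY hR1
  refine tendsto_charFun_rootMean hp (by linarith) hk hA hB
    (fun n => measurable_logExcess_right hQm γ (v n)) hY hR1 hr1 hr2 hR3 hm hσ
    (tendsto_std_div_mean hp hk hA hB hY hR1 hR2) ?_ ?_ t
  · refine tendsto_const_nhds.congr' ?_
    filter_upwards [hσ] with n hn
    exact (div_self hn.ne').symm
  · refine tendsto_const_nhds.congr fun n => ?_
    simp [excessMean]

/-- Under the second order condition the excess variable at `v ≤ b` is a standard exponential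
variable up to a shift of order `a(b) / ℓ(b)`. Comparing both `ℓ(uv)` and `ℓ(v)` with `ℓ(b)` makes
the bound uniform in `v ≤ b`. -/
theorem nearExp_of_second_order {Q : ℝ → ℝ} (hQm : Measurable Q) {γ : ℝ} (hγ : 0 < γ) {ℓ : ℝ → ℝ}
    (hQ : ∀ s ∈ Ioo (0 : ℝ) 1, Q (1 - s) = s ^ (-γ) * ℓ s) {b η : ℝ} (hb1 : b < 1) (hη : η ≤ 1 / 2)
    (hℓ : ∀ s ∈ Ioc 0 b, 0 < ℓ s) (hbd : ∀ u ∈ Ioc (0 : ℝ) 1, |ℓ (u * b) - ℓ b| ≤ η * ℓ b)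
    {v : ℝ} (hv : v ∈ Ioc 0 b) (hnonneg : ∀ u ∈ Ioo (0 : ℝ) 1, 0 ≤ logExcess γ Q v u) :
    NearExp (logExcess γ Q v) γ γ (4 * η / γ) := by
  have hb0 : 0 < b := hv.1.trans_le hv.2
  have hℓb : 0 < ℓ b := hℓ b ⟨hb0, le_rfl⟩
  have hη0 : 0 ≤ η := by
    have := (abs_nonneg _).trans (hbd 1 ⟨one_pos, le_rfl⟩)
    exact nonneg_of_mul_nonneg_left this hℓb
  have hcmp : ∀ s ∈ Ioc 0 b, (1 - η) * ℓ b ≤ ℓ s ∧ ℓ s ≤ (1 + η) * ℓ b := by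
    intro s hs
    have h := hbd (s / b) ⟨div_pos hs.1 hb0, (div_le_one hb0).2 hs.2⟩
    rw [div_mul_cancel₀ _ hb0.ne'] at h
    have := abs_le.1 h
    constructor <;> linarith
  have hlog : ∀ s ∈ Ioc 0 b, ∀ s' ∈ Ioc 0 b, Real.log (ℓ s) - Real.log (ℓ s') ≤ 4 * η := by
    intro s hs s' hs'
    have h1 := hℓ s hs
    have h2 := hℓ s' hs'
    rw [← Real.log_div h1.ne' h2.ne']
    refine (Real.log_le_sub_one_of_pos (by positivity)).trans ?_
    rw [sub_le_iff_le_add, div_le_iff₀ h2]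
    calc ℓ s ≤ (1 + η) * ℓ b := (hcmp s hs).2
      _ ≤ ((4 * η + 1) * (1 - η)) * ℓ b := by gcongr; nlinarith
      _ = (4 * η + 1) * ((1 - η) * ℓ b) := by ring
      _ ≤ (4 * η + 1) * ℓ s' := by gcongr; exact (hcmp s' hs').1
  have hY : ∀ u ∈ Ioo (0 : ℝ) 1, u * v ∈ Ioc 0 b ∧ logExcess γ Q v u =
      γ * (-Real.log u) + (Real.log (ℓ (u * v)) - Real.log (ℓ v)) := by
    intro u hu
    have huv : u * v ∈ Ioc 0 b :=
      ⟨mul_pos hu.1 hv.1, le_trans (by nlinarith [hv.1, hu.2]) hv.2⟩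
    refine ⟨huv, ?_⟩
    rw [logExcess, if_neg hv.1.ne', hQ _ ⟨huv.1, huv.2.trans_lt hb1⟩, hQ _ ⟨hv.1, hv.2.trans_lt hb1⟩,
      Real.log_div (mul_pos (Real.rpow_pos_of_pos huv.1 _) (hℓ _ huv)).ne'
        (mul_pos (Real.rpow_pos_of_pos hv.1 _) (hℓ _ hv)).ne',
      Real.log_mul (Real.rpow_pos_of_pos huv.1 _).ne' (hℓ _ huv).ne',
      Real.log_mul (Real.rpow_pos_of_pos hv.1 _).ne' (hℓ _ hv).ne',
      Real.log_rpow huv.1, Real.log_rpow hv.1, Real.log_mul hu.1.ne' hv.1.ne']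
    ring
  have hcγ : γ * (4 * η / γ) = 4 * η := by field_simp
  refine ⟨measurable_logExcess_right hQm γ v, hγ, hγ, by positivity, hnonneg, ?_, ?_⟩
  · intro u hu
    obtain ⟨huv, h⟩ := hY u hu
    rw [h, mul_sub, hcγ]
    linarith [hlog v hv _ huv]
  · intro u hu
    obtain ⟨huv, h⟩ := hY u hu
    rw [h, mul_add, hcγ]
    linarith [hlog _ huv v hv]

/-- If `Y` differs from an exponential variable by shifts `c n → 0`, its moments differ from the
exponential ones by factors between `exp (-c n)` and `exp (c n)`. -/
theorem moment_between {Y Z : ℝ → ℝ} {γ c : ℝ} (hY : NearExp Y γ γ c) (hZ : NearExp Z γ γ 0)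
    {s : ℝ} (hs : 0 ≤ s) :
    Real.exp (-c) * ∫ u, Z u ^ s ∂unif01 ≤ ∫ u, Y u ^ s ∂unif01 ∧
      ∫ u, Y u ^ s ∂unif01 ≤ Real.exp c * ∫ u, Z u ^ s ∂unif01 := by
  have h1 := hZ.moment_le hs
  have h2 := hZ.le_moment hs
  have h3 := hY.moment_le hs
  have h4 := hY.le_moment hs
  simp only [neg_zero, Real.exp_zero, one_mul] at h1 h2
  constructor
  · calc _ ≤ Real.exp (-c) * (γ ^ s * Real.Gamma (s + 1)) := by gcongr
      _ ≤ _ := by rw [← mul_assoc]; exact h4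
  · calc _ ≤ Real.exp c * (γ ^ s * Real.Gamma (s + 1)) := by rw [← mul_assoc]; exact h3
      _ ≤ _ := by gcongr

/-- Asymptotic normality with the centering and norming of the exponential limit, provided that
the shifts `c n` are small compared to the resulting standard error. -/
theorem tendsto_charFun_fixed_centering {p : ℕ → ℝ} (hp : Tendsto p atTop atTop) {k : ℕ → ℕ}
    {α : ℝ} (hα : 2 < α) (hk : ∀ᶠ n in atTop, (k n : ℝ) = Real.exp (α * p n)) {Q : ℝ → ℝ} {γ : ℝ}
    (hγ : 0 < γ) (hQm : Measurable Q) {v c : ℕ → ℝ}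
    (hY : ∀ᶠ n in atTop, NearExp (logExcess γ Q (v n)) γ γ (c n)) (hc : Tendsto c atTop (𝓝 0))
    {C L : ℝ} (hL : L < Real.log 2)
    (hkc : ∀ᶠ n in atTop, Real.sqrt (k n) * c n ≤ C * Real.exp (L * p n)) (t : ℝ) :
    Tendsto (fun n => charFun ((Measure.pi fun _ : Fin (k n) => unif01).map fun w =>
      Real.sqrt (k n) * excessMean γ Q (p n) 0 / excessStd γ Q (p n) 0 *
        (p n * ((sampleMean γ Q (k n) (p n) (v n) w / excessMean γ Q (p n) 0) ^ (1 / p n) - 1)))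
        t) atTop (𝓝 (charFun (gaussianReal 0 1) t)) := by
  obtain ⟨r, ε, hr1, hr2, hε0, hεγ, hR1, hR2, hR3⟩ := exists_margins hα hγ
  -- the margins hold a fortiori without Potter error
  have hone : (1 : ℝ) ≤ (γ + ε) / (γ - ε) := by
    rw [one_le_div (by linarith)]; linarith
  have hγγ : γ / γ = 1 := div_self hγ.ne'
  have hS1 : γ / γ < 2 := by rw [hγγ]; norm_num
  have hS2 : 2 * Real.log (2 * (γ / γ)) < α := by
    rw [hγγ]
    refine lt_of_le_of_lt ?_ hR2
    have := Real.log_le_log (by norm_num) (show 2 * (1 : ℝ) ≤ 2 * ((γ + ε) / (γ - ε)) by gcongr)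
    linarith
  have hS3 : 2 * r * Real.log (r * (γ / γ)) < α * (r - 1) := by
    rw [hγγ]
    refine lt_of_le_of_lt ?_ hR3
    have := Real.log_le_log (by linarith) (show r * (1 : ℝ) ≤ r * ((γ + ε) / (γ - ε)) by gcongr)
    gcongr
  have hZ := nearExp_logExcess_zero hQm hγ
  have hZe : ∀ᶠ _ in (atTop : Filter ℕ), NearExp (logExcess γ Q 0) γ γ 0 := Eventually.of_forall
    fun _ => hZ
  have hc1 : ∀ᶠ n in atTop, c n ≤ 1 := hc.eventually_le_const one_pos
  have hY1 : ∀ᶠ n in atTop, NearExp (logExcess γ Q (v n)) γ γ 1 := by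
    filter_upwards [hY, hc1] with n hn h1
    refine ⟨hn.meas, hγ, hγ, zero_le_one, hn.nonneg, fun u hu => ?_, fun u hu => ?_⟩
    · exact le_trans (by gcongr) (hn.lower u hu)
    · exact (hn.upper u hu).trans (by gcongr)
  have hm0 : ∀ᶠ n in atTop, 0 < excessMean γ Q (p n) 0 := by
    filter_upwards [hp.eventually_ge_atTop 0] with n hpn
    exact hZ.moment_pos hpn
  have hσ0 : ∀ᶠ n in atTop, 0 < excessStd γ Q (p n) 0 := eventually_std_pos hp hγ hγ hZe hS1
  have hstd0 := tendsto_std_div_sqrt hp hγ hγ hZe hS1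
  refine tendsto_charFun_rootMean hp (by linarith) hk hγ hγ
    (fun n => measurable_logExcess_right hQm γ (v n)) hY1 hS1 hr1 hr2 hS3 hm0 hσ0
    (tendsto_std_div_mean hp hk hγ hγ hZe hS1 hS2) ?_ ?_ t
  · have hstd := tendsto_std_div_sqrt hp hγ hγ hY1 hS1
    have hratio : Tendsto (fun n => Real.sqrt ((∫ u, logExcess γ Q (v n) u ^ (2 * p n) ∂unif01) /
        ∫ u, logExcess γ Q 0 u ^ (2 * p n) ∂unif01)) atTop (𝓝 1) := by
      rw [← Real.sqrt_one]
      refine (Real.continuous_sqrt.tendsto 1).comp ?_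
      have e1 : Tendsto (fun n => Real.exp (-c n)) atTop (𝓝 1) := by
        have := (Real.continuous_exp.tendsto _).comp hc.neg
        rw [neg_zero, Real.exp_zero] at this
        exact this
      have e2 : Tendsto (fun n => Real.exp (c n)) atTop (𝓝 1) := by
        have := (Real.continuous_exp.tendsto _).comp hc
        rw [Real.exp_zero] at this
        exact this
      refine tendsto_of_tendsto_of_tendsto_of_le_of_le' e1 e2 ?_ ?_
      · filter_upwards [hY, hp.eventually_gt_atTop 0] with n hn hpn
        rw [le_div_iff₀ (hZ.moment_pos (by positivity))]
        exact (moment_between hn hZ (by positivity)).1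
      · filter_upwards [hY, hp.eventually_gt_atTop 0] with n hn hpn
        rw [div_le_iff₀ (hZ.moment_pos (by positivity))]
        exact (moment_between hn hZ (by positivity)).2
    have hlim := (hstd.mul hratio).div hstd0 one_ne_zero
    simp only [mul_one, div_one] at hlim
    refine hlim.congr' ?_
    filter_upwards [hY, hp.eventually_gt_atTop 0, hσ0] with n hn hpn hs
    have h1 := Real.sqrt_pos.2 (hn.moment_pos (s := 2 * p n) (by positivity))
    have h2 := hZ.moment_pos (s := 2 * p n) (by positivity)
    have h3 := Real.sqrt_pos.2 h2
    have hs' : 0 < Real.sqrt (variance (fun u => logExcess γ Q 0 u ^ p n) unif01) := hs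
    simp only [Pi.div_apply]
    rw [Real.sqrt_div' _ h2.le]
    change _ = _ / Real.sqrt (variance (fun u => logExcess γ Q 0 u ^ p n) unif01)
    field_simp
  · have hlim := tendsto_linear_mul_exp hp (4 * C * Real.exp 1) 1 (sub_pos.2 hL)
    refine squeeze_zero_norm' ?_ hlim
    filter_upwards [hY, hp.eventually_gt_atTop 0, hσ0, hm0, hkc, hc1,
      hstd0.eventually_const_lt (show (1 / 2 : ℝ) < 1 by norm_num)]
      with n hn hpn hs hm hkc hc1 hhalf
    have hb := moment_between hn hZ hpn.le
    have hM0 := hZ.moment_pos (s := 2 * p n) (by positivity)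
    have hM0s := Real.sqrt_pos.2 hM0
    have hexp := Real.abs_exp_sub_one_le (x := c n) (by rw [abs_of_nonneg hn.hc]; exact hc1)
    rw [abs_of_nonneg hn.hc] at hexp
    have hexp1 := (abs_le.1 hexp).2
    have hexp2 := Real.add_one_le_exp (-c n)
    have hdiff : |∫ u, logExcess γ Q (v n) u ^ p n ∂unif01 - excessMean γ Q (p n) 0| ≤
        2 * c n * excessMean γ Q (p n) 0 := by
      have hb1 : Real.exp (-c n) * excessMean γ Q (p n) 0 ≤
        ∫ u, logExcess γ Q (v n) u ^ p n ∂unif01 := hb.1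
      have hb2 : ∫ u, logExcess γ Q (v n) u ^ p n ∂unif01 ≤
        Real.exp (c n) * excessMean γ Q (p n) 0 := hb.2
      have hcn := hn.hc
      rw [abs_le]
      constructor
      · nlinarith [mul_nonneg hcn hm.le]
      · nlinarith
    -- the mean of the exponential limit is at most `2 e (p + 1) 2⁻ᵖ` times its deviation
    have hms : excessMean γ Q (p n) 0 / excessStd γ Q (p n) 0 ≤
        2 * Real.exp 1 * (p n + 1) * Real.exp (-Real.log 2 * p n) := by
      have h1 := hZ.moment_ratio_le (a := 2 * p n) (r := 1 / 2) (by positivity) (by norm_num)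
      rw [show (1 : ℝ) / 2 * (2 * p n) = p n by ring, ← Real.sqrt_eq_rpow, hγγ, mul_one, zero_mul,
        zero_add, add_zero, Real.rpow_def_of_pos (by norm_num), one_div, Real.log_inv] at h1
      have h2 : Real.sqrt (∫ u, logExcess γ Q 0 u ^ (2 * p n) ∂unif01) ≤
          2 * excessStd γ Q (p n) 0 := by
        have h3 := (lt_div_iff₀ hM0s).1 hhalf
        have h4 : 1 / 2 * Real.sqrt (∫ u, logExcess γ Q 0 u ^ (2 * p n) ∂unif01) <
          excessStd γ Q (p n) 0 := h3
        linarith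
      rw [div_le_iff₀ hs]
      calc excessMean γ Q (p n) 0 ≤ _ := h1
        _ ≤ Real.exp 1 * (p n + 1) * Real.exp (-Real.log 2 * p n) * (2 * excessStd γ Q (p n) 0) := by
          gcongr
        _ = _ := by ring
    rw [Real.norm_eq_abs, abs_div, abs_mul, abs_of_nonneg (Real.sqrt_nonneg _), abs_of_pos hs]
    calc _ ≤ Real.sqrt (k n) * (2 * c n * excessMean γ Q (p n) 0) / excessStd γ Q (p n) 0 := by
          gcongr
      _ = 2 * (Real.sqrt (k n) * c n) * (excessMean γ Q (p n) 0 / excessStd γ Q (p n) 0) := by ring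
      _ ≤ 2 * (C * Real.exp (L * p n)) *
          (2 * Real.exp 1 * (p n + 1) * Real.exp (-Real.log 2 * p n)) := by
          have : 0 ≤ C * Real.exp (L * p n) :=
            le_trans (mul_nonneg (Real.sqrt_nonneg _) hn.hc) hkc
          gcongr
      _ = _ := by
          have : Real.exp (-(Real.log 2 - L) * p n) =
              Real.exp (L * p n) * Real.exp (-Real.log 2 * p n) := by
            rw [← Real.exp_add]; congr 1; ring
          rw [this]; ring

/-! ### From deterministic sequences back to the sample -/

theorem map_sample_eq_pi {Ω : Type*} [MeasurableSpace Ω] {P : Measure Ω} [IsProbabilityMeasure P]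
    {μ : Measure ℝ} {X : ℕ → Ω → ℝ} (hX_indep : iIndepFun X P) (hX_law : ∀ i, HasLaw (X i) μ P)
    (n : ℕ) : P.map (fun ω (i : Fin n) => X i ω) = Measure.pi fun _ => μ := by
  have h : iIndepFun (fun i : Fin n => X i) P := hX_indep.precomp Fin.val_injective
  rw [(iIndepFun_iff_map_fun_eq_pi_map fun i => (hX_law _).aemeasurable).1 h]
  simp only [(hX_law _).map_eq]

theorem aemeasurable_sample {Ω : Type*} [MeasurableSpace Ω] {P : Measure Ω}
    {μ : Measure ℝ} {X : ℕ → Ω → ℝ} (hX_law : ∀ i, HasLaw (X i) μ P) (n : ℕ) :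
    AEMeasurable (fun ω (i : Fin n) => X i ω) P :=
  aemeasurable_pi_lambda _ fun i => (hX_law i).aemeasurable

theorem measurable_quantile_sample (μ : Measure ℝ) [IsProbabilityMeasure μ] (n : ℕ) :
    Measurable fun (u : Fin n → ℝ) (i : Fin n) => quantile μ (1 - u i) :=
  measurable_pi_lambda _ fun i => (measurable_quantile μ).comp (by fun_prop)

theorem map_sample_eq_map_quantile {Ω : Type*} [MeasurableSpace Ω] {P : Measure Ω}
    [IsProbabilityMeasure P] {μ : Measure ℝ} [IsProbabilityMeasure μ] {X : ℕ → Ω → ℝ}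
    (hX_indep : iIndepFun X P) (hX_law : ∀ i, HasLaw (X i) μ P) (n : ℕ) :
    P.map (fun ω (i : Fin n) => X i ω) = (Measure.pi fun _ : Fin n => unif01).map
      fun u i => quantile μ (1 - u i) := by
  have hm : Measurable fun u : ℝ => quantile μ (1 - u) :=
    (measurable_quantile μ).comp (by fun_prop)
  have hs : IsProbabilityMeasure (unif01.map fun u => quantile μ (1 - u)) :=
    Measure.isProbabilityMeasure_map hm.aemeasurable
  rw [map_sample_eq_pi hX_indep hX_law, Measure.pi_map_pi fun _ => hm.aemeasurable]
  simp only [map_quantile_unif01]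

theorem measurable_order_hill (μ : Measure ℝ) [IsProbabilityMeasure μ] (n k : ℕ) (p : ℝ) :
    Measurable fun u : Fin n → ℝ =>
      (orderVal n u (k + 1), hillVal n k p fun i => quantile μ (1 - u i)) :=
  (measurable_orderVal n (k + 1)).prodMk
    ((measurable_hillVal n k p).comp (measurable_quantile_sample μ n))

/-- Convergence in distribution to a standard normal variable of a functional of the order statistic
and the moment statistic follows from convergence of its characteristic functions when the order
statistic is replaced by deterministic values and the moment statistic by the mean of independent
excesses over that value. -/
theorem tendstoInDistribution_of_sequences {Ω : Type*} [MeasurableSpace Ω] {P : Measure Ω}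
    [IsProbabilityMeasure P] (μ : Measure ℝ) [IsProbabilityMeasure μ] (γ : ℝ)
    {k : ℕ → ℕ} (hk : ∀ n, 1 ≤ n → 1 ≤ k n ∧ k n ≤ n) (hk_top : Tendsto k atTop atTop)
    (hk_zero : Tendsto (fun n => (k n : ℝ) / n) atTop (𝓝 0)) (p : ℕ → ℝ)
    {D : ℕ → Ω → ℝ} (hD : ∀ n, AEMeasurable (D n) P)
    {d : ℕ → ℝ × ℝ → ℝ} (hd : ∀ n, Measurable (d n))
    (hmap : ∀ n, P.map (D n) = (Measure.pi fun _ : Fin n => unif01).map fun u =>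
      d n (orderVal n u (k n + 1), hillVal n (k n) (p n) fun i => quantile μ (1 - u i)))
    (hseq : ∀ v : ℕ → ℝ, (∀ᶠ n in atTop, v n ∈ Ioc 0 (2 * (k n : ℝ) / n)) → ∀ t : ℝ,
      Tendsto (fun n => charFun ((Measure.pi fun _ : Fin (k n) => unif01).map fun w =>
        d n (v n, sampleMean γ (quantile μ) (k n) (p n) (v n) w)) t) atTop
        (𝓝 (charFun (gaussianReal 0 1) t))) :
    TendstoInDistribution D atTop (id : ℝ → ℝ) (fun _ => P) (gaussianReal 0 1) := by
  refine ⟨hD, aemeasurable_id, ProbabilityMeasure.tendsto_iff_forall_lintegral_tendsto.2 fun f => ?_⟩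
  have hf : Measurable fun x => (f x : ENNReal) :=
    f.continuous.measurable.coe_nnreal_ennreal
  obtain ⟨B, hB⟩ : ∃ B : NNReal, ∀ x, f x ≤ B :=
    ⟨_, fun x => BoundedContinuousFunction.NNReal.upper_bound f x⟩
  have hc : ∫⁻ x, f x ∂gaussianReal 0 1 ≠ ⊤ := by
    refine ne_top_of_le_ne_top (b := (B : ENNReal)) ENNReal.coe_ne_top ?_
    refine (lintegral_mono (g := fun _ => (B : ENNReal)) fun x => ENNReal.coe_le_coe.2 (hB x)).trans ?_
    simp
  have key := tendsto_lintegral_order_hill μ γ hk hk_top hk_zero p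
    (H := fun n z => (f (d n z) : ENNReal)) (fun n => hf.comp (hd n)) (C := (B : ENNReal))
    ENNReal.coe_ne_top hc (fun n z => by exact_mod_cast hB _) ?_
  · simp only [ProbabilityMeasure.coe_mk, Measure.map_id]
    refine key.congr fun n => ?_
    rw [hmap n]
    exact (lintegral_map hf ((hd n).comp (measurable_order_hill μ n (k n) (p n)))).symm
  · intro v hv
    have hm : ∀ n, Measurable fun w : Fin (k n) → ℝ =>
        d n (v n, sampleMean γ (quantile μ) (k n) (p n) (v n) w) := fun n =>
      (hd n).comp (measurable_const.prodMk ((measurable_sampleMean (measurable_quantile μ) γ (k n)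
        (p n)).comp (measurable_const.prodMk measurable_id)))
    have hpm : ∀ n, IsProbabilityMeasure ((Measure.pi fun _ : Fin (k n) => unif01).map fun w =>
        d n (v n, sampleMean γ (quantile μ) (k n) (p n) (v n) w)) := fun n =>
      Measure.isProbabilityMeasure_map (hm n).aemeasurable
    have hlim : Tendsto (β := ProbabilityMeasure ℝ) (fun n => ⟨_, hpm n⟩) atTop
        (𝓝 ⟨gaussianReal 0 1, inferInstance⟩) :=
      ProbabilityMeasure.tendsto_iff_tendsto_charFun.2 (hseq v hv)
    have := ProbabilityMeasure.tendsto_iff_forall_lintegral_tendsto.1 hlim f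
    refine this.congr fun n => ?_
    exact lintegral_map hf (hm n)

/-- The law of a functional of the order statistic of the uniform variables and the moment statistic
of the sample, when the sample is obtained from the uniform variables by the quantile
transformation. -/
theorem map_quantile_representation {Ω : Type*} [MeasurableSpace Ω] {P : Measure Ω}
    [IsProbabilityMeasure P] {μ : Measure ℝ} [IsProbabilityMeasure μ] {X U : ℕ → Ω → ℝ}
    (hU_indep : iIndepFun U P) (hU_law : ∀ i, HasLaw (U i) unif01 P)
    (hXU : ∀ i, ∀ᵐ ω ∂P, X i ω = quantile μ (1 - U i ω)) (n k : ℕ) (p : ℝ) {d : ℝ × ℝ → ℝ}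
    (hd : Measurable d) :
    P.map (fun ω => d (orderStat n (fun i => U i ω) (k + 1), hillMoment n k p fun i => X i ω)) =
      (Measure.pi fun _ : Fin n => unif01).map fun u =>
        d (orderVal n u (k + 1), hillVal n k p fun i => quantile μ (1 - u i)) := by
  have hdm : Measurable fun u : Fin n → ℝ =>
      d (orderVal n u (k + 1), hillVal n k p fun i => quantile μ (1 - u i)) :=
    hd.comp (measurable_order_hill μ n k p)
  rw [← map_sample_eq_pi hU_indep hU_law n,
    AEMeasurable.map_map_of_aemeasurable hdm.aemeasurable (aemeasurable_sample hU_law n)]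
  refine Measure.map_congr ?_
  filter_upwards [ae_all_iff.2 hXU] with ω hω
  simp only [hω]
  rfl

/-- The law of a functional of the moment statistic. -/
theorem map_hillMoment {Ω : Type*} [MeasurableSpace Ω] {P : Measure Ω}
    [IsProbabilityMeasure P] {μ : Measure ℝ} [IsProbabilityMeasure μ] {X : ℕ → Ω → ℝ}
    (hX_indep : iIndepFun X P) (hX_law : ∀ i, HasLaw (X i) μ P) (n k : ℕ) (p : ℝ) {d : ℝ → ℝ}
    (hd : Measurable d) :
    P.map (fun ω => d (hillMoment n k p fun i => X i ω)) =
      (Measure.pi fun _ : Fin n => unif01).map fun u =>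
        d (hillVal n k p fun i => quantile μ (1 - u i)) := by
  have hdm := hd.comp (measurable_hillVal n k p)
  calc P.map (fun ω => d (hillMoment n k p fun i => X i ω))
      = (P.map fun ω (i : Fin n) => X i ω).map (d ∘ hillVal n k p) :=
        (AEMeasurable.map_map_of_aemeasurable hdm.aemeasurable (aemeasurable_sample hX_law n)).symm
    _ = _ := by
        rw [map_sample_eq_map_quantile hX_indep hX_law,
          Measure.map_map hdm (measurable_quantile_sample μ n)]
        rfl

theorem aemeasurable_hillMoment {Ω : Type*} [MeasurableSpace Ω] {P : Measure Ω}
    {μ : Measure ℝ} {X : ℕ → Ω → ℝ} (hX_law : ∀ i, HasLaw (X i) μ P) (n k : ℕ) (p : ℝ) :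
    AEMeasurable (fun ω => hillMoment n k p fun i => X i ω) P := by
  simp only [hillMoment_eq_hillVal]
  exact (measurable_hillVal n k p).comp_aemeasurable (aemeasurable_sample hX_law n)

theorem aemeasurable_orderStat {Ω : Type*} [MeasurableSpace Ω] {P : Measure Ω}
    {μ : Measure ℝ} {X : ℕ → Ω → ℝ} (hX_law : ∀ i, HasLaw (X i) μ P) (n j : ℕ) :
    AEMeasurable (fun ω => orderStat n (fun i => X i ω) j) P := by
  simp only [orderStat_eq_orderVal]
  exact (measurable_orderVal n j).comp_aemeasurable (aemeasurable_sample hX_law n)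

theorem tendsto_nhdsGT_of_mem_Ioc {b v : ℕ → ℝ} (hb : Tendsto b atTop (𝓝 0))
    (hv : ∀ᶠ n in atTop, v n ∈ Ioc 0 (b n)) : Tendsto v atTop (𝓝[>] 0) :=
  tendsto_nhdsWithin_iff.2 ⟨tendsto_of_tendsto_of_tendsto_of_le_of_le' tendsto_const_nhds hb
    (hv.mono fun _ h => h.1.le) (hv.mono fun _ h => h.2), hv.mono fun _ h => h.1⟩

/-! ### Consequences of the second order condition -/

theorem SecondOrder.exists_bound {ℓ a : ℝ → ℝ} (h : SecondOrder ℓ a) :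
    ∃ C : ℝ, ∀ᶠ v in 𝓝[>] (0 : ℝ), ∀ u ∈ Ioc (0 : ℝ) 1, |ℓ (u * v) - ℓ v| ≤ C * a v := by
  obtain ⟨C, hC, -⟩ := EReal.lt_iff_exists_real_btwn.1 h.bound
  obtain ⟨ρ, ⟨δ, hδ, hpos, -⟩, -⟩ := h.regVarying
  refine ⟨C, ?_⟩
  filter_upwards [eventually_lt_of_limsup_lt hC, Ioo_mem_nhdsGT hδ] with v hv hvδ u hu
  have h1 := (le_iSup₂ (f := fun (u : ℝ) (_ : u ∈ Ioc (0 : ℝ) 1) =>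
    ((|ℓ (u * v) - ℓ v| / a v : ℝ) : EReal)) u hu).trans hv.le
  exact (div_le_iff₀ (hpos v hvδ)).1 (EReal.coe_le_coe_iff.1 h1)

/-- Doubling the argument changes `a / ℓ` by at most a constant factor. -/
theorem SecondOrder.exists_doubling {ℓ a : ℝ → ℝ} (h : SecondOrder ℓ a)
    (hℓ : SlowlyVaryingAtZero ℓ) :
    ∃ K : ℝ, ∀ᶠ x in 𝓝[>] (0 : ℝ), a (2 * x) / ℓ (2 * x) ≤ K * (a x / ℓ x) := by
  obtain ⟨ρ, ⟨δ, hδ, hpos, -⟩, ha⟩ := h.regVarying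
  obtain ⟨⟨δ', hδ', hpos', -⟩, hl⟩ := hℓ
  refine ⟨2 ^ ρ / 2 ^ (0 : ℝ) + 1, ?_⟩
  have hlim := (ha 2 two_pos).div (hl 2 two_pos) (by simp)
  filter_upwards [hlim.eventually_le_const (lt_add_one _), Ioo_mem_nhdsGT hδ,
    Ioo_mem_nhdsGT hδ'] with x hx hxδ hxδ'
  have h1 := hpos x hxδ
  have h2 := hpos' x hxδ'
  rw [← div_le_iff₀ (by positivity)]
  refine le_of_eq_of_le ?_ hx
  simp only [Pi.div_apply]
  rw [div_div_div_comm]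

/-! ### The limit theorems for the sample -/

theorem tendstoInMeasure_root_hillMoment
    {Ω : Type*} [MeasurableSpace Ω] {P : Measure Ω} [IsProbabilityMeasure P] {μ : Measure ℝ}
    [IsProbabilityMeasure μ]
    {γ : ℝ} (hγ : 0 < γ) {k : ℕ → ℕ} (hk : ∀ n, 1 ≤ n → 1 ≤ k n ∧ k n ≤ n)
    (hk_top : Tendsto k atTop atTop) (hk_zero : Tendsto (fun n => (k n : ℝ) / n) atTop (𝓝 0))
    {α : ℝ} (hα : 1 < α) {p : ℕ → ℝ} (hp0 : Tendsto p atTop atTop)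
    (hkp : ∀ᶠ n in atTop, (k n : ℝ) = Real.exp (α * p n))
    (hpotter : ∀ ε, 0 < ε → ε < γ → ∀ᶠ v in 𝓝[>] (0 : ℝ),
      NearExp (logExcess γ (quantile μ) v) (γ - ε) (γ + ε) 1)
    {X : ℕ → Ω → ℝ} (hX_indep : iIndepFun X P) (hX_law : ∀ i, HasLaw (X i) μ P) :
    TendstoInMeasure P
      (fun n ω => (hillMoment n (k n) (p n) (fun i => X i ω) / Real.Gamma (p n + 1)) ^ (1 / p n))
      atTop (fun _ => γ) := by
  have hQm := measurable_quantile μ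
  have hb : Tendsto (fun n => 2 * (k n : ℝ) / n) atTop (𝓝 0) := by
    simpa [mul_div_assoc] using hk_zero.const_mul 2
  rw [tendstoInMeasure_iff_dist]
  intro ε₀ hε₀
  -- only small `ε` matter, and the Potter bounds need `ε < γ`
  obtain ⟨ε, hε, hεγ, hεε₀⟩ : ∃ ε : ℝ, 0 < ε ∧ ε < γ ∧ ε ≤ ε₀ :=
    ⟨min ε₀ (γ / 2), lt_min hε₀ (by linarith), (min_le_right _ _).trans_lt (by linarith),
      min_le_left _ _⟩
  set r : ℕ → ℝ → ℝ := fun n s => (s / Real.Gamma (p n + 1)) ^ (1 / p n) with hr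
  have hrm : ∀ n, Measurable (r n) := fun n => (measurable_id.div_const _).pow_const _
  set S : ℕ → Set ℝ := fun n => {s | ε ≤ dist (r n s) γ} with hS
  have hSm : ∀ n, MeasurableSet (S n) := fun n =>
    measurableSet_le measurable_const ((hrm n).dist measurable_const)
  have key := tendsto_lintegral_order_hill μ γ hk hk_top hk_zero p
    (H := fun n z => (S n).indicator 1 z.2)
    (fun n => (measurable_one.indicator (hSm n)).comp measurable_snd) (C := 1) (c := 0)
    ENNReal.one_ne_top ENNReal.zero_ne_top (fun n z => indicator_le_self' (by simp) _) ?_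
  · refine tendsto_of_tendsto_of_tendsto_of_le_of_le tendsto_const_nhds key
      (fun _ => zero_le) fun n => ?_
    have hmeas := aemeasurable_hillMoment hX_law n (k n) (p n)
    have hlaw := map_hillMoment hX_indep hX_law n (k n) (p n) measurable_id
    calc _ ≤ P {ω | hillMoment n (k n) (p n) (fun i => X i ω) ∈ S n} :=
          measure_mono fun ω hω => hεε₀.trans hω
      _ = P.map (fun ω => id (hillMoment n (k n) (p n) fun i => X i ω)) (S n) :=
          (Measure.map_apply_of_aemeasurable hmeas (hSm n)).symm
      _ = _ := by
          have hm2 : Measurable fun u : Fin n → ℝ =>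
            hillVal n (k n) (p n) fun i => quantile μ (1 - u i) :=
            (measurable_order_hill μ n (k n) (p n)).snd
          rw [hlaw, ← lintegral_indicator_one (hSm n)]
          exact lintegral_map (measurable_one.indicator (hSm n)) hm2
  · intro v hv
    have hv0 := tendsto_nhdsGT_of_mem_Ioc hb hv
    refine (tendsto_measure_root_far hp0 hα hkp hε hεγ
      (hv0.eventually (hpotter (ε / 2) (by linarith) (by linarith)))).congr fun n => ?_
    have hm : Measurable fun w : Fin (k n) → ℝ =>
      sampleMean γ (quantile μ) (k n) (p n) (v n) w :=
      (measurable_sampleMean hQm γ (k n) (p n)).comp (measurable_const.prodMk measurable_id)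
    exact (lintegral_indicator_one (hm (hSm n))).symm

theorem tendstoInDistribution_random_centering
    {Ω : Type*} [MeasurableSpace Ω] {P : Measure Ω} [IsProbabilityMeasure P] {μ : Measure ℝ}
    [IsProbabilityMeasure μ]
    {γ : ℝ} (hγ : 0 < γ) {k : ℕ → ℕ} (hk : ∀ n, 1 ≤ n → 1 ≤ k n ∧ k n ≤ n)
    (hk_top : Tendsto k atTop atTop) (hk_zero : Tendsto (fun n => (k n : ℝ) / n) atTop (𝓝 0))
    {α : ℝ} (hα : 2 < α) {p : ℕ → ℝ} (hp0 : Tendsto p atTop atTop)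
    (hkp : ∀ᶠ n in atTop, (k n : ℝ) = Real.exp (α * p n))
    (hpotter : ∀ ε, 0 < ε → ε < γ → ∀ᶠ v in 𝓝[>] (0 : ℝ),
      NearExp (logExcess γ (quantile μ) v) (γ - ε) (γ + ε) 1)
    {X U : ℕ → Ω → ℝ} (hU_indep : iIndepFun U P) (hU_law : ∀ i, HasLaw (U i) unif01 P)
    (hXU : ∀ i, ∀ᵐ ω ∂P, X i ω = quantile μ (1 - U i ω)) :
    TendstoInDistribution
      (fun n ω =>
        let V := orderStat n (fun i => U i ω) (k n + 1)
        let m := excessMean γ (quantile μ) (p n) V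
        let σ := excessStd γ (quantile μ) (p n) V
        Real.sqrt (k n) * m / σ *
          (p n * ((hillMoment n (k n) (p n) (fun i => X i ω) / m) ^ (1 / p n) - 1)))
      atTop (id : ℝ → ℝ) (fun _ => P) (gaussianReal 0 1) := by
  have hQm := measurable_quantile μ
  have hb : Tendsto (fun n => 2 * (k n : ℝ) / n) atTop (𝓝 0) := by
    simpa [mul_div_assoc] using hk_zero.const_mul 2
  set d : ℕ → ℝ × ℝ → ℝ := fun n z =>
    Real.sqrt (k n) * excessMean γ (quantile μ) (p n) z.1 / excessStd γ (quantile μ) (p n) z.1 *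
      (p n * ((z.2 / excessMean γ (quantile μ) (p n) z.1) ^ (1 / p n) - 1)) with hd
  have hdm : ∀ n, Measurable (d n) := by
    intro n
    have h1 : Measurable fun z : ℝ × ℝ => excessMean γ (quantile μ) (p n) z.1 :=
      (measurable_excessMean hQm γ (p n)).comp measurable_fst
    have h2 : Measurable fun z : ℝ × ℝ => excessStd γ (quantile μ) (p n) z.1 :=
      (measurable_excessStd hQm γ (p n)).comp measurable_fst
    exact ((h1.const_mul _).div h2).mul
      ((((measurable_snd.div h1).pow_const _).sub_const _).const_mul _)
  refine tendstoInDistribution_of_sequences μ γ hk hk_top hk_zero p (d := d) (fun n => ?_) hdm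
    (fun n => map_quantile_representation hU_indep hU_law hXU n (k n) (p n) (hdm n))
    fun v hv t => ?_
  · have hX : AEMeasurable (fun ω => hillMoment n (k n) (p n) fun i => X i ω) P := by
      refine ((((measurable_hillVal n (k n) (p n)).comp (measurable_quantile_sample μ n)
        ).comp_aemeasurable (aemeasurable_sample hU_law n)).congr ?_)
      filter_upwards [ae_all_iff.2 hXU] with ω hω
      simp only [hillMoment_eq_hillVal, hω]
      rfl
    have h : AEMeasurable (fun ω => d n (orderStat n (fun i => U i ω) (k n + 1),
        hillMoment n (k n) (p n) fun i => X i ω)) P :=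
      (hdm n).comp_aemeasurable ((aemeasurable_orderStat hU_law n (k n + 1)).prodMk hX)
    exact h
  · exact tendsto_charFun_random_centering hp0 hα hkp hγ hQm hpotter
      (tendsto_nhdsGT_of_mem_Ioc hb hv) t

theorem tendstoInDistribution_fixed_centering
    {Ω : Type*} [MeasurableSpace Ω] {P : Measure Ω} [IsProbabilityMeasure P] {μ : Measure ℝ}
    [IsProbabilityMeasure μ]
    {γ : ℝ} (hγ : 0 < γ) {k : ℕ → ℕ} (hk : ∀ n, 1 ≤ n → 1 ≤ k n ∧ k n ≤ n)
    (hk_top : Tendsto k atTop atTop) (hk_zero : Tendsto (fun n => (k n : ℝ) / n) atTop (𝓝 0))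
    {α : ℝ} (hα : 2 < α) {p : ℕ → ℝ} (hp0 : Tendsto p atTop atTop)
    (hkp : ∀ᶠ n in atTop, (k n : ℝ) = Real.exp (α * p n))
    (hpotter : ∀ ε, 0 < ε → ε < γ → ∀ᶠ v in 𝓝[>] (0 : ℝ),
      NearExp (logExcess γ (quantile μ) v) (γ - ε) (γ + ε) 1)
    {X : ℕ → Ω → ℝ} (hX_indep : iIndepFun X P) (hX_law : ∀ i, HasLaw (X i) μ P)
    {ℓ : ℝ → ℝ} (hℓ : SlowlyVaryingAtZero ℓ)
    (hQ : ∀ s ∈ Ioo (0 : ℝ) 1, quantile μ (1 - s) = s ^ (-γ) * ℓ s)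
    {a : ℝ → ℝ} (ha : SecondOrder ℓ a)
    (hlimsup : limsup (fun n : ℕ => (((p n)⁻¹ *
          Real.log (Real.sqrt (k n) * (a ((k n : ℝ) / n) / ℓ ((k n : ℝ) / n))) : ℝ) : EReal)) atTop
        < ((Real.log 2 : ℝ) : EReal)) :
    TendstoInDistribution
      (fun n ω =>
        let m := excessMean γ (quantile μ) (p n) 0
        let σ := excessStd γ (quantile μ) (p n) 0
        Real.sqrt (k n) * m / σ *
          (p n * ((hillMoment n (k n) (p n) (fun i => X i ω) / m) ^ (1 / p n) - 1)))
      atTop (id : ℝ → ℝ) (fun _ => P) (gaussianReal 0 1) := by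
  have hQm := measurable_quantile μ
  have hb : Tendsto (fun n => 2 * (k n : ℝ) / n) atTop (𝓝 0) := by
    simpa [mul_div_assoc] using hk_zero.const_mul 2
  set d : ℕ → ℝ → ℝ := fun n s =>
    Real.sqrt (k n) * excessMean γ (quantile μ) (p n) 0 / excessStd γ (quantile μ) (p n) 0 *
      (p n * ((s / excessMean γ (quantile μ) (p n) 0) ^ (1 / p n) - 1)) with hd
  have hdm : ∀ n, Measurable (d n) := fun n =>
    (((measurable_id.div_const _).pow_const _).sub_const _).const_mul _ |>.const_mul _
  obtain ⟨C, hC⟩ := ha.exists_bound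
  obtain ⟨K, hK⟩ := ha.exists_doubling hℓ
  obtain ⟨L, hL1, hL2⟩ := EReal.lt_iff_exists_real_btwn.1 hlimsup
  have hL : L < Real.log 2 := EReal.coe_lt_coe_iff.1 hL2
  obtain ⟨ρ, ⟨δ, hδ, hapos, -⟩, -⟩ := ha.regVarying
  obtain ⟨δ', hδ', hℓpos, -⟩ := hℓ.1
  have hn0 : ∀ᶠ n in atTop, (0 : ℝ) < (k n : ℝ) / n := by
    filter_upwards [eventually_ge_atTop 1] with n hn
    have h1 : (0 : ℝ) < k n := by exact_mod_cast (hk n hn).1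
    have h2 : (0 : ℝ) < n := by exact_mod_cast hn
    positivity
  have hx : Tendsto (fun n => (k n : ℝ) / n) atTop (𝓝[>] 0) :=
    tendsto_nhdsWithin_iff.2 ⟨hk_zero, hn0⟩
  have hbx : Tendsto (fun n => 2 * (k n : ℝ) / n) atTop (𝓝[>] 0) :=
    tendsto_nhdsWithin_iff.2 ⟨hb, hn0.mono fun n hn => by
      rw [mem_Ioi, mul_div_assoc]; positivity⟩
  -- the shift `η n` bounds `|log ℓ(uv) - log ℓ(v)| / 4` for all `v ≤ 2 k n / n`
  set η : ℕ → ℝ := fun n => C * (a (2 * (k n : ℝ) / n) / ℓ (2 * (k n : ℝ) / n)) with hη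
  have hη0 : Tendsto η atTop (𝓝 0) := by
    simpa using (ha.negligible.comp hbx).const_mul C
  refine tendstoInDistribution_of_sequences μ γ hk hk_top hk_zero p (d := fun n z => d n z.2)
    (fun n => (hdm n).comp_aemeasurable (aemeasurable_hillMoment hX_law n (k n) (p n)))
    (fun n => (hdm n).comp measurable_snd)
    (fun n => map_hillMoment hX_indep hX_law n (k n) (p n) (hdm n)) fun v hv t => ?_
  refine tendsto_charFun_fixed_centering hp0 hα hkp hγ hQm (v := v)
    (c := fun n => 4 * η n / γ) (C := 4 * (|C| * K) / γ) ?_ ?_ hL ?_ t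
  · filter_upwards [hv, (tendsto_nhdsGT_of_mem_Ioc hb hv).eventually
        (hpotter (γ / 2) (by linarith) (by linarith)), hη0.eventually_le_const
        (show (0 : ℝ) < 1 / 2 by norm_num), hbx.eventually hC,
        hbx.eventually (Ioo_mem_nhdsGT (show (0 : ℝ) < min δ' 1 by positivity))]
      with n hvn hpn hηn hCn hbn
    have hb1 := (lt_min_iff.1 hbn.2)
    have hpos : ∀ s ∈ Ioc 0 (2 * (k n : ℝ) / n), 0 < ℓ s := fun s hs =>
      hℓpos s ⟨hs.1, hs.2.trans_lt hb1.1⟩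
    refine nearExp_of_second_order hQm hγ hQ hb1.2 hηn hpos (fun u hu => ?_) hvn hpn.nonneg
    have := hpos _ ⟨hbn.1, le_rfl⟩
    refine (hCn u hu).trans_eq ?_
    simp only [hη]
    field_simp
  · simpa using (hη0.const_mul 4).div_const γ
  · filter_upwards [eventually_lt_of_limsup_lt hL1, hp0.eventually_gt_atTop 0,
      hx.eventually hK, hx.eventually (Ioo_mem_nhdsGT hδ), hx.eventually (Ioo_mem_nhdsGT hδ'),
      hbx.eventually (Ioo_mem_nhdsGT hδ), hbx.eventually (Ioo_mem_nhdsGT hδ'), hkp]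
      with n hLn hpn hKn h1 h2 h3 h4 hkn
    have e1 := hapos _ h1
    have e2 := hℓpos _ h2
    have e3 := hapos _ h3
    have e4 := hℓpos _ h4
    have hk0 : 0 < Real.sqrt (k n) := Real.sqrt_pos.2 (by rw [hkn]; exact Real.exp_pos _)
    have hz : Real.sqrt (k n) * (a ((k n : ℝ) / n) / ℓ ((k n : ℝ) / n)) ≤
        Real.exp (L * p n) := by
      rw [← Real.log_le_iff_le_exp (by positivity)]
      have h := EReal.coe_lt_coe_iff.1 hLn
      rw [inv_mul_lt_iff₀ hpn] at h
      linarith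
    rw [← mul_div_assoc] at hKn
    have hK0 : 0 ≤ K := by
      by_contra hneg
      have : K * (a ((k n : ℝ) / n) / ℓ ((k n : ℝ) / n)) ≤ 0 :=
        mul_nonpos_of_nonpos_of_nonneg (not_le.1 hneg).le (by positivity)
      exact absurd (hKn.trans this) (not_le.2 (by positivity))
    calc Real.sqrt (k n) * (4 * η n / γ)
        = 4 / γ * Real.sqrt (k n) * (C * (a (2 * (k n : ℝ) / n) / ℓ (2 * (k n : ℝ) / n))) := by
          simp only [hη]; ring
      _ ≤ 4 / γ * Real.sqrt (k n) * (|C| * (K * (a ((k n : ℝ) / n) / ℓ ((k n : ℝ) / n)))) := by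
          gcongr
          exact le_abs_self C
      _ = 4 * (|C| * K) / γ * (Real.sqrt (k n) * (a ((k n : ℝ) / n) / ℓ ((k n : ℝ) / n))) := by
          ring
      _ ≤ 4 * (|C| * K) / γ * Real.exp (L * p n) := by gcongr

end TailIndex

open TailIndex in
theorem mainTheorem3
    {Ω : Type*} [MeasurableSpace Ω] (P : Measure Ω) [IsProbabilityMeasure P]
    (μ : Measure ℝ) [IsProbabilityMeasure μ]
    (X : ℕ → Ω → ℝ) (hX_indep : iIndepFun X P) (hX_law : ∀ i, HasLaw (X i) μ P)
    (γ : ℝ) (hγ : 0 < γ) (ℓ : ℝ → ℝ) (hℓ : SlowlyVaryingAtZero ℓ)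
    (hQ : ∀ s ∈ Ioo (0 : ℝ) 1, quantile μ (1 - s) = s ^ (-γ) * ℓ s)
    (k : ℕ → ℕ) (hk : ∀ n, 1 ≤ n → 1 ≤ k n ∧ k n ≤ n)
    (hk_top : Tendsto k atTop atTop)
    (hk_zero : Tendsto (fun n => (k n : ℝ) / n) atTop (𝓝 0))
    (α : ℝ) (p : ℕ → ℝ) (hp : ∀ n, p n = α⁻¹ * Real.log (k n)) :
    -- consistency
    (1 < α →
      TendstoInMeasure P
        (fun n ω => (hillMoment n (k n) (p n) (fun i => X i ω) / Real.Gamma (p n + 1))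
          ^ (1 / p n))
        atTop (fun _ => γ)) ∧
    -- asymptotic normality with random centering and norming
    (2 < α →
      ∀ U : ℕ → Ω → ℝ, iIndepFun U P → (∀ i, HasLaw (U i) unif01 P) →
      (∀ i, ∀ᵐ ω ∂P, X i ω = quantile μ (1 - U i ω)) →
      TendstoInDistribution
        (fun n ω =>
          let V := orderStat n (fun i => U i ω) (k n + 1)
          let m := excessMean γ (quantile μ) (p n) V
          let σ := excessStd γ (quantile μ) (p n) V
          Real.sqrt (k n) * m / σ *
            (p n * ((hillMoment n (k n) (p n) (fun i => X i ω) / m) ^ (1 / p n) - 1)))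
        atTop (id : ℝ → ℝ) (fun _ => P) (gaussianReal 0 1)) ∧
    -- asymptotic normality with deterministic centering and norming
    (2 < α →
      ∀ a : ℝ → ℝ, SecondOrder ℓ a →
      Tendsto (fun n : ℕ => p n * (a ((k n : ℝ) / n) / ℓ ((k n : ℝ) / n))) atTop (𝓝 0) →
      limsup (fun n : ℕ => (((p n)⁻¹ *
          Real.log (Real.sqrt (k n) * (a ((k n : ℝ) / n) / ℓ ((k n : ℝ) / n))) : ℝ) : EReal)) atTop
        < ((Real.log 2 : ℝ) : EReal) →
      TendstoInDistribution
        (fun n ω =>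
          let m := excessMean γ (quantile μ) (p n) 0
          let σ := excessStd γ (quantile μ) (p n) 0
          Real.sqrt (k n) * m / σ *
            (p n * ((hillMoment n (k n) (p n) (fun i => X i ω) / m) ^ (1 / p n) - 1)))
        atTop (id : ℝ → ℝ) (fun _ => P) (gaussianReal 0 1)) := by
  have hQm := measurable_quantile μ
  have hanti := antitoneOn_quantile_one_sub μ
  have hlogk : Tendsto (fun n => Real.log (k n)) atTop atTop :=
    Real.tendsto_log_atTop.comp (tendsto_natCast_atTop_atTop.comp hk_top)
  have hp_top : 0 < α → Tendsto p atTop atTop := fun hα =>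
    (hlogk.const_mul_atTop (inv_pos.2 hα)).congr fun n => (hp n).symm
  have hkp : 0 < α → ∀ᶠ n in atTop, (k n : ℝ) = Real.exp (α * p n) := fun hα => by
    filter_upwards [eventually_ge_atTop 1] with n hn
    have : (0 : ℝ) < k n := by exact_mod_cast (hk n hn).1
    rw [hp n, mul_inv_cancel_left₀ hα.ne', Real.exp_log this]
  have hpotter : ∀ ε, 0 < ε → ε < γ → ∀ᶠ v in 𝓝[>] (0 : ℝ),
      NearExp (logExcess γ (quantile μ) v) (γ - ε) (γ + ε) 1 := fun ε h0 h1 =>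
    nearExp_logExcess hQm hanti hℓ hQ h0 h1
  refine ⟨fun hα => ?_, fun hα U hU_indep hU_law hXU => ?_, fun hα a ha _ hlimsup => ?_⟩
  · have hα0 : 0 < α := by linarith
    exact tendstoInMeasure_root_hillMoment hγ hk hk_top hk_zero hα (hp_top hα0) (hkp hα0) hpotter
      hX_indep hX_law
  · have hα0 : 0 < α := by linarith
    exact tendstoInDistribution_random_centering hγ hk hk_top hk_zero hα (hp_top hα0) (hkp hα0)
      hpotter hU_indep hU_law hXU
  · have hα0 : 0 < α := by linarith
    exact tendstoInDistribution_fixed_centering hγ hk hk_top hk_zero hα (hp_top hα0) (hkp hα0)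
      hpotter hX_indep hX_law hℓ hQ ha hlimsup
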